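/- Let $W$ be an irreducible finite real reflection group of rank $n\ge 1$ acting on $\mathbf R^n$. Fix a fundamental chamber $C$ with inward unit normals $\alpha_1,\dots,\alpha_n$ (so $C=\{x\mid x\cdot\alpha_i>0 \text{ for all } i\}$), ordered so that $\{\alpha_1,\dots,\alpha_s\}$ and $\{\alpha_{s+1},\dots,\alpha_n\}$ are orthonormal sets. Write $R(v)$ for the reflection in $v^\perp$ and $R_i=R(\alpha_i)$; let $c=R_1R_2\cdots R_n$ be the bipartite Coxeter element, $h$ its order, and $c_+=R_1\cdots R_s$. The roots are the vectors $g(\alpha_i)$, $g\in W$; a root is positive if its inner product with every point of $C$ is positive. Let $\ell(w)$ be the least number of reflections of $W$ whose product is $w$ (so $\ell(1)=0$), write $u\preceq w$ if $\ell(u)+\ell(u^{-1}w)=\ell(w)$, and put $\mathrm{NCP}_c=\{w\in W\mid w\preceq c\}$. Let $M(w)$ be the orthogonal complement of the fixed subspace of $w$. For $w\in \mathrm{NCP}_c$ let $W_w$ be the parabolic subgroup whose reflections are the reflections $t\in W$ with $t\preceq w$, and let $\Pi_w$ be its simple system determined by the chamber of $W_w$ containing $C$. Put $k=|\Pi_w|$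 and $$F(w)=\{x\in\mathbf R^n\mid x\cdot\delta\le 0 \text{ for } \delta\in\Pi_w,\ x\cdot\theta\ge 0\text{ for }\theta\in\Pi_{cw^{-1}}\}.$$ Let $\rho_i=R_1R_2\cdots R_{i-1}(\alpha_i)$ for $i\ge 1$, where the subscripts of $R_j$ and $\alpha_i$ are read modulo $n$, and extend to all $i\in\mathbf Z$ by $\rho_{i+nh}=\rho_i$. Let $EX(c)$ be the simplicial complex with vertices $\rho_{-n+s+1},\dots,\rho_{nh/2+s}$, ordered by their subscripts, with a simplex on $\tau_1<\dots<\tau_m$ exactly when $\ell(R(\tau_1)\cdots R(\tau_m)c)=n-m$. Let $X(w)$ be the subcomplex of simplices all of whose vertices are positive roots lying in $M(w)$; its first and last facets are the lexicographically first and last ones, facets being written as increasing sequences of vertices. Let $AX(c)=c_+(EX(c))$ and let $\mu$ be the linear operator $2(I-c)^{-1}$. **Proposition.** The operator $I-c$ is invertible. Let $w\in\mathrm{NCP}_c$. Then $cw^{-1}\in\mathrm{NCP}_c$ and $|\Pi_{cw^{-1}}|=n-k$. The first facet of $X(cw^{-1})$ exists and has $n-k$ vertices $\epsilon_1,\dots,\epsilon_{n-k}$;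 the last facet of $X(w)$ exists and has $k$ vertices $\eta_{n-k+1},\dots,\eta_n$. The $n$ vectors $$\mu(\epsilon_1),\dots,\mu(\epsilon_{n-k}),\ \mu(c(\eta_{n-k+1})),\dots,\mu(c(\eta_n))$$ are linearly independent, $F(w)$ is the simplicial cone of their nonnegative linear combinations, and the rays (one-dimensional faces) of $F(w)$ are exactly the half-lines generated by these vectors. Moreover each of these vectors is a vertex of the complex $\mu(AX(c))$, so that the rays of $F(w)$ are generated by vertices of $\mu(AX(c))$. -/

import Mathlib

/-- Euclidean space `ℝⁿ`. -/
abbrev Euc (n : ℕ) : Type := EuclideanSpace ℝ (Fin n)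

/-- The group of linear isometries of `ℝⁿ`; multiplication is composition,
`(f * g) x = f (g x)`. -/
abbrev Iso (n : ℕ) : Type := Euc n ≃ₗᵢ[ℝ] Euc n

/-- `reflIn v` is the orthogonal reflection in the hyperplane `v^⊥` (for `v ≠ 0`). -/
noncomputable def reflIn {n : ℕ} (v : Euc n) : Iso n := ((Submodule.span ℝ {v})ᗮ).reflection

/-- The open cone `{x | ∀ i, α_i · x > 0}`. -/
def openCone {n : ℕ} (α : Fin n → Euc n) : Set (Euc n) := {x | ∀ i, 0 < inner ℝ (α i) x}

/-- An irreducible finite real reflection group `W` of rank `n` acting on `ℝⁿ`, together with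
a fundamental chamber (the open simplicial cone `openCone α`) with inward unit normals `α_i`,
ordered so that the first `s` of them, as well as the remaining ones, are mutually orthogonal. -/
structure BipartiteReflectionGroup (n : ℕ) where
  /-- the reflection group -/
  W : Subgroup (Iso n)
  rank_pos : 0 < n
  finite : Finite W
  /-- `W` is generated by the reflections that it contains -/
  generated : Subgroup.closure {t : Iso n | t ∈ W ∧ ∃ v : Euc n, v ≠ 0 ∧ t = reflIn v} = W
  irreducible : ∀ U : Submodule ℝ (Euc n), (∀ g ∈ W, ∀ x ∈ U, g x ∈ U) → U = ⊥ ∨ U = ⊤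
  /-- the inward unit normals of the chamber -/
  α : Fin n → Euc n
  norm_α : ∀ i, ‖α i‖ = 1
  linearIndependent_α : LinearIndependent ℝ α
  /-- the walls of the chamber are reflecting hyperplanes of `W` -/
  refl_α_mem : ∀ i, reflIn (α i) ∈ W
  /-- no reflecting hyperplane of `W` meets the open chamber -/
  chamber : ∀ v : Euc n, v ≠ 0 → reflIn v ∈ W → ∀ x ∈ openCone α, inner ℝ v x ≠ 0
  /-- the size of the first part of the bipartition -/
  s : ℕ
  s_le : s ≤ n
  orthogonal_fst : ∀ i j : Fin n, (i : ℕ) < s → (j : ℕ) < s → i ≠ j → inner ℝ (α i) (α j) = 0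
  orthogonal_snd : ∀ i j : Fin n, s ≤ (i : ℕ) → s ≤ (j : ℕ) → i ≠ j → inner ℝ (α i) (α j) = 0

namespace BipartiteReflectionGroup

variable {n : ℕ} (D : BipartiteReflectionGroup n)

/-- The fundamental chamber. -/
def C : Set (Euc n) := openCone D.α

/-- The set of all reflections in `W`. -/
def reflections : Set (Iso n) := {t | t ∈ D.W ∧ ∃ v : Euc n, v ≠ 0 ∧ t = reflIn v}

/-- The roots: the vectors `g (α_i)`, for `g ∈ W`. -/
def roots : Set (Euc n) := {β | ∃ g ∈ D.W, ∃ i, β = g (D.α i)}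

/-- The bipartite Coxeter element `c = R_1 R_2 ⋯ R_n`. -/
noncomputable def c : Iso n := (List.ofFn fun i => reflIn (D.α i)).prod

/-- The involution `c_+ = R_1 ⋯ R_s`. -/
noncomputable def cPlus : Iso n := ((List.ofFn fun i => reflIn (D.α i)).take D.s).prod

/-- The Coxeter number. -/
noncomputable def h : ℕ := orderOf D.c

/-- Total reflection length; the identity has length `0`. -/
noncomputable def length (w : Iso n) : ℕ :=
  sInf {k | ∃ l : List (Iso n), l.length = k ∧ (∀ t ∈ l, t ∈ D.reflections) ∧ l.prod = w}

/-- The total reflection order `u ⪯ w`. -/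
def le (u w : Iso n) : Prop := D.length u + D.length (u⁻¹ * w) = D.length w

/-- The noncrossing partitions: the elements of `W` below `c`. -/
def NCP : Set (Iso n) := {w | w ∈ D.W ∧ D.le w D.c}

/-- The orthogonal complement of the fixed subspace of `w`. -/
noncomputable def M (w : Iso n) : Submodule ℝ (Euc n) :=
  (LinearMap.ker ((w.toLinearEquiv : Euc n →ₗ[ℝ] Euc n) - LinearMap.id))ᗮ

/-- A vector is positive if its inner product with every point of the chamber is positive. -/
def IsPositive (β : Euc n) : Prop := ∀ x ∈ D.C, 0 < inner ℝ β x

/-- The positive roots of the parabolic subgroup `W_w`, whose reflections are the reflections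
`t` of `W` with `t ⪯ w`. Those roots which are positive on `C` are positive
on the whole chamber of `W_w` that contains `C`. -/
def parabolicPosRoots (w : Iso n) : Set (Euc n) :=
  {β | β ∈ D.roots ∧ D.le (reflIn β) w ∧ D.IsPositive β}

/-- The simple system `Π_w` of `W_w` determined by the chamber of `W_w` that contains `C`: the
positive roots of `W_w` that are not nonnegative combinations of the other positive roots, that
is, the inward unit normals to the walls of that chamber. -/
def simpleSystem (w : Iso n) : Set (Euc n) :=
  {β | β ∈ D.parabolicPosRoots w ∧ β ∉ PointedCone.hull ℝ (D.parabolicPosRoots w \ {β})}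

/-- The cone `F(w)` of all `x` with `x · δ ≤ 0` for `δ` simple for `W_w` and
`x · θ ≥ 0` for `θ` simple for `W_{c w⁻¹}`. -/
def F (w : Iso n) : PointedCone ℝ (Euc n) where
  carrier := {x | (∀ δ ∈ D.simpleSystem w, inner ℝ x δ ≤ 0) ∧
    (∀ θ ∈ D.simpleSystem (D.c * w⁻¹), 0 ≤ inner ℝ x θ)}
  add_mem' := by
    rintro x y ⟨hx, hx'⟩ ⟨hy, hy'⟩
    refine ⟨fun δ hδ => ?_, fun θ hθ => ?_⟩
    · rw [inner_add_left]; exact add_nonpos (hx δ hδ) (hy δ hδ)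
    · rw [inner_add_left]; exact add_nonneg (hx' θ hθ) (hy' θ hθ)
  zero_mem' := by simp
  smul_mem' := by
    rintro ⟨a, ha⟩ x ⟨hx, hx'⟩
    refine ⟨fun δ hδ => ?_, fun θ hθ => ?_⟩
    · change inner ℝ (a • x) δ ≤ 0
      rw [real_inner_smul_left]; exact mul_nonpos_of_nonneg_of_nonpos ha (hx δ hδ)
    · change 0 ≤ inner ℝ (a • x) θ
      rw [real_inner_smul_left]; exact mul_nonneg ha (hx' θ hθ)

/-- `α_i` with the subscript `i` (counted from `0`) read modulo `n`. -/
def cyc (i : ℕ) : Euc n := D.α ⟨i % n, Nat.mod_lt i D.rank_pos⟩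

/-- `rhoNat i = R_1 ⋯ R_i (α_{i+1})`, the subscripts being read modulo `n`. -/
noncomputable def rhoNat (i : ℕ) : Euc n :=
  (((List.range i).map fun j => reflIn (D.cyc j)).prod) (D.cyc i)

/-- The roots `ρ_i = R_1 R_2 ⋯ R_{i-1} (α_i)`, counted from `1`, with `i ∈ ℤ` read
modulo `n h`. -/
noncomputable def rho (i : ℤ) : Euc n := D.rhoNat ((i - 1) % ((n : ℤ) * (D.h : ℤ))).toNat

/-- The product `R(τ_1) ⋯ R(τ_k)`, where `τ_1 < ⋯ < τ_k` are the roots `ρ_i` with `i ∈ I`, in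
increasing order of `i`. -/
noncomputable def reflProd (I : Finset ℤ) : Iso n := (I.sort.map fun i => reflIn (D.rho i)).prod

/-- The simplicial complex `EX(c)` on the vertices `ρ_{-n+s+1}, …, ρ_{nh/2+s}`, which are
recorded by their subscripts: `τ_1 < ⋯ < τ_k` span a simplex when
`ℓ(R(τ_1) ⋯ R(τ_k) c) = n - k`. -/
def EX : Set (Finset ℤ) :=
  {I | (∀ i ∈ I, -(n : ℤ) + D.s + 1 ≤ i ∧ i ≤ ((n * D.h / 2 : ℕ) : ℤ) + D.s) ∧
    D.length (D.reflProd I * D.c) + I.card = n}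

/-- The subcomplex `X(w)` of `EX(c)`: the simplices whose vertices are positive roots
in `M(w)`. -/
def X (w : Iso n) : Set (Finset ℤ) :=
  {I | I ∈ D.EX ∧ ∀ i ∈ I, D.IsPositive (D.rho i) ∧ D.rho i ∈ M w}

/-- The complex `AX(c)`, the image of `EX(c)` under `c_+`; simplices are given by their sets of
vertices, which are vectors in `ℝⁿ`. -/
def AX : Set (Set (Euc n)) :=
  {σ | ∃ I ∈ D.EX, σ = (fun i => D.cPlus (D.rho i)) '' (I : Set ℤ)}

/-- The linear map `I - c`. -/
noncomputable def oneSubC : Module.End ℝ (Euc n) :=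
  1 - (D.c.toLinearEquiv : Euc n →ₗ[ℝ] Euc n)

/-- The operator `μ = 2 (I - c)⁻¹`. -/
noncomputable def mu : Module.End ℝ (Euc n) := (2 : ℝ) • Ring.inverse D.oneSubC

/-- The vectors `μ(ρ_i)`, for `i ∈ I`, and `μ(c(ρ_j))`, for `j ∈ J`. -/
noncomputable def rayVector (I J : Finset ℤ) : I ⊕ J → Euc n :=
  Sum.elim (fun i => D.mu (D.rho i)) (fun j => D.mu (D.c (D.rho j)))

/-- The complex `μ(AX(c))`. -/
def muAX : Set (Set (Euc n)) := {σ | ∃ τ ∈ D.AX, σ = D.mu '' τ}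

end BipartiteReflectionGroup

/-- The vertices of a complex whose simplices are given by their vertex sets. -/
def complexVertices {E : Type*} (K : Set (Set E)) : Set E := {v | {v} ∈ K}

/-- A facet of a complex is a simplex that is maximal for inclusion. -/
def IsFacet (K : Set (Finset ℤ)) (I : Finset ℤ) : Prop := Maximal (· ∈ K) I

/-- `I` is the lexicographically first facet of `K`; facets are compared as increasing
sequences. -/
def IsFirstFacet (K : Set (Finset ℤ)) (I : Finset ℤ) : Prop :=
  IsFacet K I ∧ ∀ J, IsFacet K J → I.sort ≤ J.sort

/-- `I` is the lexicographically last facet of `K`; facets are compared as increasing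
sequences. -/
def IsLastFacet (K : Set (Finset ℤ)) (I : Finset ℤ) : Prop :=
  IsFacet K I ∧ ∀ J, IsFacet K J → J.sort ≤ I.sort

/-- A ray of a cone is a one-dimensional face. -/
def IsRay {E : Type*} [AddCommGroup E] [Module ℝ E] (r K : PointedCone ℝ E) : Prop :=
  r.IsFaceOf K ∧ Module.finrank ℝ (Submodule.span ℝ (r : Set E)) = 1

/-!
Everything rests on the bilinear form `B(x, y) = μ(x) · y` (`form`), whose symmetrization is the
inner product (`form_add_form_swap`), and on its values on the sequence of roots `ρ_i`. The
functionals `-δ`, `δ ∈ Π_w`, and `θ ∈ Π_{c w⁻¹}` that define `F(w)` turn out to be the dual basis of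
the vectors `μ(ε_i)`, `μ(c η_j)`; hence these vectors are linearly independent, they generate `F(w)`
and span its rays (`linearIndependent_of_dual`, `eq_hull_of_dual`, `isRay_iff_of_dual`). There are
three parts to the argument.

*The sequence of roots.* The Perron vector of the Gram matrix (`exists_perron_vector`) gives a plane
(a line if `n = 1`) that is invariant under `c_+` and `c_-`. The inner products of a root with the
vectors `z j` of this plane oscillate with half-period `h` (`halfPeriod_eq_h`), so every root has a
level `L` modulo `2 h` such that its sequence passes upwards through zero at `-L`. The roots of
levels `0` and `1` are `ρ_1, …, ρ_n`, and `c` raises the level by `2`. Thus `ρ_1, …, ρ_{nh/2}` are the positive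
roots (`isPositive_rho`, `exists_rho_eq_of_isPositive`, `rho_injOn`), and the vertices of `EX(c)` are
the roots with level between `-1` and `h` (`mem_range_iff_level`). Since `μ` maps `ρ_1, …, ρ_n` to
the fundamental weights and commutes with `c`, it follows that on the positive roots `B(ρ_i, ρ_j)`
is nonnegative for `i ≤ j` and nonpositive for `i > j` (`form_rho_nonneg`, `form_rho_nonpos`).

*Lengths.* By Carter's lemma (`length_eq_finrank_M`), `ℓ(g)` is the dimension of `M(g)`. So `EX(c)`
is the flag complex in which `ρ_i` and `ρ_j`, `i < j`, are joined when `B(ρ_j, ρ_i) = 0`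
(`mem_EX_iff`), its simplices are linearly independent (`card_le_of_mem_EX`), and `M(c w⁻¹)` and
`M(w)` are orthogonal in the sense that `B(x, y) = 0` for `x` in the first and `y` in the second
(`form_eq_zero_of_mem`).

*Facets.* The simple system of a noncrossing partition `u`, ordered along the sequence `ρ`, is
triangular: `B(δ, δ') = 0` for `δ` before `δ'` (`form_eq_zero_of_mem_simpleSystem`). Therefore its
dual bases on either side of `B` are again made of roots (`exists_left_dual_root`,
`exists_right_dual_root`). A dual root `x` pairs nonnegatively with the positive roots of `M(u)`, and
`B(x, x) = 1`, so `x` is positive. Because of the signs of the form, the left dual basis is the first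
facet of `X(u)` and the right dual basis is the last one (`exists_isFirstFacet`,
`exists_isLastFacet`). With `B(c x, y) = -B(y, x)` this gives the duality stated at the outset.

Finally `ε = c_+ (c_+ ε)` and `c η = c_+ (c_- η)`, where `c_+` and `c_-` map positive roots to
vertices of `EX(c)` (`exists_rho_eq_cPlus`, `exists_rho_eq_cMinus`).
-/

/-! ### Reflections and fixed spaces of isometries -/

section Reflections

variable {n : ℕ}

theorem iso_mul_apply (f g : Iso n) (x : Euc n) : (f * g) x = f (g x) := rfl

theorem iso_inv_apply_apply (g : Iso n) (x : Euc n) : g⁻¹ (g x) = x := g.symm_apply_apply x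

theorem iso_apply_inv_apply (g : Iso n) (x : Euc n) : g (g⁻¹ x) = x := g.apply_symm_apply x

theorem reflIn_apply {v : Euc n} (hv : ‖v‖ = 1) (x : Euc n) :
    reflIn v x = x - (2 * inner ℝ v x) • v := by
  rw [reflIn, Submodule.reflection_orthogonal_apply, Submodule.reflection_singleton_apply, hv]
  simp only [RCLike.ofReal_real_eq_id, id_eq, one_pow, div_one]
  rw [neg_sub, mul_smul, two_smul, two_smul]

theorem reflIn_self (v : Euc n) : reflIn v v = -v :=
  Submodule.reflection_orthogonalComplement_singleton_eq_neg v

theorem reflIn_smul {c : ℝ} (hc : c ≠ 0) (v : Euc n) : reflIn (c • v) = reflIn v := by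
  have h : Submodule.span ℝ {c • v} = Submodule.span ℝ {v} :=
    Submodule.span_singleton_smul_eq (IsUnit.mk0 c hc) v
  unfold reflIn
  simp only [h]

theorem reflIn_neg (v : Euc n) : reflIn (-v) = reflIn v := by
  simpa using reflIn_smul (c := -1) (by norm_num) v

theorem reflIn_mul_self (v : Euc n) : reflIn v * reflIn v = 1 :=
  Submodule.reflection_mul_reflection _

theorem reflIn_inv (v : Euc n) : (reflIn v)⁻¹ = reflIn v :=
  inv_eq_of_mul_eq_one_left (reflIn_mul_self v)

theorem reflIn_apply_apply (v x : Euc n) : reflIn v (reflIn v x) = x :=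
  Submodule.reflection_reflection _ x

theorem reflIn_conj (g : Iso n) {v : Euc n} (hv : ‖v‖ = 1) :
    reflIn (g v) = g * reflIn v * g⁻¹ := by
  ext1 x
  have hgv : ‖g v‖ = 1 := by rw [LinearIsometryEquiv.norm_map, hv]
  have e : g (g⁻¹ x) = x := g.apply_symm_apply x
  have hx : inner ℝ (g v) x = inner ℝ v (g⁻¹ x) := by
    rw [← g.inner_map_map v, e]
  rw [iso_mul_apply, iso_mul_apply, reflIn_apply hgv,
    reflIn_apply hv, map_sub, map_smul, e, hx]

/-- An isometry moving `x` by `v` is corrected at `x` by the reflection in `v`. -/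
theorem reflIn_sub_apply (g : Iso n) (x : Euc n) : reflIn (g x - x) (g x) = x :=
  Submodule.reflection_sub (by simp)

theorem reflIn_eq_self_of_inner_eq_zero {v x : Euc n} (h : inner ℝ v x = 0) : reflIn v x = x :=
  Submodule.reflection_mem_subspace_eq_self
    ((Submodule.mem_orthogonal_singleton_iff_inner_right).2 h)

theorem inner_eq_zero_of_reflIn_eq_self {v x : Euc n} (h : reflIn v x = x) : inner ℝ v x = 0 :=
  (Submodule.mem_orthogonal_singleton_iff_inner_right).1 ((Submodule.reflection_eq_self_iff x).1 h)

/-- The fixed subspace of an isometry. -/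
noncomputable def fixSpace (g : Iso n) : Submodule ℝ (Euc n) :=
  LinearMap.ker ((g.toLinearEquiv : Euc n →ₗ[ℝ] Euc n) - LinearMap.id)

theorem mem_fixSpace {g : Iso n} {x : Euc n} : x ∈ fixSpace g ↔ g x = x := by
  simp [fixSpace, sub_eq_zero]

end Reflections

namespace BipartiteReflectionGroup

variable {n : ℕ}

theorem M_eq_orthogonal_fixSpace (g : Iso n) : M g = (fixSpace g)ᗮ := rfl

theorem orthogonal_M (g : Iso n) : (M g)ᗮ = fixSpace g := Submodule.orthogonal_orthogonal _

theorem finrank_fixSpace_add_finrank_M (g : Iso n) :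
    Module.finrank ℝ (fixSpace g) + Module.finrank ℝ (M g) = n := by
  rw [M_eq_orthogonal_fixSpace, (fixSpace g).finrank_add_finrank_orthogonal,
    finrank_euclideanSpace_fin]

theorem inner_eq_zero_of_mem_M {g : Iso n} {x y : Euc n} (hx : x ∈ fixSpace g) (hy : y ∈ M g) :
    inner ℝ x y = 0 :=
  (Submodule.mem_orthogonal _ _).1 hy x hx

/-- The range of `g - 1` is orthogonal to the fixed space of `g`. -/
theorem apply_sub_mem_M (g : Iso n) (x : Euc n) : g x - x ∈ M g := by
  refine (Submodule.mem_orthogonal _ _).2 fun y hy => ?_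
  have hy' := mem_fixSpace.1 hy
  rw [inner_sub_right, sub_eq_zero]
  nth_rewrite 1 [← hy']
  exact g.inner_map_map y x

theorem exists_apply_sub_eq {g : Iso n} {y : Euc n} (hy : y ∈ M g) : ∃ x, g x - x = y := by
  have hle : LinearMap.range ((g.toLinearEquiv : Euc n →ₗ[ℝ] Euc n) - LinearMap.id) ≤ M g := by
    rintro _ ⟨x, rfl⟩
    exact apply_sub_mem_M g x
  have h1 := LinearMap.finrank_range_add_finrank_ker
    ((g.toLinearEquiv : Euc n →ₗ[ℝ] Euc n) - LinearMap.id)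
  have h2 := finrank_fixSpace_add_finrank_M g
  rw [fixSpace] at h2
  rw [finrank_euclideanSpace_fin] at h1
  have h3 := Submodule.eq_of_le_of_finrank_eq hle (by omega)
  rw [← h3] at hy
  obtain ⟨x, hx⟩ := hy
  exact ⟨x, hx⟩

theorem M_mul_le (a b : Iso n) : M (a * b) ≤ M a ⊔ M b := by
  have h : (M a ⊔ M b)ᗮ ≤ (M (a * b))ᗮ := by
    rw [← Submodule.inf_orthogonal, orthogonal_M, orthogonal_M, orthogonal_M]
    rintro x ⟨h1, h2⟩
    rw [SetLike.mem_coe, mem_fixSpace] at h1 h2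
    rw [mem_fixSpace, iso_mul_apply, h2, h1]
  have := Submodule.orthogonal_le h
  rwa [Submodule.orthogonal_orthogonal, Submodule.orthogonal_orthogonal] at this

theorem finrank_M_mul_le (a b : Iso n) :
    Module.finrank ℝ (M (a * b)) ≤ Module.finrank ℝ (M a) + Module.finrank ℝ (M b) :=
  (Submodule.finrank_mono (M_mul_le a b)).trans (Submodule.finrank_add_le_finrank_add_finrank _ _)

theorem fixSpace_reflIn (v : Euc n) : fixSpace (reflIn v) = (Submodule.span ℝ {v})ᗮ := by
  ext x
  rw [mem_fixSpace, reflIn, Submodule.reflection_eq_self_iff]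

theorem M_reflIn (v : Euc n) : M (reflIn v) = Submodule.span ℝ {v} := by
  rw [M_eq_orthogonal_fixSpace, fixSpace_reflIn, Submodule.orthogonal_orthogonal]

theorem finrank_M_reflIn {v : Euc n} (hv : v ≠ 0) : Module.finrank ℝ (M (reflIn v)) = 1 := by
  rw [M_reflIn, finrank_span_singleton hv]

theorem finrank_M_conj (a g : Iso n) :
    Module.finrank ℝ (M (a * g * a⁻¹)) = Module.finrank ℝ (M g) := by
  have key : ∀ a g : Iso n, Module.finrank ℝ (fixSpace g) ≤
      Module.finrank ℝ (fixSpace (a * g * a⁻¹)) := by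
    intro a g
    have hle : (fixSpace g).map (a.toLinearEquiv : Euc n →ₗ[ℝ] Euc n) ≤
        fixSpace (a * g * a⁻¹) := by
      rintro _ ⟨x, hx, rfl⟩
      rw [SetLike.mem_coe, mem_fixSpace] at hx
      rw [mem_fixSpace]
      change a (g (a.symm (a x))) = a x
      rw [a.symm_apply_apply, hx]
    have := Submodule.finrank_mono hle
    rwa [LinearEquiv.finrank_map_eq] at this
  have h1 := key a g
  have h2 := key a⁻¹ (a * g * a⁻¹)
  have h3 : a⁻¹ * (a * g * a⁻¹) * a⁻¹⁻¹ = g := by group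
  rw [h3] at h2
  have h4 := finrank_fixSpace_add_finrank_M g
  have h5 := finrank_fixSpace_add_finrank_M (a * g * a⁻¹)
  omega

theorem fixSpace_le_fixSpace_reflIn_mul {g : Iso n} {v : Euc n} (hv : v ∈ M g) :
    fixSpace g ≤ fixSpace (reflIn v * g) := by
  intro x hx
  have h1 := inner_eq_zero_of_mem_M hx hv
  rw [mem_fixSpace] at hx ⊢
  rw [iso_mul_apply, hx]
  exact reflIn_eq_self_of_inner_eq_zero (by rwa [real_inner_comm])

theorem finrank_M_le_reflIn_mul (g : Iso n) {v : Euc n} (hv : v ≠ 0) :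
    Module.finrank ℝ (M g) ≤ Module.finrank ℝ (M (reflIn v * g)) + 1 := by
  have h := finrank_M_mul_le (reflIn v) (reflIn v * g)
  rw [← mul_assoc, reflIn_mul_self, one_mul, finrank_M_reflIn hv] at h
  omega

/-- Multiplying by the reflection in a vector of `M g` lowers the dimension of `M g` by one. -/
theorem finrank_M_reflIn_mul {g : Iso n} {v : Euc n} (hv : v ≠ 0) (hg : v ∈ M g) :
    Module.finrank ℝ (M (reflIn v * g)) + 1 = Module.finrank ℝ (M g) := by
  obtain ⟨x, hx⟩ := exists_apply_sub_eq hg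
  have hlt : fixSpace g < fixSpace (reflIn v * g) := by
    refine lt_of_le_of_ne (fixSpace_le_fixSpace_reflIn_mul hg) fun h => ?_
    have hx1 : x ∈ fixSpace (reflIn v * g) := by
      rw [mem_fixSpace, iso_mul_apply, ← hx]
      exact reflIn_sub_apply g x
    rw [← h, mem_fixSpace] at hx1
    rw [hx1, sub_self] at hx
    exact hv hx.symm
  have h1 := Submodule.finrank_lt_finrank_of_lt hlt
  have h2 := finrank_M_le_reflIn_mul g hv
  have h3 := finrank_fixSpace_add_finrank_M g
  have h4 := finrank_fixSpace_add_finrank_M (reflIn v * g)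
  omega

theorem mem_M_of_finrank_lt {g : Iso n} {v : Euc n}
    (h : Module.finrank ℝ (M (reflIn v * g)) < Module.finrank ℝ (M g)) : v ∈ M g := by
  have h3 := finrank_fixSpace_add_finrank_M g
  have h4 := finrank_fixSpace_add_finrank_M (reflIn v * g)
  have hnle : ¬ fixSpace (reflIn v * g) ≤ fixSpace g := fun hle => by
    have := Submodule.finrank_mono hle
    omega
  obtain ⟨x, hx, hx'⟩ := SetLike.not_le_iff_exists.1 hnle
  rw [mem_fixSpace] at hx hx'
  rw [iso_mul_apply] at hx
  have h5 : g x = reflIn v x := by rw [← hx, reflIn_apply_apply, hx]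
  have h6 := apply_sub_mem_M (reflIn v) x
  rw [M_reflIn, ← h5] at h6
  obtain ⟨a, ha⟩ := Submodule.mem_span_singleton.1 h6
  have ha0 : a ≠ 0 := by
    rintro rfl
    rw [zero_smul] at ha
    exact hx' (sub_eq_zero.1 ha.symm)
  have h7 : v = a⁻¹ • (g x - x) := by rw [← ha, smul_smul, inv_mul_cancel₀ ha0, one_smul]
  rw [h7]
  exact Submodule.smul_mem _ _ (apply_sub_mem_M g x)

theorem mem_M_iff_finrank {g : Iso n} {v : Euc n} (hv : v ≠ 0) :
    v ∈ M g ↔ Module.finrank ℝ (M (reflIn v * g)) + 1 = Module.finrank ℝ (M g) :=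
  ⟨finrank_M_reflIn_mul hv, fun h => mem_M_of_finrank_lt (by omega)⟩

end BipartiteReflectionGroup

/-! ### Positive roots and simple reflections -/

namespace BipartiteReflectionGroup

variable {n : ℕ} (D : BipartiteReflectionGroup n)

/-- The inward unit normals of the chamber, as a basis of `ℝⁿ`. -/
noncomputable def basisα : Module.Basis (Fin n) ℝ (Euc n) :=
  have : Nonempty (Fin n) := ⟨⟨0, D.rank_pos⟩⟩
  basisOfLinearIndependentOfCardEqFinrank D.linearIndependent_α (by simp)

theorem basisα_apply (i : Fin n) : D.basisα i = D.α i := by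
  simp [basisα]

/-- The fundamental weights: the basis dual to the simple roots with respect to the inner
product. Thus `inner ℝ (D.ω i) x` is the coefficient of `α_i` in `x`. -/
noncomputable def ω (i : Fin n) : Euc n :=
  (InnerProductSpace.toDual ℝ (Euc n)).symm (LinearMap.toContinuousLinearMap (D.basisα.coord i))

theorem inner_ω (i : Fin n) (x : Euc n) : inner ℝ (D.ω i) x = D.basisα.repr x i := by
  rw [ω, InnerProductSpace.toDual_symm_apply]
  rfl

theorem inner_ω_α (i j : Fin n) : inner ℝ (D.ω i) (D.α j) = if i = j then 1 else 0 := by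
  rw [inner_ω, ← basisα_apply, Module.Basis.repr_self, Finsupp.single_apply]
  simp only [eq_comm]

theorem inner_α_ω (i j : Fin n) : inner ℝ (D.α i) (D.ω j) = if i = j then 1 else 0 := by
  rw [real_inner_comm, inner_ω_α]
  simp only [eq_comm]

theorem sum_inner_ω_smul_α (x : Euc n) : ∑ i, inner ℝ (D.ω i) x • D.α i = x := by
  simp_rw [inner_ω, ← basisα_apply]
  exact D.basisα.sum_repr x

theorem inner_eq_sum (x y : Euc n) :
    inner ℝ x y = ∑ i, inner ℝ (D.ω i) x * inner ℝ (D.α i) y := by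
  conv_lhs => rw [← D.sum_inner_ω_smul_α x]
  rw [sum_inner]
  simp_rw [real_inner_smul_left]

theorem ext_inner_α {x y : Euc n} (h : ∀ i, inner ℝ (D.α i) x = inner ℝ (D.α i) y) : x = y := by
  refine ext_inner_left ℝ fun v => ?_
  rw [D.inner_eq_sum v x, D.inner_eq_sum v y]
  simp_rw [h]

theorem ext_inner_ω {x y : Euc n} (h : ∀ i, inner ℝ (D.ω i) x = inner ℝ (D.ω i) y) : x = y := by
  rw [← D.sum_inner_ω_smul_α x, ← D.sum_inner_ω_smul_α y]
  simp_rw [h]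

theorem mem_C_of_sum {t : Fin n → ℝ} (ht : ∀ i, 0 < t i) : ∑ i, t i • D.ω i ∈ D.C := by
  intro j
  rw [inner_sum]
  simp_rw [real_inner_smul_right, inner_α_ω]
  simpa using ht j

/-- The unit normals of the reflecting hyperplanes. They turn out to be the roots, see
`roots_eq_unitRoots`. -/
def unitRoots : Set (Euc n) := {v | ‖v‖ = 1 ∧ reflIn v ∈ D.W}

variable {D}

theorem α_mem_unitRoots (i : Fin n) : D.α i ∈ D.unitRoots := ⟨D.norm_α i, D.refl_α_mem i⟩

theorem neg_mem_unitRoots {v : Euc n} (hv : v ∈ D.unitRoots) : -v ∈ D.unitRoots :=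
  ⟨by rw [norm_neg, hv.1], by rw [reflIn_neg]; exact hv.2⟩

theorem apply_mem_unitRoots {g : Iso n} (hg : g ∈ D.W) {v : Euc n} (hv : v ∈ D.unitRoots) :
    g v ∈ D.unitRoots := by
  refine ⟨by rw [LinearIsometryEquiv.norm_map, hv.1], ?_⟩
  rw [reflIn_conj g hv.1]
  exact D.W.mul_mem (D.W.mul_mem hg hv.2) (D.W.inv_mem hg)

theorem ne_zero_of_mem_unitRoots {v : Euc n} (hv : v ∈ D.unitRoots) : v ≠ 0 := by
  rintro rfl
  simpa using hv.1

theorem inner_self_of_mem_unitRoots {v : Euc n} (hv : v ∈ D.unitRoots) : inner ℝ v v = (1 : ℝ) := by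
  rw [real_inner_self_eq_norm_sq, hv.1, one_pow]

/-- The simple coefficients of a root have the same sign: otherwise the hyperplane of the root
would meet the chamber. -/
theorem nonneg_or_nonpos_of_mem_unitRoots {v : Euc n} (hv : v ∈ D.unitRoots) :
    (∀ i, 0 ≤ inner ℝ (D.ω i) v) ∨ ∀ i, inner ℝ (D.ω i) v ≤ 0 := by
  by_contra! h
  obtain ⟨⟨j, hj⟩, ⟨i, hi⟩⟩ := h
  have key : ∀ t : Fin n → ℝ, (∀ i, 0 < t i) → ∑ l, t l * inner ℝ (D.ω l) v ≠ 0 := by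
    intro t ht h0
    refine D.chamber v (ne_zero_of_mem_unitRoots hv) hv.2 _ (D.mem_C_of_sum ht) ?_
    rw [real_inner_comm, sum_inner]
    simpa only [real_inner_smul_left] using h0
  -- enlarging one weight of `∑ ω` moves the value of `v` at it to zero
  have upd : ∀ (l : Fin n) (r : ℝ), ∑ m, (1 + if m = l then r else 0) * inner ℝ (D.ω m) v
      = ∑ m, inner ℝ (D.ω m) v + r * inner ℝ (D.ω l) v := by
    intro l r
    simp [add_mul, Finset.sum_add_distrib]
  set A := ∑ m, inner ℝ (D.ω m) v with hA
  have go : ∀ (l : Fin n) (r : ℝ), 0 ≤ r → A + r * inner ℝ (D.ω l) v ≠ 0 := by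
    intro l r hr
    rw [← upd l r]
    refine key _ fun m => ?_
    split_ifs <;> linarith
  rcases le_total 0 A with h | h
  · refine go j (A / -inner ℝ (D.ω j) v) (div_nonneg h (by linarith)) ?_
    rw [div_neg, neg_mul, div_mul_cancel₀ _ hj.ne, add_neg_cancel]
  · refine go i (-A / inner ℝ (D.ω i) v) (div_nonneg (by linarith) hi.le) ?_
    rw [div_mul_cancel₀ _ hi.ne', add_neg_cancel]

theorem isPositive_iff {v : Euc n} (hv : v ≠ 0) :
    D.IsPositive v ↔ ∀ i, 0 ≤ inner ℝ (D.ω i) v := by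
  constructor
  · intro h i
    by_contra! hi
    -- `ω_i` plus a small multiple of the other weights lies in the chamber
    set A := ∑ m, inner ℝ (D.ω m) v with hA
    set r := |A| / -inner ℝ (D.ω i) v with hr
    have hr0 : 0 ≤ r := div_nonneg (abs_nonneg _) (by linarith)
    have h1 := h _ (D.mem_C_of_sum (t := fun m => 1 + if m = i then r else 0) (fun m => by
      split_ifs <;> linarith))
    rw [real_inner_comm, sum_inner] at h1
    simp only [real_inner_smul_left] at h1
    have h2 : ∑ m, (1 + if m = i then r else 0) * inner ℝ (D.ω m) v
      = A + r * inner ℝ (D.ω i) v := by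
      simp [add_mul, Finset.sum_add_distrib, hA]
    have h3 : r * inner ℝ (D.ω i) v = -|A| := by
      rw [hr, div_neg, neg_mul, div_mul_cancel₀ _ hi.ne]
    rw [h2, h3] at h1
    linarith [le_abs_self A]
  · intro h x hx
    rw [D.inner_eq_sum]
    have hne : ∃ i, inner ℝ (D.ω i) v ≠ 0 := by
      by_contra! h0
      exact hv (D.ext_inner_ω fun i => by rw [h0 i, inner_zero_right])
    obtain ⟨i, hi⟩ := hne
    exact Finset.sum_pos' (fun j _ => mul_nonneg (h j) (hx j).le)
      ⟨i, Finset.mem_univ i, mul_pos (lt_of_le_of_ne (h i) (Ne.symm hi)) (hx i)⟩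

theorem isPositive_iff_of_mem {v : Euc n} (hv : v ∈ D.unitRoots) :
    D.IsPositive v ↔ ∀ i, 0 ≤ inner ℝ (D.ω i) v :=
  isPositive_iff (ne_zero_of_mem_unitRoots hv)

theorem isPositive_or_isPositive_neg {v : Euc n} (hv : v ∈ D.unitRoots) :
    D.IsPositive v ∨ D.IsPositive (-v) := by
  rw [isPositive_iff_of_mem hv, isPositive_iff_of_mem (neg_mem_unitRoots hv)]
  refine (nonneg_or_nonpos_of_mem_unitRoots hv).imp_right fun h i => ?_
  rw [inner_neg_right]
  linarith [h i]

variable (D) in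
theorem exists_mem_C : ∃ x, x ∈ D.C := ⟨_, D.mem_C_of_sum (t := fun _ => 1) fun _ => one_pos⟩

theorem not_isPositive_neg {v : Euc n} (h : D.IsPositive v) : ¬ D.IsPositive (-v) := by
  intro h'
  obtain ⟨x, hx⟩ := D.exists_mem_C
  have h1 := h x hx
  have h2 := h' x hx
  rw [inner_neg_left] at h2
  linarith

theorem isPositive_α (i : Fin n) : D.IsPositive (D.α i) := fun _ hx => hx i

/-- If the coefficient of a root at `α_j` is positive, so is the root. -/
theorem isPositive_of_pos {v : Euc n} (hv : v ∈ D.unitRoots) {j : Fin n}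
    (hj : 0 < inner ℝ (D.ω j) v) : D.IsPositive v := by
  rw [isPositive_iff_of_mem hv]
  rcases nonneg_or_nonpos_of_mem_unitRoots hv with h | h
  · exact h
  · linarith [h j]

/-- The reflection in the simple root `α_i`. -/
noncomputable def S (D : BipartiteReflectionGroup n) (i : Fin n) : Iso n := reflIn (D.α i)

theorem S_mem (i : Fin n) : D.S i ∈ D.W := D.refl_α_mem i

theorem S_apply (i : Fin n) (x : Euc n) :
    D.S i x = x - (2 * inner ℝ (D.α i) x) • D.α i := reflIn_apply (D.norm_α i) x

theorem inner_ω_S_of_ne {i j : Fin n} (h : j ≠ i) (x : Euc n) :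
    inner ℝ (D.ω j) (D.S i x) = inner ℝ (D.ω j) x := by
  rw [S_apply, inner_sub_right, real_inner_smul_right, inner_ω_α, if_neg h]
  ring

theorem inner_ω_S_self (i : Fin n) (x : Euc n) :
    inner ℝ (D.ω i) (D.S i x) = inner ℝ (D.ω i) x - 2 * inner ℝ (D.α i) x := by
  rw [S_apply, inner_sub_right, real_inner_smul_right, inner_ω_α, if_pos rfl]
  ring

/-- Distinct walls of the chamber meet at an angle that is not obtuse. -/
theorem inner_α_nonpos {i j : Fin n} (h : i ≠ j) : inner ℝ (D.α i) (D.α j) ≤ 0 := by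
  have hm := apply_mem_unitRoots (D.S_mem i) (D.α_mem_unitRoots j)
  have h1 : 0 < inner ℝ (D.ω j) (D.S i (D.α j)) := by
    rw [inner_ω_S_of_ne h.symm, inner_ω_α, if_pos rfl]
    exact one_pos
  have h2 := (isPositive_iff_of_mem hm).1 (isPositive_of_pos hm h1) i
  rw [inner_ω_S_self, inner_ω_α, if_neg h] at h2
  linarith

theorem eq_α_of_forall_eq_zero {v : Euc n} (hv : v ∈ D.unitRoots) (hp : D.IsPositive v)
    {i : Fin n} (h : ∀ j, j ≠ i → inner ℝ (D.ω j) v = 0) : v = D.α i := by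
  have h1 : v = inner ℝ (D.ω i) v • D.α i := by
    conv_lhs => rw [← D.sum_inner_ω_smul_α v]
    refine Finset.sum_eq_single i (fun j _ hj => ?_) (by simp)
    rw [h j hj, zero_smul]
  have h2 := hv.1
  rw [h1, norm_smul, D.norm_α, mul_one,
    Real.norm_of_nonneg ((isPositive_iff_of_mem hv).1 hp i)] at h2
  rw [h1, h2, one_smul]

/-- A simple reflection permutes the positive roots other than its own. -/
theorem isPositive_S_apply {v : Euc n} (hv : v ∈ D.unitRoots) (hp : D.IsPositive v)
    {i : Fin n} (h : v ≠ D.α i) : D.IsPositive (D.S i v) := by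
  have hne : ∃ j, j ≠ i ∧ inner ℝ (D.ω j) v ≠ 0 := by
    by_contra! h0
    exact h (eq_α_of_forall_eq_zero hv hp h0)
  obtain ⟨j, hj, hj'⟩ := hne
  refine isPositive_of_pos (apply_mem_unitRoots (D.S_mem i) hv) (j := j) ?_
  rw [inner_ω_S_of_ne hj]
  exact lt_of_le_of_ne ((isPositive_iff_of_mem hv).1 hp j) (Ne.symm hj')

variable (D) in
/-- The subgroup generated by the simple reflections; it is `W`, see `simpleSubgroup_eq`. -/
noncomputable def simpleSubgroup : Subgroup (Iso n) := Subgroup.closure (Set.range D.S)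

theorem simpleSubgroup_le : D.simpleSubgroup ≤ D.W := by
  rw [simpleSubgroup, Subgroup.closure_le]
  rintro _ ⟨i, rfl⟩
  exact S_mem i

theorem S_mem_simpleSubgroup (i : Fin n) : D.S i ∈ D.simpleSubgroup :=
  Subgroup.subset_closure ⟨i, rfl⟩

/-- The lowest positive root in the orbit of a positive root is simple. -/
theorem exists_simpleSubgroup_apply_eq_α {v : Euc n} (hv : v ∈ D.unitRoots)
    (hp : D.IsPositive v) : ∃ g ∈ D.simpleSubgroup, ∃ i, g v = D.α i := by
  have := D.finite
  have hfin : {g : Iso n | g ∈ D.simpleSubgroup ∧ D.IsPositive (g v)}.Finite :=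
    (Set.toFinite (D.W : Set (Iso n))).subset fun g hg => simpleSubgroup_le hg.1
  obtain ⟨g, ⟨hg, hgp⟩, hmin⟩ := Set.exists_min_image _
    (fun g : Iso n => ∑ j, inner ℝ (D.ω j) (g v)) hfin ⟨1, D.simpleSubgroup.one_mem, hp⟩
  have hgv := apply_mem_unitRoots (simpleSubgroup_le hg) hv
  have hex : ∃ i, 0 < inner ℝ (D.α i) (g v) := by
    by_contra! h0
    have h1 := D.inner_eq_sum (g v) (g v)
    rw [inner_self_of_mem_unitRoots hgv] at h1
    have h2 : ∑ i, inner ℝ (D.ω i) (g v) * inner ℝ (D.α i) (g v) ≤ 0 :=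
      Finset.sum_nonpos fun i _ =>
        mul_nonpos_of_nonneg_of_nonpos ((isPositive_iff_of_mem hgv).1 hgp i) (h0 i)
    linarith
  obtain ⟨i, hi⟩ := hex
  refine ⟨g, hg, i, ?_⟩
  by_contra hne
  have hp' : D.IsPositive ((D.S i * g) v) := by
    rw [iso_mul_apply]
    exact isPositive_S_apply hgv hgp hne
  have h1 := hmin (D.S i * g) ⟨D.simpleSubgroup.mul_mem (S_mem_simpleSubgroup i) hg, hp'⟩
  simp only [iso_mul_apply] at h1
  have h2 : ∑ j, inner ℝ (D.ω j) (D.S i (g v)) < ∑ j, inner ℝ (D.ω j) (g v) := by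
    refine Finset.sum_lt_sum (fun j _ => ?_) ⟨i, Finset.mem_univ i, ?_⟩
    · rcases eq_or_ne j i with rfl | hj
      · rw [inner_ω_S_self]
        linarith
      · rw [inner_ω_S_of_ne hj]
    · rw [inner_ω_S_self]
      linarith
  linarith

theorem exists_eq_simpleSubgroup_apply {v : Euc n} (hv : v ∈ D.unitRoots) :
    ∃ g ∈ D.simpleSubgroup, ∃ i, v = g (D.α i) := by
  rcases isPositive_or_isPositive_neg hv with h | h
  · obtain ⟨g, hg, i, hi⟩ := exists_simpleSubgroup_apply_eq_α hv h
    refine ⟨g⁻¹, D.simpleSubgroup.inv_mem hg, i, ?_⟩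
    rw [← hi, iso_inv_apply_apply]
  · obtain ⟨g, hg, i, hi⟩ := exists_simpleSubgroup_apply_eq_α (neg_mem_unitRoots hv) h
    refine ⟨g⁻¹ * D.S i, D.simpleSubgroup.mul_mem (D.simpleSubgroup.inv_mem hg)
      (S_mem_simpleSubgroup i), i, ?_⟩
    rw [iso_mul_apply, S, reflIn_self, ← hi, map_neg, iso_inv_apply_apply, neg_neg]

theorem simpleSubgroup_eq : D.simpleSubgroup = D.W := by
  refine le_antisymm simpleSubgroup_le ?_
  rw [← D.generated, Subgroup.closure_le]
  rintro _ ⟨hW, v, hv, rfl⟩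
  have hv' : ‖v‖ ≠ 0 := by rwa [norm_ne_zero_iff]
  have h1 : reflIn (‖v‖⁻¹ • v) = reflIn v := reflIn_smul (inv_ne_zero hv') v
  have h2 : ‖v‖⁻¹ • v ∈ D.unitRoots := by
    refine ⟨?_, by rwa [h1]⟩
    rw [norm_smul, norm_inv, norm_norm, inv_mul_cancel₀ hv']
  obtain ⟨g, hg, i, hi⟩ := exists_eq_simpleSubgroup_apply h2
  rw [← h1, hi, reflIn_conj g (D.norm_α i)]
  exact D.simpleSubgroup.mul_mem (D.simpleSubgroup.mul_mem hg (S_mem_simpleSubgroup i))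
    (D.simpleSubgroup.inv_mem hg)

theorem roots_eq_unitRoots : D.roots = D.unitRoots := by
  ext v
  constructor
  · rintro ⟨g, hg, i, rfl⟩
    exact apply_mem_unitRoots hg (α_mem_unitRoots i)
  · intro hv
    obtain ⟨g, hg, i, hi⟩ := exists_eq_simpleSubgroup_apply hv
    exact ⟨g, simpleSubgroup_le hg, i, hi⟩

variable (D) in
theorem finite_roots : D.roots.Finite := by
  have := D.finite
  have h : D.roots = Set.range fun q : D.W × Fin n => (q.1 : Iso n) (D.α q.2) := by
    ext v
    constructor
    · rintro ⟨g, hg, i, rfl⟩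
      exact ⟨(⟨g, hg⟩, i), rfl⟩
    · rintro ⟨⟨g, i⟩, rfl⟩
      exact ⟨g, g.2, i, rfl⟩
  rw [h]
  exact Set.finite_range _

variable (D) in
theorem finite_unitRoots : D.unitRoots.Finite := roots_eq_unitRoots (D := D) ▸ D.finite_roots

theorem mem_reflections_iff {t : Iso n} : t ∈ D.reflections ↔ ∃ v ∈ D.unitRoots, t = reflIn v := by
  constructor
  · rintro ⟨hW, v, hv, rfl⟩
    have hv' : ‖v‖ ≠ 0 := by rwa [norm_ne_zero_iff]
    have h1 : reflIn (‖v‖⁻¹ • v) = reflIn v := reflIn_smul (inv_ne_zero hv') v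
    refine ⟨‖v‖⁻¹ • v, ⟨?_, by rwa [h1]⟩, h1.symm⟩
    rw [norm_smul, norm_inv, norm_norm, inv_mul_cancel₀ hv']
  · rintro ⟨v, hv, rfl⟩
    exact ⟨hv.2, v, ne_zero_of_mem_unitRoots hv, rfl⟩

/-! ### Stabilizers and reflection length -/

/-- The exchange condition. -/
theorem exists_shorter_word (l : List (Fin n)) {i : Fin n}
    (h : D.IsPositive (-((l.map D.S).prod (D.α i)))) :
    ∃ l' : List (Fin n), l'.length + 1 = l.length ∧
      (l.map D.S).prod * D.S i = (l'.map D.S).prod := by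
  induction l with
  | nil => exact absurd h (not_isPositive_neg (isPositive_α i))
  | cons j l ih =>
    have hW : (l.map D.S).prod ∈ D.W := Subgroup.list_prod_mem _ fun g hg => by
      obtain ⟨k, -, rfl⟩ := List.mem_map.1 hg
      exact S_mem k
    have hm := apply_mem_unitRoots hW (α_mem_unitRoots (D := D) i)
    rcases isPositive_or_isPositive_neg hm with hp | hp
    · rw [List.map_cons, List.prod_cons, iso_mul_apply] at h
      have he : (l.map D.S).prod (D.α i) = D.α j := by
        by_contra hne
        exact not_isPositive_neg (isPositive_S_apply hm hp hne) h
      refine ⟨l, by simp, ?_⟩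
      have h2 := reflIn_conj (l.map D.S).prod (D.norm_α i)
      rw [he] at h2
      rw [List.map_cons, List.prod_cons]
      change reflIn (D.α j) * _ * reflIn (D.α i) = _
      rw [h2]
      have h3 := reflIn_mul_self (D.α i)
      simp only [mul_assoc, inv_mul_cancel_left, h3, mul_one]
    · obtain ⟨l', hl, hl'⟩ := ih hp
      refine ⟨j :: l', by simp [← hl], ?_⟩
      simp only [List.map_cons, List.prod_cons, mul_assoc, hl']

theorem exists_word {g : Iso n} (hg : g ∈ D.W) : ∃ l : List (Fin n), (l.map D.S).prod = g := by
  rw [← simpleSubgroup_eq] at hg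
  induction hg using Subgroup.closure_induction with
  | mem x hx =>
    obtain ⟨i, rfl⟩ := hx
    exact ⟨[i], by simp⟩
  | one => exact ⟨[], rfl⟩
  | mul x y _ _ hx hy =>
    obtain ⟨l, rfl⟩ := hx
    obtain ⟨l', rfl⟩ := hy
    exact ⟨l ++ l', by simp⟩
  | inv x _ hx =>
    obtain ⟨l, rfl⟩ := hx
    refine ⟨l.reverse, ?_⟩
    rw [List.prod_inv_reverse, List.map_reverse, List.map_map]
    refine congrArg List.prod (congrArg List.reverse (List.map_congr_left fun i _ => ?_))
    exact (reflIn_inv _).symm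

/-- The group acts freely on the orbit of the chamber. -/
theorem eq_one_of_apply_eq_of_mem_C {g : Iso n} (hg : g ∈ D.W) {x : Euc n} (hx : x ∈ D.C)
    (h : g x = x) : g = 1 := by
  classical
  have hex : ∃ k, ∃ l : List (Fin n), l.length = k ∧ (l.map D.S).prod = g := by
    obtain ⟨l, hl⟩ := exists_word hg
    exact ⟨_, l, rfl, hl⟩
  obtain ⟨l, hlen, hl⟩ := Nat.find_spec hex
  have hpos : ∀ i, D.IsPositive (g (D.α i)) := by
    intro i
    refine (isPositive_or_isPositive_neg (apply_mem_unitRoots hg (α_mem_unitRoots i))).resolve_right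
      fun hn => ?_
    have h1 := hn x hx
    have h2 : inner ℝ (g (D.α i)) x = inner ℝ (D.α i) x := by
      nth_rewrite 1 [← h]
      exact g.inner_map_map _ _
    rw [inner_neg_left, h2] at h1
    linarith [hx i]
  rcases List.eq_nil_or_concat l with rfl | ⟨l₁, i, rfl⟩
  · simpa using hl.symm
  · exfalso
    have hW : (l₁.map D.S).prod ∈ D.W := Subgroup.list_prod_mem _ fun g hg => by
      obtain ⟨k, -, rfl⟩ := List.mem_map.1 hg
      exact S_mem k
    have hgi : g (D.α i) = -(l₁.map D.S).prod (D.α i) := by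
      rw [← hl]
      simp [S, reflIn_self, iso_mul_apply]
    have hneg : D.IsPositive (-((l₁.map D.S).prod (D.α i))) := hgi ▸ hpos i
    obtain ⟨l', hl', he⟩ := exists_shorter_word l₁ hneg
    refine Nat.find_min hex (m := l'.length) ?_ ⟨l', rfl, ?_⟩
    · rw [← hlen, List.length_concat]
      omega
    · rw [← he, ← hl]
      simp

/-- The group acts freely on the complement of the reflecting hyperplanes. -/
theorem eq_one_of_apply_eq {g : Iso n} (hg : g ∈ D.W) {x : Euc n}
    (hx : ∀ v ∈ D.unitRoots, inner ℝ v x ≠ 0) (h : g x = x) : g = 1 := by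
  have := D.finite
  obtain ⟨y, hy⟩ := D.exists_mem_C
  -- the translate of `x` closest to a point of the chamber lies in the chamber
  obtain ⟨a, ha, hmax⟩ := Set.exists_max_image (D.W : Set (Iso n)) (fun a => inner ℝ (a x) y)
    (Set.toFinite _) ⟨1, D.W.one_mem⟩
  have haC : a x ∈ D.C := by
    intro i
    have h0 : inner ℝ (D.α i) (a x) ≠ 0 := by
      have := hx (a⁻¹ (D.α i)) (apply_mem_unitRoots (D.W.inv_mem ha) (α_mem_unitRoots i))
      rwa [← a.inner_map_map, iso_apply_inv_apply] at this
    have h1 := hmax (D.S i * a) (D.W.mul_mem (S_mem i) ha)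
    simp only [iso_mul_apply] at h1
    rw [S_apply, inner_sub_left, real_inner_smul_left] at h1
    have h2 := hy i
    have h3 : 0 ≤ inner ℝ (D.α i) (a x) := by
      by_contra! hneg
      nlinarith
    exact lt_of_le_of_ne h3 (Ne.symm h0)
  have h1 : a * g * a⁻¹ = 1 := by
    refine eq_one_of_apply_eq_of_mem_C (D.W.mul_mem (D.W.mul_mem ha hg) (D.W.inv_mem ha)) haC ?_
    rw [iso_mul_apply, iso_mul_apply, iso_inv_apply_apply, h]
  exact conj_eq_one_iff.1 h1

/-- Some root is orthogonal to the fixed space of a nontrivial element of `W`: otherwise the fixed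
space would contain a point off all reflecting hyperplanes. -/
theorem exists_unitRoot_mem_M {g : Iso n} (hg : g ∈ D.W) (h1 : g ≠ 1) :
    ∃ v ∈ D.unitRoots, v ∈ M g := by
  by_contra! hno
  have : Finite D.unitRoots := D.finite_unitRoots
  let p : D.unitRoots → Subspace ℝ (fixSpace g) := fun v =>
    LinearMap.ker ((innerₛₗ ℝ (v : Euc n)).comp (fixSpace g).subtype)
  have hcov : ⋃ v, (p v : Set (fixSpace g)) = Set.univ := by
    refine Set.eq_univ_of_forall fun x => ?_
    by_contra hx
    refine h1 (eq_one_of_apply_eq hg (x := x) (fun v hv h0 => hx ?_) (mem_fixSpace.1 x.2))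
    exact Set.mem_iUnion.2 ⟨⟨v, hv⟩, by simpa [p] using h0⟩
  obtain ⟨v, hv⟩ := Subspace.exists_eq_top_of_iUnion_eq_univ hcov
  refine hno v v.2 ((Submodule.mem_orthogonal _ _).2 fun x hx => ?_)
  have : (⟨x, hx⟩ : fixSpace g) ∈ p v := by rw [hv]; trivial
  rw [real_inner_comm]
  simpa [p] using this

theorem M_one : M (1 : Iso n) = ⊥ := by
  rw [M_eq_orthogonal_fixSpace, Submodule.orthogonal_eq_bot_iff, eq_top_iff]
  intro x _
  exact mem_fixSpace.2 rfl

/-- An element of `W` is a product of `dim M g` reflections. -/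
theorem exists_reflection_word (k : ℕ) : ∀ g ∈ D.W, Module.finrank ℝ (M g) = k →
    ∃ l : List (Iso n), l.length = k ∧ (∀ t ∈ l, t ∈ D.reflections) ∧ l.prod = g := by
  induction k with
  | zero =>
    intro g hg hk
    refine ⟨[], rfl, by simp, ?_⟩
    by_contra hne
    obtain ⟨v, hv, hvM⟩ := exists_unitRoot_mem_M hg (Ne.symm hne)
    rw [Submodule.finrank_eq_zero.1 hk, Submodule.mem_bot] at hvM
    exact ne_zero_of_mem_unitRoots hv hvM
  | succ k ih =>
    intro g hg hk
    have hne : g ≠ 1 := by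
      rintro rfl
      rw [M_one] at hk
      simp at hk
    obtain ⟨v, hv, hvM⟩ := exists_unitRoot_mem_M hg hne
    have h1 := finrank_M_reflIn_mul (ne_zero_of_mem_unitRoots hv) hvM
    obtain ⟨l, hl, hlt, hlp⟩ := ih (reflIn v * g) (D.W.mul_mem hv.2 hg) (by omega)
    refine ⟨reflIn v :: l, by simp [hl], ?_, ?_⟩
    · intro t ht
      rcases List.mem_cons.1 ht with rfl | ht
      · exact mem_reflections_iff.2 ⟨v, hv, rfl⟩
      · exact hlt t ht
    · rw [List.prod_cons, hlp, ← mul_assoc, reflIn_mul_self, one_mul]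

theorem finrank_M_prod_le (l : List (Iso n)) (hl : ∀ t ∈ l, t ∈ D.reflections) :
    Module.finrank ℝ (M l.prod) ≤ l.length := by
  induction l with
  | nil =>
    rw [List.prod_nil, M_one]
    simp
  | cons t l ih =>
    obtain ⟨-, v, hv, rfl⟩ := hl t (by simp)
    have h1 := finrank_M_mul_le (reflIn v) l.prod
    rw [finrank_M_reflIn hv] at h1
    have h2 := ih fun t ht => hl t (by simp [ht])
    rw [List.prod_cons, List.length_cons]
    omega

/-- Carter's lemma: the reflection length is the codimension of the fixed space. -/
theorem length_eq_finrank_M {g : Iso n} (hg : g ∈ D.W) :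
    D.length g = Module.finrank ℝ (M g) := by
  refine le_antisymm (Nat.sInf_le (exists_reflection_word _ g hg rfl)) ?_
  refine le_csInf ⟨_, exists_reflection_word _ g hg rfl⟩ ?_
  rintro k ⟨l, rfl, hl, rfl⟩
  exact finrank_M_prod_le l hl

theorem M_prod_le_span (l : List (Iso n)) (hl : ∀ t ∈ l, t ∈ D.reflections) :
    ∃ s : Finset (Euc n), (s : Set (Euc n)) ⊆ D.unitRoots ∧ s.card ≤ l.length ∧
      M l.prod ≤ Submodule.span ℝ (s : Set (Euc n)) := by
  classical
  induction l with
  | nil => exact ⟨∅, by simp, by simp, by simp [M_one]⟩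
  | cons t l ih =>
    obtain ⟨v, hv, rfl⟩ := mem_reflections_iff.1 (hl t (by simp))
    obtain ⟨s, hs, hc, hM⟩ := ih fun t ht => hl t (by simp [ht])
    refine ⟨insert v s, ?_, ?_, ?_⟩
    · rw [Finset.coe_insert]
      exact Set.insert_subset hv hs
    · exact (Finset.card_insert_le _ _).trans (by simpa using hc)
    · rw [List.prod_cons]
      refine (M_mul_le _ _).trans (sup_le ?_ ?_)
      · rw [M_reflIn]
        exact Submodule.span_mono (by simp)
      · exact hM.trans (Submodule.span_mono (by simp))

/-- The space `M g` is spanned by the roots that it contains: the roots of a shortest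
factorization of `g` into reflections span it. -/
theorem span_unitRoots_inter_M {g : Iso n} (hg : g ∈ D.W) :
    Submodule.span ℝ (D.unitRoots ∩ M g) = M g := by
  refine le_antisymm (Submodule.span_le.2 Set.inter_subset_right) ?_
  obtain ⟨l, hlen, hl, hp⟩ := exists_reflection_word _ g hg rfl
  obtain ⟨s, hs, hc, hM⟩ := M_prod_le_span l hl
  rw [hp] at hM
  have h1 := finrank_span_finset_le_card (R := ℝ) s
  have h2 : M g = Submodule.span ℝ (s : Set (Euc n)) :=
    Submodule.eq_of_le_of_finrank_le hM (by
      change Module.finrank ℝ (Submodule.span ℝ (s : Set (Euc n))) ≤ _ at h1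
      omega)
  have h3 : (s : Set (Euc n)) ⊆ D.unitRoots ∩ M g :=
    Set.subset_inter hs (h2 ▸ Submodule.subset_span)
  nth_rewrite 1 [h2]
  exact Submodule.span_mono h3

end BipartiteReflectionGroup

/-! ### The Perron vector of the Gram matrix -/

namespace BipartiteReflectionGroup

variable {n : ℕ} {D : BipartiteReflectionGroup n}

theorem apply_mem_of_forall_S {U : Submodule ℝ (Euc n)} (h : ∀ i, ∀ x ∈ U, D.S i x ∈ U)
    {g : Iso n} (hg : g ∈ D.W) {x : Euc n} (hx : x ∈ U) : g x ∈ U := by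
  obtain ⟨l, rfl⟩ := exists_word hg
  induction l with
  | nil => exact hx
  | cons i l ih =>
    rw [List.map_cons, List.prod_cons, iso_mul_apply]
    refine h i _ (ih ?_)
    exact Subgroup.list_prod_mem _ fun g hg => by
      obtain ⟨k, -, rfl⟩ := List.mem_map.1 hg
      exact S_mem k

theorem eq_zero_of_forall_quadratic_nonneg {A B : ℝ} (h : ∀ t : ℝ, 0 ≤ t * A + t ^ 2 * B) :
    A = 0 := by
  rcases le_or_gt B 0 with hB | hB
  · have := h (-A)
    nlinarith [sq_nonneg A, mul_nonneg (sq_nonneg A) (neg_nonneg.2 hB)]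
  · have h1 := h (-A / (2 * B))
    have h2 : -A / (2 * B) * A + (-A / (2 * B)) ^ 2 * B = -(A ^ 2 / (4 * B)) := by
      field_simp
      ring
    rw [h2] at h1
    have h3 : 0 ≤ A ^ 2 / (4 * B) := by positivity
    have h4 : A ^ 2 / (4 * B) = 0 := by linarith
    rcases div_eq_zero_iff.1 h4 with h5 | h5
    · exact pow_eq_zero_iff (two_ne_zero) |>.1 h5
    · linarith

variable (D) in
/-- The Gram matrix of the simple roots has an eigenvector with positive entries. It is a
minimizer of the quadratic form on the unit sphere, taken with nonnegative entries, which are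
positive because `W` is irreducible. -/
theorem exists_perron_vector : ∃ κ : ℝ, 0 < κ ∧ ∃ e : Euc n, (∀ i, 0 < inner ℝ (D.ω i) e) ∧
    ∀ i, inner ℝ (D.α i) e = κ * inner ℝ (D.ω i) e := by
  let f : Euc n → Euc n := fun u => ∑ j, u j • D.α j
  have hfc : Continuous fun u => ‖f u‖ ^ 2 := by
    simp only [f]
    fun_prop
  have hcoef : ∀ u i, inner ℝ (D.ω i) (f u) = u i := by
    intro u i
    simp only [f]
    rw [inner_sum]
    simp_rw [real_inner_smul_right, inner_ω_α]
    simp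
  have hf0 : ∀ u, f u = 0 → u = 0 := by
    intro u hu
    ext i
    rw [← hcoef u i, hu, inner_zero_right]
    rfl
  have hcpt : IsCompact (Metric.sphere (0 : Euc n) 1) := isCompact_sphere 0 1
  have hne : (Metric.sphere (0 : Euc n) 1).Nonempty :=
    ⟨EuclideanSpace.single ⟨0, D.rank_pos⟩ 1, by simp⟩
  obtain ⟨u₀, hu₀, hmin₀⟩ := hcpt.exists_isMinOn hne hfc.continuousOn
  -- replacing the entries by their absolute values does not increase the form
  have hnormsq : ∀ u : Euc n, ‖f u‖ ^ 2 = ∑ i, ∑ j, u i * u j * inner ℝ (D.α i) (D.α j) := by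
    intro u
    rw [← real_inner_self_eq_norm_sq]
    simp only [f]
    rw [sum_inner]
    refine Finset.sum_congr rfl fun i _ => ?_
    rw [inner_sum]
    refine Finset.sum_congr rfl fun j _ => ?_
    rw [real_inner_smul_left, real_inner_smul_right]
    ring
  let u : Euc n := WithLp.toLp 2 fun i => |u₀ i|
  have hu_apply : ∀ i, u i = |u₀ i| := fun i => rfl
  have hu1 : ‖u‖ = 1 := by
    have h1 : ‖u₀‖ = 1 := by simpa using hu₀
    rw [EuclideanSpace.norm_eq] at h1 ⊢
    rw [← h1]
    simp [hu_apply]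
  have hle : ‖f u‖ ^ 2 ≤ ‖f u₀‖ ^ 2 := by
    rw [hnormsq, hnormsq]
    refine Finset.sum_le_sum fun i _ => Finset.sum_le_sum fun j _ => ?_
    rw [hu_apply, hu_apply, ← abs_mul]
    rcases eq_or_ne i j with rfl | hij
    · rw [abs_mul_self]
    · exact mul_le_mul_of_nonpos_right (le_abs_self _) (inner_α_nonpos hij)
  set κ := ‖f u‖ ^ 2 with hκ
  have hu0 : u ≠ 0 := by
    intro h
    rw [h, norm_zero] at hu1
    exact zero_ne_one hu1
  have hκ0 : 0 < κ := by
    have : f u ≠ 0 := fun h => hu0 (hf0 u h)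
    positivity
  have hmin : ∀ x : Euc n, κ * ‖x‖ ^ 2 ≤ ‖f x‖ ^ 2 := by
    intro x
    rcases eq_or_ne x 0 with rfl | hx
    · simp
    have hx' : 0 < ‖x‖ := norm_pos_iff.2 hx
    have hmem : ‖x‖⁻¹ • x ∈ Metric.sphere (0 : Euc n) 1 := by
      simp [norm_smul, hx'.ne']
    have h1 : ‖f u₀‖ ^ 2 ≤ ‖f (‖x‖⁻¹ • x)‖ ^ 2 := hmin₀ hmem
    have h2 : f (‖x‖⁻¹ • x) = ‖x‖⁻¹ • f x := by
      simp only [f, Finset.smul_sum, smul_smul, PiLp.smul_apply, smul_eq_mul]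
    rw [h2, norm_smul, norm_inv, norm_norm, mul_pow] at h1
    have h3 := hle.trans h1
    calc κ * ‖x‖ ^ 2 ≤ (‖x‖⁻¹ ^ 2 * ‖f x‖ ^ 2) * ‖x‖ ^ 2 := by gcongr
      _ = ‖f x‖ ^ 2 := by field_simp
  have heig : ∀ i, inner ℝ (D.α i) (f u) = κ * u i := by
    intro i
    have hq : ∀ t : ℝ, 0 ≤ t * (2 * (inner ℝ (D.α i) (f u) - κ * u i)) + t ^ 2 * (1 - κ) := by
      intro t
      have h1 := hmin (u + t • EuclideanSpace.single i 1)
      have h2 : f (u + t • EuclideanSpace.single i 1) = f u + t • D.α i := by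
        simp only [f, PiLp.add_apply, PiLp.smul_apply, add_smul, Finset.sum_add_distrib,
          smul_eq_mul]
        congr 1
        rw [Finset.sum_eq_single i]
        · simp
        · intro j _ hj
          simp [hj]
        · simp
      rw [h2, norm_add_sq_real, norm_add_sq_real, hu1, real_inner_smul_right,
        real_inner_smul_right, norm_smul, norm_smul, D.norm_α, EuclideanSpace.inner_single_right,
        real_inner_comm, ← hκ] at h1
      simp only [PiLp.norm_single, norm_one, conj_trivial, one_mul, mul_one,
        Real.norm_eq_abs, sq_abs] at h1
      linarith
    have := eq_zero_of_forall_quadratic_nonneg hq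
    linarith
  have hun : ∀ i, 0 ≤ u i := fun i => abs_nonneg _
  have horth : ∀ i j, u i = 0 → u j ≠ 0 → inner ℝ (D.α i) (D.α j) = 0 := by
    intro i j hi hj
    have h1 := heig i
    rw [hi, mul_zero] at h1
    simp only [f] at h1
    rw [inner_sum] at h1
    have h2 : ∀ k ∈ Finset.univ, inner ℝ (D.α i) (u k • D.α k) ≤ 0 := by
      intro k _
      rw [real_inner_smul_right]
      rcases eq_or_ne i k with rfl | hik
      · simp [hi]
      · exact mul_nonpos_of_nonneg_of_nonpos (hun k) (inner_α_nonpos hik)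
    have h3 := (Finset.sum_eq_zero_iff_of_nonpos h2).1 h1 j (Finset.mem_univ j)
    rw [real_inner_smul_right] at h3
    exact (mul_eq_zero.1 h3).resolve_left hj
  have hpos : ∀ i, u i ≠ 0 := by
    intro i hi
    let U : Submodule ℝ (Euc n) := Submodule.span ℝ {x | ∃ j, u j ≠ 0 ∧ x = D.α j}
    have hinv : ∀ g ∈ D.W, ∀ x ∈ U, g x ∈ U := by
      intro g hg x hx
      refine apply_mem_of_forall_S (fun k y hy => ?_) hg hx
      by_cases hk : u k = 0
      · have hky : inner ℝ (D.α k) y = 0 := by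
          induction hy using Submodule.span_induction with
          | mem y hy =>
            obtain ⟨j, hj, rfl⟩ := hy
            exact horth k j hk hj
          | zero => exact inner_zero_right _
          | add y z _ _ hy hz => rw [inner_add_right, hy, hz, add_zero]
          | smul a y _ hy => rw [real_inner_smul_right, hy, mul_zero]
        rw [S_apply, hky, mul_zero, zero_smul, sub_zero]
        exact hy
      · rw [S_apply]
        exact U.sub_mem hy (U.smul_mem _ (Submodule.subset_span ⟨k, hk, rfl⟩))
    rcases D.irreducible U hinv with h | h
    · obtain ⟨j, hj⟩ : ∃ j, u j ≠ 0 := by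
        by_contra! h0
        exact hu0 (by ext j; exact h0 j)
      have : D.α j ∈ U := Submodule.subset_span ⟨j, hj, rfl⟩
      rw [h, Submodule.mem_bot] at this
      exact D.linearIndependent_α.ne_zero j this
    · have hmem : D.α i ∈ U := by rw [h]; trivial
      have h0 : ∀ y ∈ U, inner ℝ (D.α i) y = 0 := by
        intro y hy
        induction hy using Submodule.span_induction with
        | mem y hy =>
          obtain ⟨j, hj, rfl⟩ := hy
          exact horth i j hi hj
        | zero => exact inner_zero_right _
        | add y z _ _ hy hz => rw [inner_add_right, hy, hz, add_zero]
        | smul a y _ hy => rw [real_inner_smul_right, hy, mul_zero]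
      have h1 := h0 _ hmem
      rw [inner_self_eq_zero] at h1
      exact D.linearIndependent_α.ne_zero i h1
  refine ⟨κ, hκ0, f u, fun i => ?_, fun i => ?_⟩
  · rw [hcoef]
    exact lt_of_le_of_ne (hun i) (Ne.symm (hpos i))
  · rw [hcoef, heig]

/-! ### The bipartite Coxeter element -/

variable (D) in
/-- The product `R_1 ⋯ R_i` of the first `i` simple reflections, read cyclically. -/
noncomputable def prefixProd (i : ℕ) : Iso n :=
  ((List.range i).map fun j => reflIn (D.cyc j)).prod

variable (D) in
/-- The involution `c_- = R_{s+1} ⋯ R_n`. -/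
noncomputable def cMinus : Iso n := ((List.ofFn fun i => reflIn (D.α i)).drop D.s).prod

theorem c_eq : D.c = D.cPlus * D.cMinus := (List.prod_take_mul_prod_drop _ _).symm

theorem prefixProd_zero : D.prefixProd 0 = 1 := rfl

theorem prefixProd_succ (i : ℕ) :
    D.prefixProd (i + 1) = D.prefixProd i * reflIn (D.cyc i) := by
  simp [prefixProd, List.range_succ]

theorem cyc_of_lt {i : ℕ} (hi : i < n) : D.cyc i = D.α ⟨i, hi⟩ := by
  simp only [cyc, Nat.mod_eq_of_lt hi]

theorem ofFn_eq_map_range :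
    (List.ofFn fun i => reflIn (D.α i)) = (List.range n).map fun j => reflIn (D.cyc j) := by
  refine List.ext_getElem (by simp) fun i h1 h2 => ?_
  have hi : i < n := by simpa using h1
  simp [cyc_of_lt hi]

theorem prefixProd_n : D.prefixProd n = D.c := by
  rw [prefixProd, c, ofFn_eq_map_range]

theorem prefixProd_s : D.prefixProd D.s = D.cPlus := by
  rw [prefixProd, cPlus, ofFn_eq_map_range, ← List.map_take, List.take_range, min_eq_left D.s_le]

/-- The simple coefficients of `R_1 ⋯ R_i x`, for `i` in the first block. -/
theorem inner_ω_prefixProd {i : ℕ} (hi : i ≤ D.s) (j : Fin n) (x : Euc n) :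
    inner ℝ (D.ω j) (D.prefixProd i x) =
      inner ℝ (D.ω j) x - if (j : ℕ) < i then 2 * inner ℝ (D.α j) x else 0 := by
  induction i generalizing x with
  | zero => simp [prefixProd_zero]
  | succ i ih =>
    have hin : i < n := lt_of_lt_of_le hi D.s_le
    rw [prefixProd_succ, iso_mul_apply, cyc_of_lt hin, ih (by omega)]
    change inner ℝ (D.ω j) (D.S ⟨i, hin⟩ x) - _ = _
    rcases eq_or_ne j ⟨i, hin⟩ with rfl | hj
    · rw [inner_ω_S_self]
      simp
    · rw [inner_ω_S_of_ne hj]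
      have hj' : (j : ℕ) ≠ i := fun h => hj (Fin.ext h)
      by_cases hlt : (j : ℕ) < i
      · rw [if_pos hlt, if_pos (by omega)]
        change _ - 2 * inner ℝ (D.α j) (D.S ⟨i, hin⟩ x) = _
        rw [S_apply, inner_sub_right, real_inner_smul_right,
          D.orthogonal_fst j ⟨i, hin⟩ (by omega) (by simpa using hi) hj]
        ring
      · rw [if_neg hlt, if_neg (by omega)]

theorem inner_ω_cPlus (j : Fin n) (x : Euc n) :
    inner ℝ (D.ω j) (D.cPlus x) =
      inner ℝ (D.ω j) x - if (j : ℕ) < D.s then 2 * inner ℝ (D.α j) x else 0 := by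
  rw [← prefixProd_s, inner_ω_prefixProd le_rfl]

theorem exists_prefixProd_eq {i : ℕ} (hs : D.s ≤ i) (hi : i ≤ n) :
    ∃ g : Iso n, D.prefixProd i = D.cPlus * g ∧ ∀ (j : Fin n) (x : Euc n),
      inner ℝ (D.ω j) (g x) =
        inner ℝ (D.ω j) x - if D.s ≤ (j : ℕ) ∧ (j : ℕ) < i then 2 * inner ℝ (D.α j) x else 0 := by
  induction i, hs using Nat.le_induction with
  | base =>
    refine ⟨1, by rw [prefixProd_s, mul_one], fun j x => ?_⟩
    rw [if_neg (by omega), sub_zero]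
    rfl
  | succ i hs ih =>
    obtain ⟨g, hg, hgx⟩ := ih (by omega)
    have hin : i < n := by omega
    refine ⟨g * D.S ⟨i, hin⟩, ?_, fun j x => ?_⟩
    · rw [prefixProd_succ, hg, cyc_of_lt hin, mul_assoc, S]
    · rw [iso_mul_apply, hgx]
      rcases eq_or_ne j ⟨i, hin⟩ with rfl | hj
      · rw [inner_ω_S_self]
        simp [hs]
      · rw [inner_ω_S_of_ne hj]
        have hj' : (j : ℕ) ≠ i := fun h => hj (Fin.ext h)
        by_cases hlt : D.s ≤ (j : ℕ) ∧ (j : ℕ) < i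
        · rw [if_pos hlt, if_pos (by omega), S_apply, inner_sub_right, real_inner_smul_right,
            D.orthogonal_snd j ⟨i, hin⟩ hlt.1 hs hj]
          ring
        · rw [if_neg hlt, if_neg (by omega)]

theorem inner_ω_cMinus (j : Fin n) (x : Euc n) :
    inner ℝ (D.ω j) (D.cMinus x) =
      inner ℝ (D.ω j) x - if D.s ≤ (j : ℕ) then 2 * inner ℝ (D.α j) x else 0 := by
  obtain ⟨g, hg, hgx⟩ := exists_prefixProd_eq (D := D) D.s_le le_rfl
  rw [prefixProd_n, c_eq] at hg
  rw [mul_left_cancel hg, hgx]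
  simp

theorem cPlus_apply_of_orthogonal {x : Euc n}
    (h : ∀ j : Fin n, (j : ℕ) < D.s → inner ℝ (D.α j) x = 0) : D.cPlus x = x := by
  refine D.ext_inner_ω fun j => ?_
  rw [inner_ω_cPlus]
  split_ifs with hj
  · rw [h j hj, mul_zero, sub_zero]
  · rw [sub_zero]

theorem cMinus_apply_of_orthogonal {x : Euc n}
    (h : ∀ j : Fin n, D.s ≤ (j : ℕ) → inner ℝ (D.α j) x = 0) : D.cMinus x = x := by
  refine D.ext_inner_ω fun j => ?_
  rw [inner_ω_cMinus]
  split_ifs with hj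
  · rw [h j hj, mul_zero, sub_zero]
  · rw [sub_zero]

theorem cPlus_mem : D.cPlus ∈ D.W := by
  refine Subgroup.list_prod_mem _ fun g hg => ?_
  obtain ⟨i, rfl⟩ := List.mem_ofFn.1 (List.mem_of_mem_take hg)
  exact D.refl_α_mem i

theorem cMinus_mem : D.cMinus ∈ D.W := by
  refine Subgroup.list_prod_mem _ fun g hg => ?_
  obtain ⟨i, rfl⟩ := List.mem_ofFn.1 (List.mem_of_mem_drop hg)
  exact D.refl_α_mem i

theorem c_mem : D.c ∈ D.W := by
  rw [c_eq]
  exact D.W.mul_mem cPlus_mem cMinus_mem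

theorem cPlus_α_of_lt {i : Fin n} (hi : (i : ℕ) < D.s) : D.cPlus (D.α i) = -D.α i := by
  refine D.ext_inner_ω fun j => ?_
  rw [inner_ω_cPlus, inner_neg_right, inner_ω_α]
  rcases eq_or_ne j i with rfl | hj
  · rw [if_pos hi, if_pos rfl, real_inner_self_eq_norm_sq, D.norm_α]
    norm_num
  · rw [if_neg hj]
    split_ifs with h
    · rw [D.orthogonal_fst j i h hi hj]
      norm_num
    · norm_num

theorem cMinus_α_of_le {i : Fin n} (hi : D.s ≤ (i : ℕ)) : D.cMinus (D.α i) = -D.α i := by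
  refine D.ext_inner_ω fun j => ?_
  rw [inner_ω_cMinus, inner_neg_right, inner_ω_α]
  rcases eq_or_ne j i with rfl | hj
  · rw [if_pos hi, if_pos rfl, real_inner_self_eq_norm_sq, D.norm_α]
    norm_num
  · rw [if_neg hj]
    split_ifs with h
    · rw [D.orthogonal_snd j i h hi hj]
      norm_num
    · norm_num

theorem sub_cPlus (x : Euc n) :
    x - D.cPlus x = ∑ j : Fin n, (if (j : ℕ) < D.s then 2 * inner ℝ (D.α j) x else 0) • D.α j := by
  rw [← D.sum_inner_ω_smul_α (x - D.cPlus x)]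
  refine Finset.sum_congr rfl fun j _ => ?_
  rw [inner_sub_right, inner_ω_cPlus, sub_sub_cancel]

theorem sub_cMinus (x : Euc n) :
    x - D.cMinus x = ∑ j : Fin n, (if D.s ≤ (j : ℕ) then 2 * inner ℝ (D.α j) x else 0) • D.α j := by
  rw [← D.sum_inner_ω_smul_α (x - D.cMinus x)]
  refine Finset.sum_congr rfl fun j _ => ?_
  rw [inner_sub_right, inner_ω_cMinus, sub_sub_cancel]

theorem cPlus_cPlus (x : Euc n) : D.cPlus (D.cPlus x) = x := by
  have h : D.cPlus (x - D.cPlus x) = -(x - D.cPlus x) := by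
    rw [sub_cPlus, map_sum, ← Finset.sum_neg_distrib]
    refine Finset.sum_congr rfl fun j _ => ?_
    split_ifs with hj
    · rw [map_smul, cPlus_α_of_lt hj, smul_neg]
    · simp
  rw [map_sub] at h
  have h' : D.cPlus x - D.cPlus (D.cPlus x) = D.cPlus x - x := by rw [h]; abel
  exact sub_right_injective h'

theorem cMinus_cMinus (x : Euc n) : D.cMinus (D.cMinus x) = x := by
  have h : D.cMinus (x - D.cMinus x) = -(x - D.cMinus x) := by
    rw [sub_cMinus, map_sum, ← Finset.sum_neg_distrib]
    refine Finset.sum_congr rfl fun j _ => ?_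
    split_ifs with hj
    · rw [map_smul, cMinus_α_of_le hj, smul_neg]
    · simp
  rw [map_sub] at h
  have h' : D.cMinus x - D.cMinus (D.cMinus x) = D.cMinus x - x := by rw [h]; abel
  exact sub_right_injective h'

theorem cPlus_mul_cPlus : D.cPlus * D.cPlus = 1 := by
  ext1 x
  exact cPlus_cPlus x

theorem cMinus_mul_cMinus : D.cMinus * D.cMinus = 1 := by
  ext1 x
  exact cMinus_cMinus x

theorem cPlus_inv : D.cPlus⁻¹ = D.cPlus := inv_eq_of_mul_eq_one_left cPlus_mul_cPlus

theorem cMinus_inv : D.cMinus⁻¹ = D.cMinus := inv_eq_of_mul_eq_one_left cMinus_mul_cMinus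

theorem c_inv : D.c⁻¹ = D.cMinus * D.cPlus := by
  rw [c_eq, mul_inv_rev, cPlus_inv, cMinus_inv]

theorem inner_cPlus_left (x y : Euc n) : inner ℝ (D.cPlus x) y = inner ℝ x (D.cPlus y) := by
  rw [← D.cPlus.inner_map_map, cPlus_cPlus]

theorem inner_cMinus_left (x y : Euc n) : inner ℝ (D.cMinus x) y = inner ℝ x (D.cMinus y) := by
  rw [← D.cMinus.inner_map_map, cMinus_cMinus]

/-- The Coxeter element has no nonzero fixed point: `c x = x` puts `x - c_+ x = x - c_- x` into
the span of either block of simple roots. -/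
theorem eq_zero_of_c_apply_eq {x : Euc n} (h : D.c x = x) : x = 0 := by
  have h1 : D.cMinus x = D.cPlus x := by
    rw [c_eq, iso_mul_apply] at h
    rw [← cPlus_cPlus (D.cMinus x), h]
  refine D.ext_inner_α fun j => ?_
  rw [inner_zero_right]
  have h2 := inner_ω_cPlus (D := D) j x
  rw [← h1, inner_ω_cMinus] at h2
  by_cases hj : (j : ℕ) < D.s
  · rw [if_pos hj, if_neg (by omega)] at h2
    linarith
  · rw [if_neg hj, if_pos (by omega)] at h2
    linarith

theorem fixSpace_c : fixSpace D.c = ⊥ := by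
  rw [eq_bot_iff]
  intro x hx
  exact (Submodule.mem_bot ℝ).2 (eq_zero_of_c_apply_eq (mem_fixSpace.1 hx))

theorem finrank_M_c : Module.finrank ℝ (M D.c) = n := by
  have := finrank_fixSpace_add_finrank_M D.c
  rwa [fixSpace_c, finrank_bot, zero_add] at this

end BipartiteReflectionGroup

/-! ### Oscillating sequences -/

section Sequences

variable {f g : ℤ → ℝ} {lam : ℝ}

/-- Solutions of the same recurrence that vanish somewhere are proportional up to a shift. -/
theorem recurrence_proportional (hf : ∀ j, f (j + 1) + f (j - 1) = 2 * lam * f j)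
    (hg : ∀ j, g (j + 1) + g (j - 1) = 2 * lam * g j) {a b : ℤ} (ha : f a = 0) (hb : g b = 0)
    (m : ℤ) : f (a + m) * g (b + 1) = g (b + m) * f (a + 1) := by
  have key : f (a + m) * g (b + 1) = g (b + m) * f (a + 1) ∧
      f (a + (m + 1)) * g (b + 1) = g (b + (m + 1)) * f (a + 1) := by
    induction m with
    | zero => simp [ha, hb, mul_comm]
    | succ i ih =>
      refine ⟨ih.2, ?_⟩
      have h1 := hf (a + (i + 1))
      have h2 := hg (b + (i + 1))
      rw [show a + ((i : ℤ) + 1) - 1 = a + i by ring,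
        show a + ((i : ℤ) + 1) + 1 = a + (i + 1 + 1) by ring] at h1
      rw [show b + ((i : ℤ) + 1) - 1 = b + i by ring,
        show b + ((i : ℤ) + 1) + 1 = b + (i + 1 + 1) by ring] at h2
      linear_combination g (b + 1) * h1 - f (a + 1) * h2 - ih.1 + 2 * lam * ih.2
    | pred i ih =>
      have h1 := hf (a + -i)
      have h2 := hg (b + -i)
      rw [show a + -(i : ℤ) - 1 = a + (-i - 1) by ring,
        show a + -(i : ℤ) + 1 = a + (-i + 1) by ring] at h1
      rw [show b + -(i : ℤ) - 1 = b + (-i - 1) by ring,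
        show b + -(i : ℤ) + 1 = b + (-i + 1) by ring] at h2
      rw [show (-(i : ℤ) - 1 + 1) = -i by ring]
      refine ⟨?_, ih.1⟩
      linear_combination g (b + 1) * h1 - f (a + 1) * h2 - ih.2 + 2 * lam * ih.1
  exact key.1

/-- Consecutive entries of `f` have weakly the same sign and do not both vanish. -/
def NoJump (f : ℤ → ℝ) : Prop :=
  ∀ j, (0 ≤ f j ∧ 0 ≤ f (j + 1) ∨ f j ≤ 0 ∧ f (j + 1) ≤ 0) ∧ (f j ≠ 0 ∨ f (j + 1) ≠ 0)

theorem NoJump.neg (h : NoJump f) : NoJump fun j => -f j := by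
  intro j
  obtain ⟨h1, h2⟩ := h j
  refine ⟨?_, by simpa using h2⟩
  simp only [Left.nonneg_neg_iff, Left.neg_nonpos_iff]
  exact h1.symm

/-- A periodic solution of `f (j + 1) + f (j - 1) = 2 λ f j` with `λ ≠ 1` sums to zero over a
period, so it takes negative values. -/
theorem NoJump.exists_neg (h : NoJump f) (hlam : lam ≠ 1)
    (hf : ∀ j, f (j + 1) + f (j - 1) = 2 * lam * f j) {P : ℕ} (hP : 2 ≤ P)
    (hper : ∀ j, f (j + P) = f j) : ∃ j, f j < 0 := by
  by_contra! hno
  have hshift : ∀ t : ℤ,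
      ∑ i ∈ Finset.range P, f (i + (t + 1)) = ∑ i ∈ Finset.range P, f (i + t) := by
    intro t
    have h1 := Finset.sum_range_succ (fun i : ℕ => f (i + t)) P
    have h2 := Finset.sum_range_succ' (fun i : ℕ => f (i + t)) P
    rw [h1] at h2
    have h3 : f (P + t) = f ((0 : ℕ) + t) := by
      rw [add_comm, hper]
      simp
    rw [h3] at h2
    have h4 := add_right_cancel h2
    rw [h4]
    refine Finset.sum_congr rfl fun i _ => ?_
    congr 1
    push_cast
    ring
  have h0 : ∑ i ∈ Finset.range P, f (i + 0) = 0 := by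
    have h1 := hshift 0
    have h2 := hshift (-1)
    have h3 : ∑ i ∈ Finset.range P, f (i + (0 + 1)) + ∑ i ∈ Finset.range P, f (i + -1) =
        2 * lam * ∑ i ∈ Finset.range P, f (i + 0) := by
      rw [← Finset.sum_add_distrib, Finset.mul_sum]
      refine Finset.sum_congr rfl fun i _ => ?_
      have := hf i
      simpa [sub_eq_add_neg] using this
    rw [neg_add_cancel] at h2
    rw [h1, ← h2] at h3
    have h4 : (1 - lam) * ∑ i ∈ Finset.range P, f (i + 0) = 0 := by linarith
    exact (mul_eq_zero.1 h4).resolve_left (sub_ne_zero.2 hlam.symm)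
  have h1 := (Finset.sum_eq_zero_iff_of_nonneg fun i _ => hno _).1 h0
  have h2 := h1 0 (Finset.mem_range.2 (by omega))
  have h3 := h1 1 (Finset.mem_range.2 (by omega))
  rcases (h 0).2 with h4 | h4
  · exact h4 (by simpa using h2)
  · exact h4 (by simpa using h3)

/-- After a negative entry, the sequence has an upward zero: the first entry that is not
negative vanishes, and it is followed by a positive one. -/
theorem NoJump.exists_up (h : NoJump f) (hlam : lam ≠ 1)
    (hf : ∀ j, f (j + 1) + f (j - 1) = 2 * lam * f j) {P : ℕ} (hP : 2 ≤ P)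
    (hper : ∀ j, f (j + P) = f j) {j : ℤ} (hj : f j < 0) :
    ∃ m : ℕ, f (j + m) = 0 ∧ 0 < f (j + m + 1) ∧ ∀ i < m, f (j + i) < 0 := by
  classical
  obtain ⟨j', hj'⟩ := h.neg.exists_neg hlam (fun j => by linarith [hf j]) hP
    (fun j => by rw [hper])
  have hmul : ∀ t : ℕ, f (j' + t * P) = f j' := by
    intro t
    induction t with
    | zero => simp
    | succ t ih =>
      rw [← ih, ← hper (j' + t * P)]
      congr 1
      push_cast
      ring
  have hex : ∃ m : ℕ, 0 ≤ f (j + m) := by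
    refine ⟨(j' + (j - j').toNat * P - j).toNat, ?_⟩
    have h1 : 0 ≤ j' + (j - j').toNat * P - j := by
      have h2 : j - j' ≤ (j - j').toNat := Int.self_le_toNat _
      have h3 : (0 : ℤ) ≤ (j - j').toNat := Int.natCast_nonneg _
      have h4 : (2 : ℤ) ≤ P := by exact_mod_cast hP
      nlinarith
    rw [Int.toNat_of_nonneg h1, add_sub_cancel, hmul]
    linarith
  have hspec := Nat.find_spec hex
  have hmin : ∀ i < Nat.find hex, f (j + i) < 0 := fun i hi => not_le.1 (Nat.find_min hex hi)
  obtain ⟨m, hm⟩ : ∃ m, Nat.find hex = m + 1 := by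
    refine Nat.exists_eq_succ_of_ne_zero fun h0 => ?_
    rw [h0, Nat.cast_zero, add_zero] at hspec
    linarith
  rw [hm] at hspec hmin
  have h1 := hmin m (by omega)
  push_cast at hspec
  have h2 := (h (j + m)).1
  rw [show j + (m : ℤ) + 1 = j + (m + 1) by ring] at h2
  have h3 : f (j + (m + 1)) = 0 := by
    rcases h2 with h2 | h2 <;> linarith
  refine ⟨m + 1, by push_cast; exact h3, ?_, hmin⟩
  have h4 := hf (j + (m + 1))
  rw [h3, show j + ((m : ℤ) + 1) - 1 = j + m by ring] at h4
  push_cast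
  linarith

/-- A periodic sequence as above which starts with `0, 1` stays positive until some index `k`,
and changes its sign under the shift by `k`. -/
theorem NoJump.exists_halfPeriod (h : NoJump f) (hlam : lam ≠ 1)
    (hf : ∀ j, f (j + 1) + f (j - 1) = 2 * lam * f j) {P : ℕ} (hP : 2 ≤ P)
    (hper : ∀ j, f (j + P) = f j) (h0 : f 0 = 0) (h1 : f 1 = 1) :
    ∃ k : ℕ, 2 ≤ k ∧ f k = 0 ∧ (∀ m : ℤ, 0 < m → m < k → 0 < f m) ∧ ∀ m, f (m + k) = -f m := by
  obtain ⟨m, hm, -, hlt⟩ := h.neg.exists_up hlam (fun j => by linarith [hf j]) hP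
    (fun j => by rw [hper]) (j := 1) (by linarith)
  have hm1 : 1 ≤ m := by
    rcases Nat.eq_zero_or_pos m with rfl | hpos
    · simp [h1] at hm
    · exact hpos
  have hk : f (m + 1 : ℕ) = 0 := by
    rw [neg_eq_zero, add_comm] at hm
    exact_mod_cast hm
  have hpos : ∀ i : ℤ, 0 < i → i < (m + 1 : ℕ) → 0 < f i := by
    intro i hi hi'
    have := hlt (i - 1).toNat (by omega)
    rw [Int.toNat_of_nonneg (by omega), add_sub_cancel] at this
    linarith
  refine ⟨m + 1, by omega, hk, hpos, fun i => ?_⟩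
  set k : ℤ := ((m + 1 : ℕ) : ℤ) with hkdef
  -- comparing with the reversed sequence shows that the last entry before `k` is `1`
  have hrev := recurrence_proportional (f := fun i => f (k - i)) (g := f) (lam := lam)
    (fun j => by
      have := hf (k - j)
      rw [show k - (j + 1) = k - j - 1 by ring, show k - (j - 1) = k - j + 1 by ring]
      linarith) hf (a := 0) (b := 0) (by simpa using hk) h0 (k - 1)
  simp only [zero_add, h1, mul_one, sub_sub_cancel] at hrev
  have hlast : 0 < f (k - 1) := hpos _ (by omega) (by omega)
  have h3 : f (k - 1) = 1 := by nlinarith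
  have h4 := hf k
  rw [hk, h3] at h4
  have h5 := recurrence_proportional hf hf hk h0 i
  rw [zero_add, h1, mul_one, zero_add] at h5
  rw [add_comm, h5]
  have h6 : f (k + 1) = -1 := by linarith
  rw [h6]
  ring

end Sequences

/-! ### The Coxeter plane -/

namespace BipartiteReflectionGroup

variable {n : ℕ}

variable (D : BipartiteReflectionGroup n)

/-- The eigenvalue of the Gram matrix that belongs to the Perron vector. -/
noncomputable def gramEigenvalue : ℝ := D.exists_perron_vector.choose

/-- The Perron vector of the Gram matrix, as a combination of the simple roots. -/
noncomputable def perron : Euc n := D.exists_perron_vector.choose_spec.2.choose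

theorem gramEigenvalue_pos : 0 < D.gramEigenvalue := D.exists_perron_vector.choose_spec.1

theorem inner_ω_perron_pos (i : Fin n) : 0 < inner ℝ (D.ω i) D.perron :=
  D.exists_perron_vector.choose_spec.2.choose_spec.1 i

theorem inner_α_perron (i : Fin n) :
    inner ℝ (D.α i) D.perron = D.gramEigenvalue * inner ℝ (D.ω i) D.perron :=
  D.exists_perron_vector.choose_spec.2.choose_spec.2 i

/-- The vector of the Coxeter plane that lies on the walls of the second block. -/
noncomputable def planeP : Euc n :=
  ∑ i : Fin n, (if (i : ℕ) < D.s then inner ℝ (D.ω i) D.perron else 0) • D.ω i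

/-- The vector of the Coxeter plane that lies on the walls of the first block. -/
noncomputable def planeQ : Euc n :=
  ∑ i : Fin n, (if (i : ℕ) < D.s then 0 else inner ℝ (D.ω i) D.perron) • D.ω i

variable {D}

theorem inner_α_planeP (i : Fin n) : inner ℝ (D.α i) D.planeP =
    if (i : ℕ) < D.s then inner ℝ (D.ω i) D.perron else 0 := by
  rw [planeP, inner_sum]
  simp_rw [real_inner_smul_right, inner_α_ω]
  simp

theorem inner_α_planeQ (i : Fin n) : inner ℝ (D.α i) D.planeQ =
    if (i : ℕ) < D.s then 0 else inner ℝ (D.ω i) D.perron := by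
  rw [planeQ, inner_sum]
  simp_rw [real_inner_smul_right, inner_α_ω]
  simp

theorem planeP_add_planeQ_mem_C : D.planeP + D.planeQ ∈ D.C := by
  intro i
  rw [inner_add_right, inner_α_planeP, inner_α_planeQ]
  have := D.inner_ω_perron_pos i
  split_ifs <;> linarith

theorem inner_planeP (v : Euc n) : inner ℝ D.planeP v =
    ∑ i : Fin n, inner ℝ (D.ω i) v * if (i : ℕ) < D.s then inner ℝ (D.ω i) D.perron else 0 := by
  rw [real_inner_comm, D.inner_eq_sum]
  simp_rw [inner_α_planeP]

theorem inner_planeQ (v : Euc n) : inner ℝ D.planeQ v =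
    ∑ i : Fin n, inner ℝ (D.ω i) v * if (i : ℕ) < D.s then 0 else inner ℝ (D.ω i) D.perron := by
  rw [real_inner_comm, D.inner_eq_sum]
  simp_rw [inner_α_planeQ]

theorem cMinus_planeP : D.cMinus D.planeP = D.planeP :=
  cMinus_apply_of_orthogonal fun j hj => by rw [inner_α_planeP, if_neg (by omega)]

theorem cPlus_planeQ : D.cPlus D.planeQ = D.planeQ :=
  cPlus_apply_of_orthogonal fun j hj => by rw [inner_α_planeQ, if_pos hj]

/-- The Perron vector in terms of the plane; its eigenvalue equation yields the action of `c_+`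
and `c_-` on the plane. -/
theorem sub_cPlus_planeP_add : (D.planeP - D.cPlus D.planeP) + (D.planeQ - D.cMinus D.planeQ) =
    (2 : ℝ) • D.perron := by
  refine D.ext_inner_ω fun i => ?_
  rw [inner_add_right, inner_sub_right, inner_sub_right, inner_ω_cPlus, inner_ω_cMinus,
    real_inner_smul_right, inner_α_planeP, inner_α_planeQ]
  by_cases hi : (i : ℕ) < D.s
  · simp [hi]
  · simp [hi, not_lt.1 hi]

theorem inner_α_sub_cPlus_of_lt {i : Fin n} (hi : (i : ℕ) < D.s) (x : Euc n) :
    inner ℝ (D.α i) (x - D.cPlus x) = 2 * inner ℝ (D.α i) x := by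
  have h : inner ℝ (D.α i) (D.cPlus x) = -inner ℝ (D.α i) x := by
    rw [← inner_cPlus_left, cPlus_α_of_lt hi, inner_neg_left]
  rw [inner_sub_right, h]
  ring

theorem inner_α_sub_cMinus_of_le {i : Fin n} (hi : D.s ≤ (i : ℕ)) (x : Euc n) :
    inner ℝ (D.α i) (x - D.cMinus x) = 2 * inner ℝ (D.α i) x := by
  have h : inner ℝ (D.α i) (D.cMinus x) = -inner ℝ (D.α i) x := by
    rw [← inner_cMinus_left, cMinus_α_of_le hi, inner_neg_left]
  rw [inner_sub_right, h]
  ring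

theorem cPlus_planeP : D.cPlus D.planeP =
    (2 * (1 - D.gramEigenvalue)) • D.planeQ - D.planeP := by
  have h : D.planeP - D.cPlus D.planeP =
      (2 : ℝ) • D.planeP - (2 * (1 - D.gramEigenvalue)) • D.planeQ := by
    refine D.ext_inner_α fun i => ?_
    rw [inner_sub_right (D.α i) ((2 : ℝ) • D.planeP), real_inner_smul_right, real_inner_smul_right,
      inner_α_planeP, inner_α_planeQ]
    by_cases hi : (i : ℕ) < D.s
    · rw [inner_α_sub_cPlus_of_lt hi, inner_α_planeP]
      simp [hi]
    · have h1 := congrArg (inner ℝ (D.α i)) (sub_cPlus_planeP_add (D := D))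
      rw [inner_add_right, real_inner_smul_right, inner_α_perron,
        inner_α_sub_cMinus_of_le (not_lt.1 hi), inner_α_planeQ, if_neg hi] at h1
      rw [if_neg hi, if_neg hi]
      linarith
  have h2 : D.cPlus D.planeP = D.planeP - (D.planeP - D.cPlus D.planeP) := by abel
  rw [h2, h, two_smul]
  abel

theorem cMinus_planeQ : D.cMinus D.planeQ =
    (2 * (1 - D.gramEigenvalue)) • D.planeP - D.planeQ := by
  have h1 := sub_cPlus_planeP_add (D := D)
  have h : D.planeQ - D.cMinus D.planeQ =
      (2 : ℝ) • D.planeQ - (2 * (1 - D.gramEigenvalue)) • D.planeP := by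
    refine D.ext_inner_α fun i => ?_
    rw [inner_sub_right (D.α i) ((2 : ℝ) • D.planeQ), real_inner_smul_right, real_inner_smul_right,
      inner_α_planeP, inner_α_planeQ]
    by_cases hi : (i : ℕ) < D.s
    · have h1 := congrArg (inner ℝ (D.α i)) (sub_cPlus_planeP_add (D := D))
      rw [inner_add_right, real_inner_smul_right, inner_α_perron,
        inner_α_sub_cPlus_of_lt hi, inner_α_planeP, if_pos hi] at h1
      rw [if_pos hi, if_pos hi]
      linarith
    · rw [inner_α_sub_cMinus_of_le (not_lt.1 hi), inner_α_planeQ]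
      simp [hi]
  have h2 : D.cMinus D.planeQ = D.planeQ - (D.planeQ - D.cMinus D.planeQ) := by abel
  rw [h2, h, two_smul]
  abel

variable (D) in
/-- The orbit of `planeQ` and `planeP` under the dihedral group generated by `c_+` and `c_-`,
enumerated in the order of its angles in the Coxeter plane: `z 0 = planeQ`, `z 1 = planeP`. -/
noncomputable def z (j : ℤ) : Euc n :=
  (D.c ^ (-(j / 2)) : Iso n) (if Even j then D.planeQ else D.planeP)

theorem z_two_mul (m : ℤ) : D.z (2 * m) = (D.c ^ (-m) : Iso n) D.planeQ := by
  simp [z]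

theorem z_two_mul_add_one (m : ℤ) : D.z (2 * m + 1) = (D.c ^ (-m) : Iso n) D.planeP := by
  have h1 : (2 * m + 1) / 2 = m := by omega
  have h2 : ¬ Even (2 * m + 1) := by simp
  rw [z, h1, if_neg h2]

theorem z_zero : D.z 0 = D.planeQ := by simpa using z_two_mul (D := D) 0

theorem z_one : D.z 1 = D.planeP := by simpa using z_two_mul_add_one (D := D) 0

theorem c_zpow_add_apply (a b : ℤ) (x : Euc n) :
    (D.c ^ (a + b) : Iso n) x = (D.c ^ a : Iso n) ((D.c ^ b : Iso n) x) := by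
  rw [zpow_add, iso_mul_apply]

theorem c_z (j : ℤ) : D.c (D.z j) = D.z (j - 2) := by
  have h : ∀ (m : ℤ) (x : Euc n), D.c ((D.c ^ (-m) : Iso n) x) = (D.c ^ (-(m - 1)) : Iso n) x := by
    intro m x
    rw [show -(m - 1) = 1 + -m by ring, c_zpow_add_apply, zpow_one]
  rcases Int.even_or_odd' j with ⟨m, rfl | rfl⟩
  · rw [z_two_mul, h, show 2 * m - 2 = 2 * (m - 1) by ring, z_two_mul]
  · rw [z_two_mul_add_one, h, show 2 * m + 1 - 2 = 2 * (m - 1) + 1 by ring, z_two_mul_add_one]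

theorem cPlus_c_zpow (m : ℤ) (x : Euc n) :
    D.cPlus ((D.c ^ m : Iso n) x) = (D.c ^ (-m) : Iso n) (D.cPlus x) := by
  have h1 : D.cPlus * D.c * D.cPlus⁻¹ = D.c⁻¹ := by
    rw [c_inv, cPlus_inv, c_eq, ← mul_assoc, cPlus_mul_cPlus, one_mul]
  have h2 : D.cPlus * D.c ^ m * D.cPlus⁻¹ = D.c ^ (-m) := by
    rw [← conj_zpow, h1, inv_zpow, zpow_neg]
  rw [← h2, iso_mul_apply, iso_mul_apply, iso_inv_apply_apply]

theorem cPlus_z (j : ℤ) : D.cPlus (D.z j) = D.z (-j) := by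
  rcases Int.even_or_odd' j with ⟨m, rfl | rfl⟩
  · rw [z_two_mul, cPlus_c_zpow, cPlus_planeQ, show -(2 * m) = 2 * (-m) by ring, z_two_mul]
  · rw [z_two_mul_add_one, cPlus_c_zpow, show -(2 * m + 1) = 2 * (-m - 1) + 1 by ring,
      z_two_mul_add_one, show -(-m - 1) = -(-m) + 1 by ring, c_zpow_add_apply, zpow_one, c_eq,
      iso_mul_apply, cMinus_planeP]

theorem cMinus_z (j : ℤ) : D.cMinus (D.z j) = D.z (2 - j) := by
  rw [show 2 - j = -(j - 2) by ring, ← cPlus_z, ← c_z, c_eq, iso_mul_apply, cPlus_cPlus]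

theorem z_rec (j : ℤ) :
    D.z (j + 1) + D.z (j - 1) = (2 * (1 - D.gramEigenvalue)) • D.z j := by
  rcases Int.even_or_odd' j with ⟨m, rfl | rfl⟩
  · have h : D.c D.planeP = D.cPlus D.planeP := by rw [c_eq, iso_mul_apply, cMinus_planeP]
    rw [z_two_mul_add_one, show 2 * m - 1 = 2 * (m - 1) + 1 by ring, z_two_mul_add_one, z_two_mul,
      show -(m - 1) = -m + 1 by ring, c_zpow_add_apply, zpow_one, h, cPlus_planeP, map_sub,
      map_smul, add_sub_cancel]
  · have h : (D.c⁻¹ : Iso n) D.planeQ = D.cMinus D.planeQ := by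
      rw [c_inv, iso_mul_apply, cPlus_planeQ]
    rw [show 2 * m + 1 + 1 = 2 * (m + 1) by ring, z_two_mul, show 2 * m + 1 - 1 = 2 * m by ring,
      z_two_mul, z_two_mul_add_one, show -(m + 1) = -m + -1 by ring, c_zpow_add_apply, zpow_neg_one,
      h, cMinus_planeQ, map_sub, map_smul, sub_add_cancel]

/-- The inner products of `v` with the vectors `z j` of the Coxeter plane. -/
noncomputable def proj (D : BipartiteReflectionGroup n) (v : Euc n) (j : ℤ) : ℝ :=
  inner ℝ (D.z j) v

theorem proj_rec (v : Euc n) (j : ℤ) :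
    D.proj v (j + 1) + D.proj v (j - 1) = 2 * (1 - D.gramEigenvalue) * D.proj v j := by
  rw [proj, proj, proj, ← inner_add_left, z_rec, real_inner_smul_left]

theorem proj_cPlus (v : Euc n) (j : ℤ) : D.proj (D.cPlus v) j = D.proj v (-j) := by
  rw [proj, ← inner_cPlus_left, cPlus_z, proj]

theorem proj_cMinus (v : Euc n) (j : ℤ) : D.proj (D.cMinus v) j = D.proj v (2 - j) := by
  rw [proj, ← inner_cMinus_left, cMinus_z, proj]

theorem proj_c (v : Euc n) (j : ℤ) : D.proj (D.c v) j = D.proj v (j + 2) := by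
  rw [c_eq, iso_mul_apply, proj_cPlus, proj_cMinus]
  congr 1
  ring

theorem proj_c_zpow (m : ℤ) (v : Euc n) (j : ℤ) :
    D.proj ((D.c ^ m : Iso n) v) j = D.proj v (j + 2 * m) := by
  induction m generalizing j with
  | zero => simp
  | succ i ih =>
    rw [add_comm (i : ℤ) 1, c_zpow_add_apply, zpow_one, proj_c, ih]
    congr 1
    ring
  | pred i ih =>
    have h := ih (j - 2)
    rw [show -(i : ℤ) = 1 + (-i - 1) by ring, c_zpow_add_apply, zpow_one, proj_c] at h
    rw [sub_add_cancel] at h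
    rw [h]
    congr 1
    ring

theorem proj_neg (v : Euc n) (j : ℤ) : D.proj (-v) j = -D.proj v j := inner_neg_right _ _

theorem c_zpow_mem (m : ℤ) : D.c ^ m ∈ D.W := D.W.zpow_mem c_mem m

theorem proj_zero_nonneg {v : Euc n} (hv : v ∈ D.unitRoots) (hp : D.IsPositive v) :
    0 ≤ D.proj v 0 := by
  rw [proj, z_zero, inner_planeQ]
  refine Finset.sum_nonneg fun i _ => mul_nonneg ((isPositive_iff_of_mem hv).1 hp i) ?_
  split_ifs
  exacts [le_rfl, (D.inner_ω_perron_pos i).le]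

theorem proj_one_nonneg {v : Euc n} (hv : v ∈ D.unitRoots) (hp : D.IsPositive v) :
    0 ≤ D.proj v 1 := by
  rw [proj, z_one, inner_planeP]
  refine Finset.sum_nonneg fun i _ => mul_nonneg ((isPositive_iff_of_mem hv).1 hp i) ?_
  split_ifs
  exacts [(D.inner_ω_perron_pos i).le, le_rfl]

theorem proj_ne_zero {v : Euc n} (hv : v ∈ D.unitRoots) : D.proj v 0 ≠ 0 ∨ D.proj v 1 ≠ 0 := by
  by_contra! h
  have h1 := D.chamber v (ne_zero_of_mem_unitRoots hv) hv.2 _ planeP_add_planeQ_mem_C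
  rw [real_inner_comm, inner_add_left, ← z_zero, ← z_one] at h1
  exact h1 (by rw [← proj, ← proj, h.1, h.2, add_zero])

theorem noJump_proj {v : Euc n} (hv : v ∈ D.unitRoots) : NoJump (D.proj v) := by
  have h0 : ∀ v ∈ D.unitRoots, (0 ≤ D.proj v 0 ∧ 0 ≤ D.proj v 1 ∨
      D.proj v 0 ≤ 0 ∧ D.proj v 1 ≤ 0) ∧ (D.proj v 0 ≠ 0 ∨ D.proj v 1 ≠ 0) := by
    intro v hv
    refine ⟨?_, proj_ne_zero hv⟩
    rcases isPositive_or_isPositive_neg hv with h | h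
    · exact Or.inl ⟨proj_zero_nonneg hv h, proj_one_nonneg hv h⟩
    · have h1 := proj_zero_nonneg (neg_mem_unitRoots hv) h
      have h2 := proj_one_nonneg (neg_mem_unitRoots hv) h
      rw [proj_neg] at h1 h2
      exact Or.inr ⟨by linarith, by linarith⟩
  intro j
  rcases Int.even_or_odd' j with ⟨m, rfl | rfl⟩
  · have h1 := h0 _ (apply_mem_unitRoots (c_zpow_mem m) hv)
    rw [proj_c_zpow, proj_c_zpow] at h1
    rwa [zero_add, add_comm] at h1
  · have h1 := h0 _ (apply_mem_unitRoots cPlus_mem (apply_mem_unitRoots (c_zpow_mem (m + 1)) hv))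
    rw [proj_cPlus, proj_cPlus, proj_c_zpow, proj_c_zpow,
      show -0 + 2 * (m + 1) = 2 * m + 1 + 1 by ring,
      show -1 + 2 * (m + 1) = 2 * m + 1 by ring] at h1
    obtain ⟨h2, h3⟩ := h1
    exact ⟨h2.imp And.symm And.symm, h3.symm⟩

theorem h_pos : 0 < D.h := by
  have := D.finite
  have h1 : IsOfFinOrder (⟨D.c, c_mem⟩ : D.W) := isOfFinOrder_of_finite _
  have h2 := h1.orderOf_pos
  rwa [Subgroup.orderOf_mk] at h2

theorem c_pow_h : D.c ^ D.h = 1 := pow_orderOf_eq_one _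

theorem proj_add_two_mul_h (v : Euc n) (j : ℤ) : D.proj v (j + (2 * D.h : ℕ)) = D.proj v j := by
  have h1 := proj_c_zpow (D := D) D.h v j
  rw [zpow_natCast, c_pow_h] at h1
  push_cast
  rw [← h1]
  rfl

/-- The values `D.proj v` pass from negative to positive through a zero at `j`. -/
def Up (D : BipartiteReflectionGroup n) (v : Euc n) (j : ℤ) : Prop :=
  D.proj v j = 0 ∧ 0 < D.proj v (j + 1)

theorem exists_up {v : Euc n} (hv : v ∈ D.unitRoots) : ∃ j, D.Up v j := by
  have hlam : 1 - D.gramEigenvalue ≠ 1 := by linarith [D.gramEigenvalue_pos]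
  have hP : 2 ≤ 2 * D.h := by have := h_pos (D := D); omega
  obtain ⟨j, hj⟩ := (noJump_proj hv).exists_neg hlam (proj_rec v) hP (proj_add_two_mul_h v)
  obtain ⟨m, h1, h2, -⟩ :=
    (noJump_proj hv).exists_up hlam (proj_rec v) hP (proj_add_two_mul_h v) hj
  exact ⟨_, h1, h2⟩

variable (D) in
theorem exists_halfPeriod : ∃ k : ℕ, 2 ≤ k ∧ ∀ v ∈ D.unitRoots, ∀ j, D.Up v j →
    (∀ m : ℤ, 0 < m → m < k → 0 < D.proj v (j + m)) ∧ ∀ m, D.proj v (m + k) = -D.proj v m := by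
  have hlam : 1 - D.gramEigenvalue ≠ 1 := by linarith [D.gramEigenvalue_pos]
  have hP : 2 ≤ 2 * D.h := by have := h_pos (D := D); omega
  have hα := α_mem_unitRoots (D := D) ⟨0, D.rank_pos⟩
  obtain ⟨a, ha0, ha1⟩ := exists_up hα
  set u := D.α ⟨0, D.rank_pos⟩
  let g : ℤ → ℝ := fun m => D.proj u (a + m) / D.proj u (a + 1)
  have hg0 : g 0 = 0 := by simp [g, ha0]
  have hg1 : g 1 = 1 := div_self ha1.ne'
  have hgrec : ∀ j, g (j + 1) + g (j - 1) = 2 * (1 - D.gramEigenvalue) * g j := by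
    intro j
    simp only [g]
    rw [← add_div, ← add_assoc, ← add_sub_assoc, proj_rec, mul_div_assoc]
  have hgnj : NoJump g := by
    intro j
    obtain ⟨h1, h2⟩ := noJump_proj hα (a + j)
    simp only [g, ← add_assoc]
    refine ⟨h1.imp (fun h => ⟨div_nonneg h.1 ha1.le, div_nonneg h.2 ha1.le⟩) fun h =>
      ⟨div_nonpos_of_nonpos_of_nonneg h.1 ha1.le, div_nonpos_of_nonpos_of_nonneg h.2 ha1.le⟩,
      h2.imp (fun h => div_ne_zero h ha1.ne') fun h => div_ne_zero h ha1.ne'⟩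
  have hgper : ∀ j, g (j + (2 * D.h : ℕ)) = g j := by
    intro j
    simp only [g]
    rw [← add_assoc, proj_add_two_mul_h]
  obtain ⟨k, hk2, -, hpos, hanti⟩ := hgnj.exists_halfPeriod hlam hgrec hP hgper hg0 hg1
  refine ⟨k, hk2, fun v hv j hj => ?_⟩
  have hprop : ∀ m, D.proj v (j + m) = g m * D.proj v (j + 1) := by
    intro m
    have := recurrence_proportional (proj_rec v) hgrec hj.1 hg0 m
    rwa [zero_add, hg1, mul_one, zero_add] at this
  refine ⟨fun m hm hmk => ?_, fun m => ?_⟩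
  · rw [hprop]
    exact mul_pos (hpos m hm hmk) hj.2
  · have h1 := hprop (m - j + k)
    have h2 := hprop (m - j)
    rw [hanti] at h1
    rw [add_sub_cancel] at h2
    rw [show j + (m - j + k) = m + k by ring] at h1
    rw [h1, h2]
    ring

/-- The number of steps after which the sequences `D.proj v` change their sign is the Coxeter
number, because `W` acts freely on the chamber and the plane meets the chamber. -/
theorem halfPeriod_eq_h {k : ℕ} (hk2 : 2 ≤ k) (hk : ∀ v ∈ D.unitRoots, ∀ j, D.Up v j →
    (∀ m : ℤ, 0 < m → m < k → 0 < D.proj v (j + m)) ∧ ∀ m, D.proj v (m + k) = -D.proj v m) :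
    D.h = k := by
  refine (orderOf_eq_iff (by omega)).2 ⟨?_, fun m hm hm0 hc => ?_⟩
  · have hfix : ∀ j, (D.c ^ (-(k : ℤ)) : Iso n) (D.z j) = D.z j := by
      intro j
      refine D.ext_inner_α fun i => ?_
      have hα := α_mem_unitRoots (D := D) i
      obtain ⟨a, ha⟩ := exists_up hα
      have h1 := (hk _ hα a ha).2
      have h2 : D.proj (D.α i) (j + 2 * k) = D.proj (D.α i) j := by
        rw [show j + 2 * (k : ℤ) = j + k + k by ring, h1, h1, neg_neg]
      rw [← proj_c_zpow, proj, proj] at h2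
      have h3 : inner ℝ (D.α i) ((D.c ^ (-(k : ℤ)) : Iso n) (D.z j)) =
          inner ℝ ((D.c ^ (k : ℤ) : Iso n) (D.α i)) (D.z j) := by
        rw [← (D.c ^ (k : ℤ)).inner_map_map (D.α i), ← c_zpow_add_apply, add_neg_cancel, zpow_zero]
        rfl
      rw [h3, real_inner_comm, h2, real_inner_comm]
    have h1 : D.c ^ (-(k : ℤ)) = 1 := by
      refine eq_one_of_apply_eq_of_mem_C (c_zpow_mem _) planeP_add_planeQ_mem_C ?_
      rw [map_add, ← z_zero, ← z_one, hfix, hfix]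
    rwa [zpow_neg, inv_eq_one, zpow_natCast] at h1
  · have hα := α_mem_unitRoots (D := D) ⟨0, D.rank_pos⟩
    obtain ⟨j, hj⟩ := exists_up hα
    obtain ⟨hpos, hanti⟩ := hk _ hα j hj
    have hper : ∀ i, D.proj (D.α ⟨0, D.rank_pos⟩) (i + 2 * m) = D.proj (D.α ⟨0, D.rank_pos⟩) i := by
      intro i
      rw [← proj_c_zpow, zpow_natCast, hc]
      rfl
    have h0 := hper j
    have h1 := hper (j + 1)
    rw [hj.1] at h0
    rcases lt_trichotomy (2 * m) k with hlt | heq | hgt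
    · exact (hpos (2 * m) (by omega) (by omega)).ne' h0
    · have h2 := hanti (j + 1)
      rw [← heq] at h2
      push_cast at h2
      rw [h1] at h2
      linarith [hj.2]
    · have h2 := hanti (j + (2 * m - k))
      rw [show j + (2 * (m : ℤ) - k) + k = j + 2 * m by ring, h0] at h2
      have h3 := hpos (2 * m - k) (by omega) (by omega)
      linarith

theorem two_le_h : 2 ≤ D.h := by
  obtain ⟨k, hk2, hk⟩ := D.exists_halfPeriod
  rw [halfPeriod_eq_h hk2 hk]
  exact hk2

theorem Up.proj_pos {v : Euc n} (hv : v ∈ D.unitRoots) {j : ℤ} (h : D.Up v j) {m : ℤ} (h0 : 0 < m)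
    (hm : m < D.h) : 0 < D.proj v (j + m) := by
  obtain ⟨k, hk2, hk⟩ := D.exists_halfPeriod
  rw [halfPeriod_eq_h hk2 hk] at hm
  exact (hk v hv j h).1 m h0 hm

theorem proj_add_h {v : Euc n} (hv : v ∈ D.unitRoots) (m : ℤ) :
    D.proj v (m + D.h) = -D.proj v m := by
  obtain ⟨j, hj⟩ := exists_up hv
  obtain ⟨k, hk2, hk⟩ := D.exists_halfPeriod
  rw [halfPeriod_eq_h hk2 hk]
  exact (hk v hv j hj).2 m

end BipartiteReflectionGroup

/-! ### The enumeration of the roots by their level -/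

namespace BipartiteReflectionGroup

variable {n : ℕ} {D : BipartiteReflectionGroup n}

theorem Up.neg {v : Euc n} (hv : v ∈ D.unitRoots) {j : ℤ} (h : D.Up v j) :
    D.Up (-v) (j + D.h) := by
  refine ⟨?_, ?_⟩
  · rw [proj_neg, proj_add_h hv, h.1]
    simp
  · rw [proj_neg, show j + (D.h : ℤ) + 1 = j + 1 + D.h by ring, proj_add_h hv, neg_neg]
    exact h.2

theorem up_c_zpow_iff {v : Euc n} {m j : ℤ} :
    D.Up ((D.c ^ m : Iso n) v) j ↔ D.Up v (j + 2 * m) := by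
  rw [Up, Up, proj_c_zpow, proj_c_zpow, show j + 1 + 2 * m = j + 2 * m + 1 by ring]

/-- Under `c_+` the level `L` becomes `h - L`. -/
theorem Up.cPlus {v : Euc n} (hv : v ∈ D.unitRoots) {L : ℤ} (h : D.Up v (-L)) :
    D.Up (D.cPlus v) (-(D.h - L)) := by
  have h2 := proj_add_h hv (-(-(D.h - L)) - D.h)
  have h3 := proj_add_h hv (-(-(D.h - L) + 1) - D.h)
  rw [sub_add_cancel] at h2 h3
  have h4 := (h.proj_pos hv (m := -1 + D.h) (by have := two_le_h (D := D); omega) (by omega))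
  rw [Up, proj_cPlus, proj_cPlus]
  refine ⟨?_, ?_⟩
  · rw [h2, show -(-((D.h : ℤ) - L)) - D.h = -L by ring, h.1, neg_zero]
  · rw [show -(-((D.h : ℤ) - L) + 1) = -L + (-1 + D.h) by ring]
    exact h4

/-- Under `c_-` the level `L` becomes `h - 2 - L`. -/
theorem Up.cMinus {v : Euc n} (hv : v ∈ D.unitRoots) {L : ℤ} (h : D.Up v (-L)) :
    D.Up (D.cMinus v) (-(D.h - 2 - L)) := by
  have h1 := h.cPlus hv
  have h2 : D.cMinus v = (D.c ^ (-1 : ℤ) : Iso n) (D.cPlus v) := by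
    rw [zpow_neg_one, c_inv, iso_mul_apply, cPlus_cPlus]
  rw [h2, up_c_zpow_iff]
  convert h1 using 1
  ring

/-- Two upward zeros of `D.proj v` that are less than a period `2 h` apart coincide. -/
theorem Up.eq_of_lt {v : Euc n} (hv : v ∈ D.unitRoots) {j m : ℤ} (h : D.Up v j)
    (h' : D.Up v (j + m)) (h0 : 0 ≤ m) (hm : m < 2 * D.h) : m = 0 := by
  by_contra hne
  rcases lt_trichotomy m D.h with hlt | heq | hgt
  · exact (h.proj_pos hv (m := m) (by omega) hlt).ne' h'.1
  · have h1 := h'.2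
    rw [heq, show j + (D.h : ℤ) + 1 = j + 1 + D.h by ring, proj_add_h hv] at h1
    linarith [h.2]
  · have h1 := h'.1
    rw [show j + m = j + (m - D.h) + D.h by ring, proj_add_h hv] at h1
    linarith [h.proj_pos hv (m := m - D.h) (by omega) (by omega)]

theorem Up.add_mul {v : Euc n} {j : ℤ} (h : D.Up v j) (t : ℤ) : D.Up v (j + 2 * (D.h * t)) := by
  rw [← up_c_zpow_iff, zpow_mul, zpow_natCast, c_pow_h, one_zpow]
  exact h

theorem Up.level_eq {v : Euc n} (hv : v ∈ D.unitRoots) {a b : ℤ} (h : D.Up v (-a))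
    (h' : D.Up v (-b)) (ha0 : 0 ≤ a) (ha : a < 2 * D.h) (hb0 : 0 ≤ b) (hb : b < 2 * D.h) :
    a = b := by
  rcases le_total a b with hab | hab
  · have := h'.eq_of_lt hv (m := b - a) (by rwa [show -b + (b - a) = -a by ring]) (by omega)
      (by omega)
    omega
  · have := h.eq_of_lt hv (m := a - b) (by rwa [show -a + (a - b) = -b by ring]) (by omega)
      (by omega)
    omega

theorem exists_up_level {v : Euc n} (hv : v ∈ D.unitRoots) :
    ∃ L : ℤ, 0 ≤ L ∧ L < 2 * D.h ∧ D.Up v (-L) := by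
  obtain ⟨j, hj⟩ := exists_up hv
  have hh : (0 : ℤ) < 2 * D.h := by have := h_pos (D := D); omega
  refine ⟨(-j) % (2 * D.h), Int.emod_nonneg _ hh.ne', Int.emod_lt_of_pos _ hh, ?_⟩
  have h1 := hj.add_mul ((-j) / (2 * D.h))
  have h2 := Int.emod_add_mul_ediv (-j) (2 * D.h)
  convert h1 using 1
  linear_combination -h2

theorem isPositive_of_up {v : Euc n} (hv : v ∈ D.unitRoots) {L : ℤ} (h0 : 0 ≤ L) (hL : L < D.h)
    (h : D.Up v (-L)) : D.IsPositive v := by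
  refine (isPositive_or_isPositive_neg hv).resolve_right fun hn => ?_
  rcases h0.eq_or_lt with rfl | h0
  · have h1 := proj_one_nonneg (neg_mem_unitRoots hv) hn
    have h2 := h.2
    rw [neg_zero, zero_add] at h2
    rw [proj_neg] at h1
    linarith
  · have h1 := proj_zero_nonneg (neg_mem_unitRoots hv) hn
    have h2 := h.proj_pos hv h0 hL
    rw [neg_add_cancel] at h2
    rw [proj_neg] at h1
    linarith

theorem isPositive_neg_of_up {v : Euc n} (hv : v ∈ D.unitRoots) {L : ℤ} (h0 : -D.h ≤ L)
    (hL : L < 0) (h : D.Up v (-L)) : D.IsPositive (-v) := by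
  have h1 := (h.neg hv).add_mul (-1)
  refine isPositive_of_up (neg_mem_unitRoots hv) (L := L + D.h) (by omega) (by omega) ?_
  convert h1 using 1
  ring

theorem isPositive_neg_of_up' {v : Euc n} (hv : v ∈ D.unitRoots) {L : ℤ} (h0 : D.h ≤ L)
    (hL : L < 2 * D.h) (h : D.Up v (-L)) : D.IsPositive (-v) := by
  have h1 := h.neg hv
  refine isPositive_of_up (neg_mem_unitRoots hv) (L := L - D.h) (by omega) (by omega) ?_
  convert h1 using 1
  ring

theorem exists_up_of_isPositive {v : Euc n} (hv : v ∈ D.unitRoots) (hp : D.IsPositive v) :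
    ∃ L : ℤ, 0 ≤ L ∧ L < D.h ∧ D.Up v (-L) := by
  obtain ⟨L, h0, hL, h⟩ := exists_up_level hv
  refine ⟨L, h0, ?_, h⟩
  by_contra! hge
  exact not_isPositive_neg hp (isPositive_neg_of_up' hv hge hL h)

theorem up_α_of_lt {i : Fin n} (hi : (i : ℕ) < D.s) : D.Up (D.α i) 0 := by
  rw [Up, zero_add, proj, proj, z_zero, z_one, real_inner_comm, inner_α_planeQ,
    real_inner_comm _ D.planeP, inner_α_planeP, if_pos hi, if_pos hi]
  exact ⟨rfl, D.inner_ω_perron_pos i⟩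

theorem up_cPlus_α_of_le {i : Fin n} (hi : D.s ≤ (i : ℕ)) : D.Up (D.cPlus (D.α i)) (-1) := by
  rw [Up, proj_cPlus, proj_cPlus, neg_neg, neg_add_cancel, neg_zero, proj, proj, z_zero, z_one,
    real_inner_comm, inner_α_planeP, real_inner_comm _ D.planeQ, inner_α_planeQ, if_neg (by omega),
    if_neg (by omega)]
  exact ⟨rfl, D.inner_ω_perron_pos i⟩

/-- A positive root supported on mutually orthogonal simple roots is one of them: reflecting it
in a simple root of its support changes one sign only. -/
theorem exists_eq_α_of_support {v : Euc n} (hv : v ∈ D.unitRoots) (hp : D.IsPositive v)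
    {A : Set (Fin n)} (hA : ∀ i ∈ A, ∀ j ∈ A, i ≠ j → inner ℝ (D.α i) (D.α j) = 0)
    (hsupp : ∀ i, i ∉ A → inner ℝ (D.ω i) v = 0) : ∃ i ∈ A, v = D.α i := by
  have hnn := (isPositive_iff_of_mem hv).1 hp
  obtain ⟨i, hi⟩ : ∃ i, inner ℝ (D.ω i) v ≠ 0 := by
    by_contra! h0
    exact ne_zero_of_mem_unitRoots hv (D.ext_inner_ω fun i => by rw [h0 i, inner_zero_right])
  have hiA : i ∈ A := by
    by_contra h
    exact hi (hsupp i h)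
  refine ⟨i, hiA, eq_α_of_forall_eq_zero hv hp fun j hj => ?_⟩
  have hip : 0 < inner ℝ (D.ω i) v := lt_of_le_of_ne (hnn i) (Ne.symm hi)
  have h1 : inner ℝ (D.α i) v = inner ℝ (D.ω i) v := by
    rw [real_inner_comm, D.inner_eq_sum, Finset.sum_eq_single i]
    · rw [real_inner_self_eq_norm_sq, D.norm_α, one_pow, mul_one]
    · intro k _ hk
      by_cases hkA : k ∈ A
      · rw [hA k hkA i hiA hk, mul_zero]
      · rw [hsupp k hkA, zero_mul]
    · simp
  have h2 : inner ℝ (D.ω i) (D.S i v) < 0 := by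
    rw [inner_ω_S_self, h1]
    linarith
  rcases nonneg_or_nonpos_of_mem_unitRoots (apply_mem_unitRoots (S_mem i) hv) with h | h
  · linarith [h i]
  · have h3 := h j
    rw [inner_ω_S_of_ne hj] at h3
    linarith [hnn j]

theorem exists_eq_α_of_up_zero {v : Euc n} (hv : v ∈ D.unitRoots) (h : D.Up v 0) :
    ∃ i : Fin n, (i : ℕ) < D.s ∧ v = D.α i := by
  have hp := isPositive_of_up hv (L := 0) le_rfl (by exact_mod_cast h_pos (D := D))
    (by simpa using h)
  have hnn := (isPositive_iff_of_mem hv).1 hp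
  refine exists_eq_α_of_support hv hp (A := {i | (i : ℕ) < D.s})
    (fun i hi j hj => D.orthogonal_fst i j hi hj) fun i hi => ?_
  have h1 := h.1
  rw [proj, z_zero, inner_planeQ, Finset.sum_eq_zero_iff_of_nonneg] at h1
  · have h2 := h1 i (Finset.mem_univ i)
    rw [if_neg (show ¬ (i : ℕ) < D.s from hi)] at h2
    exact (mul_eq_zero.1 h2).resolve_right (D.inner_ω_perron_pos i).ne'
  · intro j _
    refine mul_nonneg (hnn j) ?_
    split_ifs
    exacts [le_rfl, (D.inner_ω_perron_pos j).le]

theorem exists_eq_cPlus_α_of_up_neg_one {v : Euc n} (hv : v ∈ D.unitRoots) (h : D.Up v (-1)) :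
    ∃ i : Fin n, D.s ≤ (i : ℕ) ∧ v = D.cPlus (D.α i) := by
  have h0 : D.proj (D.cPlus v) 1 = 0 := by rw [proj_cPlus, h.1]
  have h1 : 0 < D.proj (D.cPlus v) 0 := by
    rw [proj_cPlus, neg_zero]
    simpa using h.2
  have hv' := apply_mem_unitRoots cPlus_mem hv
  have hp : D.IsPositive (D.cPlus v) := by
    refine (isPositive_or_isPositive_neg hv').resolve_right fun hn => ?_
    have h2 := proj_zero_nonneg (neg_mem_unitRoots hv') hn
    rw [proj_neg] at h2
    linarith
  have hnn := (isPositive_iff_of_mem hv').1 hp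
  obtain ⟨i, hi, he⟩ := exists_eq_α_of_support hv' hp (A := {i | D.s ≤ (i : ℕ)})
    (fun i hi j hj => D.orthogonal_snd i j hi hj) fun i hi => by
      rw [proj, z_one, inner_planeP, Finset.sum_eq_zero_iff_of_nonneg] at h0
      · have h2 := h0 i (Finset.mem_univ i)
        rw [if_pos (not_le.1 hi)] at h2
        exact (mul_eq_zero.1 h2).resolve_right (D.inner_ω_perron_pos i).ne'
      · intro j _
        refine mul_nonneg (hnn j) ?_
        split_ifs
        exacts [(D.inner_ω_perron_pos j).le, le_rfl]
  exact ⟨i, hi, by rw [← he, cPlus_cPlus]⟩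

/-! ### The sequence of roots -/

theorem cyc_add_n (i : ℕ) : D.cyc (n + i) = D.cyc i := by
  simp only [cyc, Nat.add_mod_left]

theorem prefixProd_add_n (i : ℕ) : D.prefixProd (n + i) = D.c * D.prefixProd i := by
  induction i with
  | zero => rw [add_zero, prefixProd_n, prefixProd_zero, mul_one]
  | succ i ih => rw [← add_assoc, prefixProd_succ, ih, cyc_add_n, mul_assoc, ← prefixProd_succ]

theorem rhoNat_eq (i : ℕ) : D.rhoNat i = D.prefixProd i (D.cyc i) := rfl

theorem rhoNat_add_n (i : ℕ) : D.rhoNat (n + i) = D.c (D.rhoNat i) := by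
  rw [rhoNat_eq, prefixProd_add_n, cyc_add_n, iso_mul_apply, rhoNat_eq]

theorem rhoNat_add_mul (a i : ℕ) : D.rhoNat (n * a + i) = (D.c ^ a : Iso n) (D.rhoNat i) := by
  induction a with
  | zero => simp
  | succ a ih =>
    rw [show n * (a + 1) + i = n + (n * a + i) by ring, rhoNat_add_n, ih, pow_succ', iso_mul_apply]

theorem rhoNat_of_lt_s {i : Fin n} (hi : (i : ℕ) < D.s) : D.rhoNat i = D.α i := by
  rw [rhoNat_eq, cyc_of_lt i.2]
  refine D.ext_inner_ω fun j => ?_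
  rw [inner_ω_prefixProd hi.le, sub_eq_self]
  split_ifs with hj
  · rw [D.orthogonal_fst j i (by omega) hi (by rintro rfl; omega), mul_zero]
  · rfl

theorem rhoNat_of_s_le {i : Fin n} (hi : D.s ≤ (i : ℕ)) : D.rhoNat i = D.cPlus (D.α i) := by
  rw [rhoNat_eq, cyc_of_lt i.2]
  obtain ⟨g, hg, hgx⟩ := exists_prefixProd_eq (D := D) hi i.2.le
  rw [hg, iso_mul_apply]
  congr 1
  refine D.ext_inner_ω fun j => ?_
  rw [hgx, sub_eq_self]
  split_ifs with hj
  · rw [D.orthogonal_snd j i hj.1 hi (by rintro rfl; omega), mul_zero]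
  · rfl

/-- The root `ρ_i` for `i = n a + r + 1` with `0 ≤ r < n` is `c ^ a ρ_{r+1}`. -/
theorem rho_eq (a : ℤ) (r : Fin n) :
    D.rho (n * a + r + 1) = (D.c ^ a : Iso n) (D.rhoNat r) := by
  have hh : (0 : ℤ) < D.h := by exact_mod_cast h_pos (D := D)
  have hn : (0 : ℤ) < n := by exact_mod_cast D.rank_pos
  have hr : ((r : ℕ) : ℤ) < n := by exact_mod_cast r.2
  have h1 : 0 ≤ a % D.h := Int.emod_nonneg _ hh.ne'
  have h2 : a % D.h < D.h := Int.emod_lt_of_pos _ hh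
  have h3 : ((n : ℤ) * a + r) % (n * D.h) = n * (a % D.h) + r := by
    have h4 := Int.emod_add_mul_ediv a D.h
    have h5 : (n : ℤ) * a + r = n * (a % D.h) + r + (n * D.h) * (a / D.h) := by
      linear_combination -(n : ℤ) * h4
    rw [h5, Int.add_mul_emod_self_left]
    refine Int.emod_eq_of_lt (by positivity) ?_
    nlinarith
  rw [rho, add_sub_cancel_right, h3]
  have h6 : ((n : ℤ) * (a % D.h) + r).toNat = n * (a % D.h).toNat + r := by
    have : ((n : ℤ) * (a % D.h) + r) = ((n * (a % D.h).toNat + r : ℕ) : ℤ) := by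
      push_cast
      rw [Int.toNat_of_nonneg h1]
    rw [this, Int.toNat_natCast]
  rw [h6, rhoNat_add_mul]
  have h7 : D.c ^ a = D.c ^ (a % D.h).toNat := by
    rw [← zpow_natCast, Int.toNat_of_nonneg h1]
    exact (zpow_mod_orderOf D.c a).symm
  rw [h7]

theorem exists_index (D : BipartiteReflectionGroup n) (i : ℤ) :
    ∃ (a : ℤ) (r : Fin n), i = n * a + r + 1 := by
  have hn : (0 : ℤ) < n := by exact_mod_cast D.rank_pos
  have h1 := Int.emod_nonneg (i - 1) hn.ne'
  have h2 := Int.emod_lt_of_pos (i - 1) hn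
  refine ⟨(i - 1) / n, ⟨((i - 1) % n).toNat, by omega⟩, ?_⟩
  have h3 := Int.emod_add_mul_ediv (i - 1) n
  simp only [Int.toNat_of_nonneg h1]
  linarith

/-- The level of the index `i`: the number `L` such that `D.proj (D.rho i)` passes upwards through
zero at `-L`, see `up_rho`. It increases by `2` when `i` increases by `n`. -/
noncomputable def level (D : BipartiteReflectionGroup n) (i : ℤ) : ℤ :=
  2 * ((i - 1) / n) + if (i - 1) % n < D.s then 0 else 1

theorem level_eq (a : ℤ) (r : Fin n) :
    D.level (n * a + r + 1) = 2 * a + if (r : ℕ) < D.s then 0 else 1 := by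
  have hn : (0 : ℤ) < n := by exact_mod_cast D.rank_pos
  have hr : ((r : ℕ) : ℤ) < n := by exact_mod_cast r.2
  have h1 : ((n : ℤ) * a + r) / n = a := by
    rw [add_comm, Int.add_mul_ediv_left _ _ hn.ne', Int.ediv_eq_zero_of_lt (by positivity) hr,
      zero_add]
  have h2 : ((n : ℤ) * a + r) % n = r := by
    rw [add_comm, Int.add_mul_emod_self_left, Int.emod_eq_of_lt (by positivity) hr]
  rw [level, add_sub_cancel_right, h1, h2]
  simp

theorem rhoNat_mem (r : Fin n) : D.rhoNat r ∈ D.unitRoots := by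
  rcases lt_or_ge (r : ℕ) D.s with h | h
  · rw [rhoNat_of_lt_s h]
    exact α_mem_unitRoots r
  · rw [rhoNat_of_s_le h]
    exact apply_mem_unitRoots cPlus_mem (α_mem_unitRoots r)

theorem rho_mem (i : ℤ) : D.rho i ∈ D.unitRoots := by
  obtain ⟨a, r, rfl⟩ := D.exists_index i
  rw [rho_eq]
  exact apply_mem_unitRoots (c_zpow_mem a) (rhoNat_mem r)

theorem up_rho (i : ℤ) : D.Up (D.rho i) (-D.level i) := by
  obtain ⟨a, r, rfl⟩ := D.exists_index i
  rw [rho_eq, level_eq, up_c_zpow_iff]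
  rcases lt_or_ge (r : ℕ) D.s with h | h
  · rw [rhoNat_of_lt_s h, if_pos h]
    simpa using up_α_of_lt h
  · rw [rhoNat_of_s_le h, if_neg (by omega)]
    convert up_cPlus_α_of_le h using 1
    ring

theorem exists_rho_eq {v : Euc n} (hv : v ∈ D.unitRoots) {L : ℤ} (h : D.Up v (-L)) :
    ∃ i, D.level i = L ∧ D.rho i = v := by
  have hsub : ∀ m : ℤ, (D.c ^ m : Iso n) ((D.c ^ (-m) : Iso n) v) = v := by
    intro m
    rw [← c_zpow_add_apply, add_neg_cancel]
    rfl
  rcases Int.even_or_odd' L with ⟨m, rfl | rfl⟩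
  · have h1 : D.Up ((D.c ^ (-m) : Iso n) v) 0 := by
      rw [up_c_zpow_iff]
      convert h using 1
      ring
    obtain ⟨r, hr, he⟩ := exists_eq_α_of_up_zero (apply_mem_unitRoots (c_zpow_mem _) hv) h1
    refine ⟨n * m + r + 1, ?_, ?_⟩
    · rw [level_eq, if_pos hr, add_zero]
    · rw [rho_eq, rhoNat_of_lt_s hr, ← he, hsub]
  · have h1 : D.Up ((D.c ^ (-m) : Iso n) v) (-1) := by
      rw [up_c_zpow_iff]
      convert h using 1
      ring
    obtain ⟨r, hr, he⟩ := exists_eq_cPlus_α_of_up_neg_one (apply_mem_unitRoots (c_zpow_mem _) hv) h1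
    refine ⟨n * m + r + 1, ?_, ?_⟩
    · rw [level_eq, if_neg (by omega)]
    · rw [rho_eq, rhoNat_of_s_le hr, ← he, hsub]

theorem rhoNat_injective : Function.Injective fun r : Fin n => D.rhoNat r := by
  intro r r' he
  simp only at he
  have hα := D.linearIndependent_α.injective
  have hcross : ∀ r r' : Fin n, (r : ℕ) < D.s → D.s ≤ (r' : ℕ) → D.rhoNat r ≠ D.rhoNat r' := by
    intro r r' hr hr' he
    have h1 := up_α_of_lt hr
    have h2 := up_cPlus_α_of_le hr'
    rw [← rhoNat_of_lt_s hr] at h1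
    rw [← rhoNat_of_s_le hr', ← he] at h2
    have := h2.eq_of_lt (rhoNat_mem r) (m := 1) (by simpa using h1) (by norm_num)
      (by have := h_pos (D := D); omega)
    omega
  rcases lt_or_ge (r : ℕ) D.s with h | h <;> rcases lt_or_ge (r' : ℕ) D.s with h' | h'
  · rw [rhoNat_of_lt_s h, rhoNat_of_lt_s h'] at he
    exact hα he
  · exact absurd he (hcross r r' h h')
  · exact absurd he.symm (hcross r' r h' h)
  · rw [rhoNat_of_s_le h, rhoNat_of_s_le h'] at he
    exact hα (D.cPlus.injective he)

theorem rho_injective_of_level {i j : ℤ} (hl : D.level i = D.level j) (he : D.rho i = D.rho j) :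
    i = j := by
  obtain ⟨a, r, rfl⟩ := D.exists_index i
  obtain ⟨b, r', rfl⟩ := D.exists_index j
  rw [level_eq, level_eq] at hl
  have hab : a = b := by split_ifs at hl <;> omega
  subst hab
  rw [rho_eq, rho_eq] at he
  rw [rhoNat_injective ((D.c ^ a).injective he)]

/-- If the Coxeter number is odd, then both blocks have the same size: the roots of level `h`
are the negatives of those of level `0`. -/
theorem two_mul_s_of_odd (hodd : Odd D.h) : n = 2 * D.s := by
  obtain ⟨m, hm⟩ := hodd
  have hh := two_le_h (D := D)
  -- `c ^ m c_+` maps the second block onto the negative of the first one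
  have h1 : ∀ i : {i : Fin n // (i : ℕ) < D.s}, ∃ j : {j : Fin n // D.s ≤ (j : ℕ)},
      -D.α i = (D.c ^ (m : ℤ) : Iso n) (D.cPlus (D.α j)) := by
    rintro ⟨i, hi⟩
    have hu := ((up_α_of_lt hi).neg (α_mem_unitRoots i)).add_mul (-1)
    have hu' : D.Up (-D.α i) (-(2 * m + 1 : ℤ)) := by
      convert hu using 1
      rw [hm]
      push_cast
      ring
    have hu2 : D.Up ((D.c ^ (-(m : ℤ)) : Iso n) (-D.α i)) (-1) := by
      rw [up_c_zpow_iff]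
      convert hu' using 1
      ring
    obtain ⟨j, hj, he⟩ := exists_eq_cPlus_α_of_up_neg_one
      (apply_mem_unitRoots (c_zpow_mem _) (neg_mem_unitRoots (α_mem_unitRoots i))) hu2
    refine ⟨⟨j, hj⟩, ?_⟩
    rw [← he, ← c_zpow_add_apply, add_neg_cancel]
    rfl
  have h2 : ∀ j : {j : Fin n // D.s ≤ (j : ℕ)}, ∃ i : {i : Fin n // (i : ℕ) < D.s},
      D.α i = -(D.c ^ (m : ℤ) : Iso n) (D.cPlus (D.α j)) := by
    rintro ⟨j, hj⟩
    have hmem := apply_mem_unitRoots (c_zpow_mem (D := D) m)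
      (apply_mem_unitRoots cPlus_mem (α_mem_unitRoots (D := D) j))
    have hu : D.Up ((D.c ^ (m : ℤ) : Iso n) (D.cPlus (D.α j))) (-(D.h : ℤ)) := by
      rw [up_c_zpow_iff]
      convert up_cPlus_α_of_le hj using 1
      rw [hm]
      push_cast
      ring
    have hu' := hu.neg hmem
    rw [neg_add_cancel] at hu'
    obtain ⟨i, hi, he⟩ := exists_eq_α_of_up_zero (neg_mem_unitRoots hmem) hu'
    exact ⟨⟨i, hi⟩, he.symm⟩
  choose f hf using h1
  choose g hg using h2
  have hα := D.linearIndependent_α.injective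
  have hfinj : Function.Injective f := by
    intro i i' he
    have h3 := hf i
    rw [he, ← hf i', neg_inj] at h3
    exact Subtype.ext (hα h3)
  have hginj : Function.Injective g := by
    intro j j' he
    have h3 := hg j
    rw [he, hg j', neg_inj] at h3
    exact Subtype.ext (hα (D.cPlus.injective ((D.c ^ (m : ℤ)).injective h3))).symm
  have hc1 := Fintype.card_le_of_injective f hfinj
  have hc2 := Fintype.card_le_of_injective g hginj
  have hA : Fintype.card {i : Fin n // (i : ℕ) < D.s} = D.s := by
    rw [Fintype.card_subtype, Fin.card_filter_val_lt, min_eq_right D.s_le]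
  have hB : Fintype.card {i : Fin n // D.s ≤ (i : ℕ)} = n - D.s := by
    have h3 := Fintype.card_subtype_compl fun i : Fin n => (i : ℕ) < D.s
    rw [hA, Fintype.card_fin] at h3
    rw [← h3]
    exact Fintype.card_congr (Equiv.subtypeEquivRight fun i => by simp)
  have := D.s_le
  omega

/-- The number `n h / 2` of reflections. -/
noncomputable def numRefl (D : BipartiteReflectionGroup n) : ℤ := ((n * D.h / 2 : ℕ) : ℤ)

theorem two_mul_numRefl : 2 * D.numRefl = n * D.h := by
  have h1 : Even (n * D.h) := by
    rcases Nat.even_or_odd D.h with h | h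
    · exact h.mul_left n
    · have h2 := two_mul_s_of_odd h
      exact Even.mul_right (h2 ▸ even_two_mul D.s) _
  rw [numRefl]
  have := Nat.two_mul_div_two_of_even h1
  exact_mod_cast this

/-- The index at the end of level `h - 1`, in terms of the quotient and the remainder by `n`. -/
theorem numRefl_cases : (∃ q : ℤ, (D.h : ℤ) = 2 * q ∧ D.numRefl = n * q) ∨
    ∃ q : ℤ, (D.h : ℤ) = 2 * q + 1 ∧ D.numRefl = n * q + D.s ∧ (n : ℤ) = 2 * D.s := by
  have h2 := two_mul_numRefl (D := D)
  rcases Nat.even_or_odd' D.h with ⟨q, h | h⟩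
  · refine Or.inl ⟨q, by exact_mod_cast h, ?_⟩
    rw [h] at h2
    push_cast at h2
    linarith
  · have h3 := two_mul_s_of_odd ⟨q, h⟩
    have h4 : (n : ℤ) = 2 * D.s := by exact_mod_cast h3
    refine Or.inr ⟨q, by exact_mod_cast h, ?_, h4⟩
    rw [h] at h2
    push_cast at h2
    linarith

theorem level_nonneg_iff {i : ℤ} : 0 ≤ D.level i ↔ 1 ≤ i := by
  obtain ⟨a, r, rfl⟩ := D.exists_index i
  have hr : ((r : ℕ) : ℤ) < n := by exact_mod_cast r.2
  rw [level_eq]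
  constructor
  · intro h
    have : 0 ≤ a := by split_ifs at h <;> omega
    nlinarith
  · intro h
    have : 0 ≤ a := by
      by_contra! hneg
      nlinarith
    split_ifs <;> omega

theorem level_lt_h_iff {i : ℤ} : D.level i < D.h ↔ i ≤ D.numRefl := by
  obtain ⟨a, r, rfl⟩ := D.exists_index i
  have hr : ((r : ℕ) : ℤ) < n := by exact_mod_cast r.2
  rw [level_eq]
  rcases numRefl_cases (D := D) with ⟨q, hq, hN⟩ | ⟨q, hq, hN, hns⟩
  · rw [hq, hN]
    constructor
    · intro h
      have : a + 1 ≤ q := by split_ifs at h <;> omega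
      nlinarith
    · intro h
      have : a < q := by
        by_contra! hge
        nlinarith
      split_ifs <;> omega
  · rw [hq, hN]
    constructor
    · intro h
      split_ifs at h with hs
      · have : a ≤ q := by omega
        nlinarith
      · have : a + 1 ≤ q := by omega
        nlinarith
    · intro h
      have : a ≤ q := by
        by_contra! hge
        have : (0 : ℤ) ≤ D.s := by positivity
        nlinarith
      rcases this.eq_or_lt with rfl | hlt
      · rw [if_pos (by omega)]
        omega
      · split_ifs <;> omega

theorem neg_h_le_level {i : ℤ} (hi : -D.numRefl < i) : -D.h ≤ D.level i := by
  obtain ⟨a, r, rfl⟩ := D.exists_index i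
  have hr : ((r : ℕ) : ℤ) < n := by exact_mod_cast r.2
  rw [level_eq]
  rcases numRefl_cases (D := D) with ⟨q, hq, hN⟩ | ⟨q, hq, hN, hns⟩
  · rw [hN] at hi
    have : -q ≤ a := by
      by_contra! hge
      nlinarith
    split_ifs <;> omega
  · rw [hN] at hi
    have : -q - 1 ≤ a := by
      by_contra! hge
      have : (0 : ℤ) ≤ D.s := by positivity
      nlinarith
    rcases this.eq_or_lt with rfl | hlt
    · rw [if_neg]
      · omega
      · intro hlt
        have : ((r : ℕ) : ℤ) < D.s := by exact_mod_cast hlt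
        nlinarith
    · split_ifs <;> omega

/-- The vertices of `EX(c)` are the roots whose level is between `-1` and `h`. -/
theorem mem_range_iff_level {i : ℤ} :
    (-(n : ℤ) + D.s + 1 ≤ i ∧ i ≤ D.numRefl + D.s) ↔ -1 ≤ D.level i ∧ D.level i ≤ D.h := by
  obtain ⟨a, r, rfl⟩ := D.exists_index i
  have hr : ((r : ℕ) : ℤ) < n := by exact_mod_cast r.2
  have hs : (D.s : ℤ) ≤ n := by exact_mod_cast D.s_le
  have hs0 : (0 : ℤ) ≤ D.s := by positivity
  have hr0 : (0 : ℤ) ≤ (r : ℕ) := by positivity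
  rw [level_eq]
  refine and_congr ?_ ?_
  · constructor
    · intro h
      have : -1 ≤ a := by
        by_contra! hge
        nlinarith
      rcases this.eq_or_lt with rfl | hlt
      · rw [if_neg]
        · omega
        · intro hlt
          have : ((r : ℕ) : ℤ) < D.s := by exact_mod_cast hlt
          linarith
      · split_ifs <;> omega
    · intro h
      split_ifs at h with hrs
      · have : 0 ≤ a := by omega
        nlinarith
      · rcases (show -1 ≤ a by omega).eq_or_lt with rfl | hlt
        · have : (D.s : ℤ) ≤ (r : ℕ) := by exact_mod_cast not_lt.1 hrs
          linarith
        · have : 0 ≤ a := by omega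
          nlinarith
  · rcases numRefl_cases (D := D) with ⟨q, hq, hN⟩ | ⟨q, hq, hN, hns⟩
    · rw [hq, hN]
      constructor
      · intro h
        have : a ≤ q := by
          by_contra! hge
          nlinarith
        rcases this.eq_or_lt with rfl | hlt
        · rw [if_pos (by omega)]
          omega
        · split_ifs <;> omega
      · intro h
        split_ifs at h with hrs
        · have h1 : a ≤ q := by omega
          have : ((r : ℕ) : ℤ) < D.s := by exact_mod_cast hrs
          nlinarith
        · have : a + 1 ≤ q := by omega
          nlinarith
    · rw [hq, hN]
      constructor
      · intro h
        have : a ≤ q := by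
          by_contra! hge
          nlinarith
        split_ifs <;> omega
      · intro h
        have : a ≤ q := by split_ifs at h <;> omega
        nlinarith

theorem isPositive_rho {i : ℤ} (h1 : 1 ≤ i) (h2 : i ≤ D.numRefl) : D.IsPositive (D.rho i) :=
  isPositive_of_up (rho_mem i) (level_nonneg_iff.2 h1) (level_lt_h_iff.2 h2) (up_rho i)

theorem isPositive_neg_rho {i : ℤ} (h1 : -D.numRefl < i) (h2 : i ≤ 0) :
    D.IsPositive (-D.rho i) := by
  refine isPositive_neg_of_up (rho_mem i) (neg_h_le_level h1) ?_ (up_rho i)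
  have := (level_nonneg_iff (D := D) (i := i)).not
  omega

theorem rho_injOn {i j : ℤ} (hi1 : 1 ≤ i) (hi2 : i ≤ D.numRefl) (hj1 : 1 ≤ j)
    (hj2 : j ≤ D.numRefl) (h : D.rho i = D.rho j) : i = j := by
  refine rho_injective_of_level ?_ h
  have h1 := up_rho (D := D) i
  have h2 := up_rho (D := D) j
  rw [h] at h1
  have hi := level_lt_h_iff.2 hi2
  have hj := level_lt_h_iff.2 hj2
  have hi0 := level_nonneg_iff (D := D).2 hi1
  have hj0 := level_nonneg_iff (D := D).2 hj1
  exact h1.level_eq (rho_mem j) h2 hi0 (by omega) hj0 (by omega)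

theorem exists_rho_eq_of_isPositive {v : Euc n} (hv : v ∈ D.unitRoots) (hp : D.IsPositive v) :
    ∃ i, 1 ≤ i ∧ i ≤ D.numRefl ∧ D.rho i = v := by
  obtain ⟨L, h0, hL, hu⟩ := exists_up_of_isPositive hv hp
  obtain ⟨i, rfl, hi⟩ := exists_rho_eq hv hu
  exact ⟨i, level_nonneg_iff.1 h0, level_lt_h_iff.1 hL, hi⟩

/-- Among the vertices of `EX(c)`, the positive ones are `ρ_1, …, ρ_{nh/2}`. -/
theorem isPositive_rho_iff {i : ℤ} (h1 : -(n : ℤ) + D.s + 1 ≤ i) (h2 : i ≤ D.numRefl + D.s) :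
    D.IsPositive (D.rho i) ↔ 1 ≤ i ∧ i ≤ D.numRefl := by
  refine ⟨fun hp => ?_, fun h => isPositive_rho h.1 h.2⟩
  obtain ⟨h3, h4⟩ := mem_range_iff_level.1 ⟨h1, h2⟩
  have hh := two_le_h (D := D)
  rw [← level_nonneg_iff (D := D), ← level_lt_h_iff]
  by_contra hno
  rw [not_and_or, not_le, not_lt] at hno
  rcases hno with h | h
  · exact not_isPositive_neg hp (isPositive_neg_of_up (rho_mem i) (by omega) h (up_rho i))
  · exact not_isPositive_neg hp (isPositive_neg_of_up' (rho_mem i) h (by omega) (up_rho i))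

/-- The involution `c_+` maps the levels `0, …, h - 1` of the positive roots to `1, …, h`. -/
theorem exists_rho_eq_cPlus {v : Euc n} (hv : v ∈ D.unitRoots) (hp : D.IsPositive v) :
    ∃ i, (-(n : ℤ) + D.s + 1 ≤ i ∧ i ≤ D.numRefl + D.s) ∧ D.rho i = D.cPlus v := by
  obtain ⟨L, h0, hL, hu⟩ := exists_up_of_isPositive hv hp
  obtain ⟨i, hi, he⟩ := exists_rho_eq (apply_mem_unitRoots cPlus_mem hv) (hu.cPlus hv)
  exact ⟨i, mem_range_iff_level.2 ⟨by omega, by omega⟩, he⟩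

/-- The involution `c_-` maps the levels `0, …, h - 1` of the positive roots to `-1, …, h - 2`. -/
theorem exists_rho_eq_cMinus {v : Euc n} (hv : v ∈ D.unitRoots) (hp : D.IsPositive v) :
    ∃ i, (-(n : ℤ) + D.s + 1 ≤ i ∧ i ≤ D.numRefl + D.s) ∧ D.rho i = D.cMinus v := by
  obtain ⟨L, h0, hL, hu⟩ := exists_up_of_isPositive hv hp
  obtain ⟨i, hi, he⟩ := exists_rho_eq (apply_mem_unitRoots cMinus_mem hv) (hu.cMinus hv)
  exact ⟨i, mem_range_iff_level.2 ⟨by omega, by omega⟩, he⟩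

end BipartiteReflectionGroup

/-! ### The bilinear form of the Coxeter element -/

namespace BipartiteReflectionGroup

variable {n : ℕ} {D : BipartiteReflectionGroup n}

theorem oneSubC_apply (x : Euc n) : D.oneSubC x = x - D.c x := rfl

variable (D) in
theorem isUnit_oneSubC : IsUnit D.oneSubC := by
  rw [LinearMap.isUnit_iff_ker_eq_bot, eq_bot_iff]
  intro x hx
  rw [LinearMap.mem_ker, oneSubC_apply, sub_eq_zero] at hx
  exact (Submodule.mem_bot ℝ).2 (eq_zero_of_c_apply_eq hx.symm)

theorem mu_sub_c_mu (x : Euc n) : D.mu x - D.c (D.mu x) = (2 : ℝ) • x := by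
  rw [← oneSubC_apply, mu, LinearMap.smul_apply, map_smul, ← Module.End.mul_apply,
    Ring.mul_inverse_cancel _ D.isUnit_oneSubC, Module.End.one_apply]

theorem c_mu (x : Euc n) : D.c (D.mu x) = D.mu x - (2 : ℝ) • x := by
  rw [← mu_sub_c_mu, sub_sub_cancel]

theorem mu_eq_of_sub_eq {a x : Euc n} (h : a - D.c a = (2 : ℝ) • x) : D.mu x = a := by
  have h1 : D.c (D.mu x - a) = D.mu x - a := by
    rw [map_sub, c_mu, ← h]
    abel
  exact sub_eq_zero.1 (eq_zero_of_c_apply_eq h1)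

theorem mu_c (x : Euc n) : D.mu (D.c x) = D.c (D.mu x) := by
  refine mu_eq_of_sub_eq ?_
  rw [← map_sub, mu_sub_c_mu, map_smul]

theorem mu_c_zpow (m : ℤ) (x : Euc n) :
    D.mu ((D.c ^ m : Iso n) x) = (D.c ^ m : Iso n) (D.mu x) := by
  refine mu_eq_of_sub_eq ?_
  have h : ∀ y, D.c ((D.c ^ m : Iso n) y) = (D.c ^ m : Iso n) (D.c y) := by
    intro y
    rw [← iso_mul_apply, ← iso_mul_apply, ← zpow_one_add, ← zpow_add_one, add_comm]
  rw [h, ← map_sub, mu_sub_c_mu, map_smul]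

/-- The bilinear form `μ(x) · y`. Its symmetrization is the inner product, and the sign pattern
of its values on the roots `ρ_1, …, ρ_{nh/2}` encodes the Coxeter element. -/
noncomputable def form (D : BipartiteReflectionGroup n) (x y : Euc n) : ℝ := inner ℝ (D.mu x) y

theorem form_smul_left (a : ℝ) (x y : Euc n) : D.form (a • x) y = a * D.form x y := by
  rw [form, map_smul, real_inner_smul_left, form]

theorem form_neg_left (x y : Euc n) : D.form (-x) y = -D.form x y := by
  rw [form, map_neg, inner_neg_left, form]

theorem form_sub_left (x x' y : Euc n) : D.form (x - x') y = D.form x y - D.form x' y := by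
  rw [form, map_sub, inner_sub_left, form, form]

theorem form_smul_right (a : ℝ) (x y : Euc n) : D.form x (a • y) = a * D.form x y :=
  real_inner_smul_right _ _ _

theorem form_neg_right (x y : Euc n) : D.form x (-y) = -D.form x y := inner_neg_right _ _

theorem form_sub_right (x y y' : Euc n) : D.form x (y - y') = D.form x y - D.form x y' :=
  inner_sub_right _ _ _

/-- The symmetrization of the form is the inner product: `μ` is a Cayley transform of `c`, and
`(2 x) · (2 y)` expands as `(μ x - c μ x) · (μ y - c μ y)`. -/
theorem form_add_form_swap (x y : Euc n) : D.form x y + D.form y x = 2 * inner ℝ x y := by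
  have h1 : inner ℝ ((2 : ℝ) • x) ((2 : ℝ) • y) = (4 : ℝ) * inner ℝ x y := by
    rw [real_inner_smul_left, real_inner_smul_right]
    ring
  have h2 : (2 : ℝ) * D.form x y = inner ℝ (D.mu x) ((2 : ℝ) • y) := by
    rw [real_inner_smul_right, form]
  have h3 : (2 : ℝ) * D.form y x = inner ℝ (D.mu y) ((2 : ℝ) • x) := by
    rw [real_inner_smul_right, form]
  rw [← mu_sub_c_mu x, inner_sub_right] at h3
  rw [← mu_sub_c_mu y, inner_sub_right] at h2
  rw [← mu_sub_c_mu x, ← mu_sub_c_mu y, inner_sub_left, inner_sub_right, inner_sub_right,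
    LinearIsometryEquiv.inner_map_map, real_inner_comm (D.mu y) (D.c (D.mu x))] at h1
  rw [real_inner_comm (D.mu x) (D.mu y)] at h3
  linarith

theorem form_self {v : Euc n} (hv : v ∈ D.unitRoots) : D.form v v = 1 := by
  have h := form_add_form_swap (D := D) v v
  rw [inner_self_of_mem_unitRoots hv] at h
  linarith

theorem form_c_left (x y : Euc n) : D.form (D.c x) y = -D.form y x := by
  have h := form_add_form_swap (D := D) x y
  rw [form, mu_c, c_mu, inner_sub_left, real_inner_smul_left]
  rw [form] at h
  linarith

theorem form_c_zpow (m : ℤ) (x y : Euc n) :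
    D.form ((D.c ^ m : Iso n) x) y = D.form x ((D.c ^ (-m) : Iso n) y) := by
  rw [form, form, mu_c_zpow, ← (D.c ^ (-m)).inner_map_map, ← c_zpow_add_apply, neg_add_cancel]
  rfl

/-- The operator `μ` maps the first `n` roots of the sequence to the fundamental weights. -/
theorem mu_rhoNat (r : Fin n) : D.mu (D.rhoNat r) = D.ω r := by
  refine mu_eq_of_sub_eq ?_
  rcases lt_or_ge (r : ℕ) D.s with h | h
  · have h1 : D.cMinus (D.ω r) = D.ω r := cMinus_apply_of_orthogonal fun j hj => by
      rw [inner_α_ω, if_neg (by rintro rfl; omega)]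
    rw [rhoNat_of_lt_s h, c_eq, iso_mul_apply, h1]
    refine D.ext_inner_ω fun j => ?_
    rw [inner_sub_right, inner_ω_cPlus, real_inner_smul_right, inner_ω_α, inner_α_ω]
    rcases eq_or_ne j r with rfl | hj
    · simp [h]
    · simp [hj]
  · have h1 : D.cMinus (D.ω r) = D.ω r - (2 : ℝ) • D.α r := by
      refine D.ext_inner_ω fun j => ?_
      rw [inner_ω_cMinus, inner_sub_right, real_inner_smul_right, inner_ω_α, inner_α_ω]
      rcases eq_or_ne j r with rfl | hj
      · simp [h]
      · simp [hj]
    have h2 : D.cPlus (D.ω r) = D.ω r := cPlus_apply_of_orthogonal fun j hj => by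
      rw [inner_α_ω, if_neg (by rintro rfl; omega)]
    rw [rhoNat_of_s_le h, c_eq, iso_mul_apply, h1, map_sub, h2, map_smul, sub_sub_cancel]

theorem rho_add_mul (a i : ℤ) : D.rho (i + n * a) = (D.c ^ a : Iso n) (D.rho i) := by
  obtain ⟨b, r, rfl⟩ := D.exists_index i
  rw [show (n : ℤ) * b + r + 1 + n * a = n * (a + b) + r + 1 by ring, rho_eq, rho_eq,
    c_zpow_add_apply]

theorem form_rho (a : ℤ) (r : Fin n) (j : ℤ) :
    D.form (D.rho (n * a + r + 1)) (D.rho j) = inner ℝ (D.ω r) (D.rho (j - n * a)) := by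
  rw [rho_eq, form_c_zpow, ← rho_add_mul, form, mu_rhoNat]
  congr 2
  ring

/-- An earlier root of the sequence pairs nonnegatively with a later one: by invariance under
`c`, this value is a simple coefficient of a positive root. -/
theorem form_rho_nonneg {i j : ℤ} (hi : 1 ≤ i) (hij : i ≤ j) (hj : j ≤ D.numRefl) :
    0 ≤ D.form (D.rho i) (D.rho j) := by
  obtain ⟨a, r, rfl⟩ := D.exists_index i
  have hr : ((r : ℕ) : ℤ) < n := by exact_mod_cast r.2
  rw [form_rho]
  have ha : 0 ≤ a := by
    by_contra! hneg
    nlinarith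
  have hna : 0 ≤ (n : ℤ) * a := by positivity
  exact (isPositive_iff_of_mem (rho_mem _)).1 (isPositive_rho (by omega) (by omega)) r

theorem inner_ω_rhoNat_of_lt {r r' : Fin n} (h : r' < r) : inner ℝ (D.ω r) (D.rhoNat r') = 0 := by
  rcases lt_or_ge (r' : ℕ) D.s with hs | hs
  · rw [rhoNat_of_lt_s hs, inner_ω_α, if_neg h.ne']
  · have h' : (r' : ℕ) < r := h
    rw [rhoNat_of_s_le hs, inner_ω_cPlus, inner_ω_α, if_neg h.ne', if_neg (by omega), sub_zero]

/-- A later root of the sequence pairs nonpositively with an earlier one: up to a power of `c`, the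
later one is among `ρ_1, …, ρ_n`, and then the value is a simple coefficient of a root which is
negative or is one of the preceding `ρ_i`. -/
theorem form_rho_nonpos {i j : ℤ} (hj : 1 ≤ j) (hij : j < i) (hi : i ≤ D.numRefl) :
    D.form (D.rho i) (D.rho j) ≤ 0 := by
  obtain ⟨a, r, rfl⟩ := D.exists_index i
  have hr : ((r : ℕ) : ℤ) < n := by exact_mod_cast r.2
  rw [form_rho]
  have ha : 0 ≤ a := by
    by_contra! hneg
    nlinarith
  rcases le_or_gt (j - n * a) 0 with h | h
  · have h1 := (isPositive_iff_of_mem (neg_mem_unitRoots (rho_mem _))).1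
      (isPositive_neg_rho (D := D) (i := j - n * a) (by omega) h) r
    rw [inner_neg_right] at h1
    linarith
  · have hlt : (j - n * a - 1).toNat < n := by omega
    have h1 := rho_eq (D := D) 0 ⟨(j - n * a - 1).toNat, hlt⟩
    rw [mul_zero, zero_add, Int.toNat_of_nonneg (by omega), sub_add_cancel, zpow_zero] at h1
    rw [h1]
    refine (inner_ω_rhoNat_of_lt (r' := ⟨(j - n * a - 1).toNat, hlt⟩) ?_).le
    rw [Fin.lt_def]
    simp only
    omega

/-! ### The simplices of `EX(c)` -/

/-- A product `R(τ_1) ⋯ R(τ_m) c` has a fixed space of dimension at most `m`. Equality holds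
exactly when the form vanishes on the pairs `(τ_j, τ_i)` with `i < j`, and then the fixed space is
spanned by the vectors `μ(τ_i)`. -/
theorem fixSpace_prod_mul_c (l : List (Euc n)) (hl : ∀ v ∈ l, v ∈ D.unitRoots) :
    Module.finrank ℝ (fixSpace ((l.map reflIn).prod * D.c)) ≤ l.length ∧
    (Module.finrank ℝ (fixSpace ((l.map reflIn).prod * D.c)) = l.length →
      l.Pairwise fun a b => D.form b a = 0) ∧
    ((l.Pairwise fun a b => D.form b a = 0) →
      Module.finrank ℝ (fixSpace ((l.map reflIn).prod * D.c)) = l.length ∧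
      fixSpace ((l.map reflIn).prod * D.c) = Submodule.span ℝ (D.mu '' {v | v ∈ l})) := by
  induction l with
  | nil =>
    rw [List.map_nil, List.prod_nil, one_mul, fixSpace_c]
    simp
  | cons v l ih =>
    have hv := hl v (by simp)
    have hv0 := ne_zero_of_mem_unitRoots hv
    obtain ⟨ih1, ih2, ih3⟩ := ih fun w hw => hl w (by simp [hw])
    rw [List.map_cons, List.prod_cons, mul_assoc]
    set g := (l.map reflIn).prod * D.c with hg
    have hd := finrank_fixSpace_add_finrank_M g
    have hd' := finrank_fixSpace_add_finrank_M (reflIn v * g)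
    have hle := finrank_M_le_reflIn_mul g hv0
    rw [List.length_cons]
    -- the root lies in `M g` exactly when it is compatible with the tail of the list
    have hmem : (l.Pairwise fun a b => D.form b a = 0) →
        (v ∈ M g ↔ ∀ w ∈ l, D.form w v = 0) := by
      intro hp
      rw [M_eq_orthogonal_fixSpace, (ih3 hp).2]
      constructor
      · intro h w hw
        exact (Submodule.mem_orthogonal _ _).1 h _ (Submodule.subset_span ⟨w, hw, rfl⟩)
      · intro h
        rw [Submodule.mem_orthogonal]
        intro y hy
        induction hy using Submodule.span_induction with
        | mem y hy =>
          obtain ⟨w, hw, rfl⟩ := hy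
          exact h w hw
        | zero => exact inner_zero_left _
        | add y z _ _ hy hz => rw [inner_add_left, hy, hz, add_zero]
        | smul a y _ hy => rw [real_inner_smul_left, hy, mul_zero]
    refine ⟨by omega, fun h => ?_, fun h => ?_⟩
    · have hp := ih2 (by omega)
      have hvM : v ∈ M g := mem_M_of_finrank_lt (by omega)
      exact List.pairwise_cons.2 ⟨(hmem hp).1 hvM, hp⟩
    · obtain ⟨hvl, hp⟩ := List.pairwise_cons.1 h
      have hvM := (hmem hp).2 hvl
      obtain ⟨ih4, ih5⟩ := ih3 hp
      have hdim : Module.finrank ℝ (fixSpace (reflIn v * g)) = l.length + 1 := by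
        have := finrank_M_reflIn_mul hv0 hvM
        omega
      refine ⟨hdim, (Submodule.eq_of_le_of_finrank_le ?_ ?_).symm⟩
      · rw [Submodule.span_le]
        rintro _ ⟨w, hw, rfl⟩
        rcases List.mem_cons.1 hw with rfl | hw
        · -- `c` shifts `μ(w)` by `-2 w`, which is what the reflection in `w` undoes
          have hprod : ∀ m : List (Euc n), (∀ u ∈ m, D.form u w = 0) →
              (m.map reflIn).prod (D.mu w - (2 : ℝ) • w) = D.mu w - (2 : ℝ) • w := by
            intro m hm
            induction m with
            | nil => rfl
            | cons u m ihm =>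
              rw [List.map_cons, List.prod_cons, iso_mul_apply,
                ihm fun u hu => hm u (by simp [hu])]
              refine reflIn_eq_self_of_inner_eq_zero ?_
              have h1 := form_add_form_swap (D := D) u w
              rw [hm u (by simp), zero_add, form, real_inner_comm] at h1
              rw [inner_sub_right, real_inner_smul_right, h1, sub_self]
          rw [SetLike.mem_coe, mem_fixSpace, iso_mul_apply, hg, iso_mul_apply, c_mu, hprod l hvl,
            reflIn_apply hv.1, inner_sub_right, real_inner_smul_right,
            inner_self_of_mem_unitRoots hv, real_inner_comm, ← form, form_self hv]
          module
        · exact fixSpace_le_fixSpace_reflIn_mul hvM (ih5 ▸ Submodule.subset_span ⟨w, hw, rfl⟩)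
      · -- the span has full dimension, as `μ(v)` is not orthogonal to `v`
        have hlt : fixSpace g < Submodule.span ℝ (D.mu '' {w | w ∈ v :: l}) := by
          refine lt_of_le_of_ne ?_ fun he => ?_
          · rw [ih5]
            exact Submodule.span_mono (Set.image_mono fun w hw => by
              simp only [Set.mem_ofPred_eq] at hw ⊢
              exact List.mem_cons_of_mem _ hw)
          · have h1 : D.mu v ∈ fixSpace g := he ▸ Submodule.subset_span ⟨v, by simp, rfl⟩
            have h2 := inner_eq_zero_of_mem_M h1 hvM
            rw [← form, form_self hv] at h2
            exact one_ne_zero h2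
        have := Submodule.finrank_lt_finrank_of_lt hlt
        omega

theorem pairwise_sort_iff {r : ℤ → ℤ → Prop} (I : Finset ℤ) :
    I.sort.Pairwise r ↔ ∀ i ∈ I, ∀ j ∈ I, i < j → r i j := by
  have hs : I.sort.Pairwise (· < ·) := I.sortedLT_sort.pairwise
  constructor
  · intro h i hi j hj hij
    have h1 : I.sort.Pairwise fun a b => (a < b → r a b) ∧ (b < a → r b a) :=
      (h.and hs).imp fun hab => ⟨fun _ => hab.1, fun hba => absurd hab.2 hba.not_gt⟩
    have h2 : Std.Symm fun a b : ℤ => (a < b → r a b) ∧ (b < a → r b a) := ⟨fun _ _ h => h.symm⟩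
    exact (h1.forall ((Finset.mem_sort _).2 hi) ((Finset.mem_sort _).2 hj) hij.ne).1 hij
  · intro h
    refine hs.imp_of_mem fun ha hb hab => ?_
    exact h _ ((Finset.mem_sort _).1 ha) _ ((Finset.mem_sort _).1 hb) hab

theorem reflProd_mem (I : Finset ℤ) : D.reflProd I ∈ D.W := by
  refine Subgroup.list_prod_mem _ fun g hg => ?_
  obtain ⟨i, -, rfl⟩ := List.mem_map.1 hg
  exact (rho_mem i).2

theorem reflProd_eq (I : Finset ℤ) : D.reflProd I = ((I.sort.map D.rho).map reflIn).prod := by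
  rw [reflProd, List.map_map]
  rfl

/-- The complex `EX(c)` is a flag complex: its simplices are the sets of vertices on which the
form vanishes for the pairs of a later and an earlier vertex. -/
theorem mem_EX_iff (I : Finset ℤ) :
    I ∈ D.EX ↔ (∀ i ∈ I, -(n : ℤ) + D.s + 1 ≤ i ∧ i ≤ D.numRefl + D.s) ∧
      ∀ i ∈ I, ∀ j ∈ I, i < j → D.form (D.rho j) (D.rho i) = 0 := by
  have hl : ∀ v ∈ I.sort.map D.rho, v ∈ D.unitRoots := by
    intro v hv
    obtain ⟨i, -, rfl⟩ := List.mem_map.1 hv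
    exact rho_mem i
  obtain ⟨-, h2, h3⟩ := fixSpace_prod_mul_c _ hl
  rw [← reflProd_eq] at h2 h3
  rw [List.length_map, Finset.length_sort] at h2 h3
  refine and_congr Iff.rfl ?_
  rw [length_eq_finrank_M (D.W.mul_mem (reflProd_mem I) c_mem)]
  have h4 := finrank_fixSpace_add_finrank_M (D.reflProd I * D.c)
  rw [List.pairwise_map, pairwise_sort_iff] at h2 h3
  constructor
  · intro h
    exact h2 (by omega)
  · intro h
    have := (h3 h).1
    omega

/-- The roots of a simplex of `EX(c)` are linearly independent. -/
theorem card_le_of_mem_EX {I : Finset ℤ} (hI : I ∈ D.EX) {U : Submodule ℝ (Euc n)}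
    (hU : ∀ i ∈ I, D.rho i ∈ U) : I.card ≤ Module.finrank ℝ U := by
  have hl : ∀ v ∈ I.sort.map D.rho, v ∈ D.unitRoots := by
    intro v hv
    obtain ⟨i, -, rfl⟩ := List.mem_map.1 hv
    exact rho_mem i
  obtain ⟨-, -, h3⟩ := fixSpace_prod_mul_c _ hl
  rw [List.length_map, Finset.length_sort, List.pairwise_map, pairwise_sort_iff] at h3
  obtain ⟨h4, h5⟩ := h3 ((mem_EX_iff I).1 hI).2
  rw [← h4, h5]
  have h6 : Submodule.span ℝ (D.mu '' {v | v ∈ I.sort.map D.rho}) ≤ U.map D.mu := by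
    rw [Submodule.span_le]
    rintro _ ⟨v, hv, rfl⟩
    obtain ⟨i, hi, rfl⟩ := List.mem_map.1 hv
    exact ⟨_, hU i ((Finset.mem_sort _).1 hi), rfl⟩
  exact (Submodule.finrank_mono h6).trans (Submodule.finrank_map_le _ _)

end BipartiteReflectionGroup

/-! ### Minimal generators of cones -/

section Cones

variable {V : Type*} [NormedAddCommGroup V] [InnerProductSpace ℝ V]

theorem nonneg_of_mem_hull {s : Set V} {f : V →ₗ[ℝ] ℝ} (hf : ∀ v ∈ s, 0 ≤ f v) {x : V}
    (hx : x ∈ PointedCone.hull ℝ s) : 0 ≤ f x := by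
  induction hx using Submodule.span_induction with
  | mem v hv => exact hf v hv
  | zero => simp
  | add x y _ _ hx hy => rw [map_add]; exact add_nonneg hx hy
  | smul a x _ hx =>
    change 0 ≤ f ((a : ℝ) • x)
    rw [map_smul]
    exact mul_nonneg a.2 hx

theorem mem_span_of_mem_hull {s : Set V} {x : V} (hx : x ∈ PointedCone.hull ℝ s) :
    x ∈ Submodule.span ℝ s := by
  induction hx using Submodule.span_induction with
  | mem v hv => exact Submodule.subset_span hv
  | zero => exact Submodule.zero_mem _
  | add x y _ _ hx hy => exact Submodule.add_mem _ hx hy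
  | smul a x _ hx => exact Submodule.smul_mem _ (a : ℝ) hx

/-- If a functional is nonnegative on a set, then its zeros in the hull of the set are spanned by
its zeros in the set. -/
theorem mem_span_zeros_of_mem_hull {s : Set V} {f : V →ₗ[ℝ] ℝ} (hf : ∀ v ∈ s, 0 ≤ f v) {x : V}
    (hx : x ∈ PointedCone.hull ℝ s) (h0 : f x = 0) :
    x ∈ Submodule.span ℝ {v ∈ s | f v = 0} := by
  induction hx using Submodule.span_induction with
  | mem v hv => exact Submodule.subset_span ⟨hv, h0⟩
  | zero => exact Submodule.zero_mem _
  | add x y hx hy ihx ihy =>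
    have h1 := nonneg_of_mem_hull hf hx
    have h2 := nonneg_of_mem_hull hf hy
    rw [map_add] at h0
    exact Submodule.add_mem _ (ihx (by linarith)) (ihy (by linarith))
  | smul a x hx ih =>
    change (a : ℝ) • x ∈ _
    replace h0 : f ((a : ℝ) • x) = 0 := h0
    rw [map_smul, smul_eq_mul] at h0
    rcases mul_eq_zero.1 h0 with h | h
    · rw [h, zero_smul]
      exact Submodule.zero_mem _
    · exact Submodule.smul_mem _ _ (ih h)

/-- A finite set of unit vectors in an open half-space is contained in the hull of those of its
elements that do not lie in the hull of the others. -/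
theorem subset_hull_minimal_generators {T : Set V} (hT : T.Finite) (hnorm : ∀ v ∈ T, ‖v‖ = 1)
    {x₀ : V} (hx₀ : ∀ v ∈ T, 0 < inner ℝ x₀ v) :
    T ⊆ PointedCone.hull ℝ {v | v ∈ T ∧ v ∉ PointedCone.hull ℝ (T \ {v})} := by
  classical
  -- a generating subset with the least number of elements
  have hex : ∃ k, ∃ S : Finset V, S.card = k ∧ (S : Set V) ⊆ T ∧
      T ⊆ PointedCone.hull ℝ (S : Set V) :=
    ⟨_, hT.toFinset, rfl, by simp, by simp⟩
  obtain ⟨S, hcard, hST, hTS⟩ := Nat.find_spec hex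
  have hmin : ∀ s ∈ S, s ∉ PointedCone.hull ℝ ((S : Set V) \ {s}) := by
    intro s hs hmem
    refine Nat.find_min hex (m := (S.erase s).card) ?_ ⟨S.erase s, rfl, ?_, ?_⟩
    · rw [← hcard]
      exact Finset.card_erase_lt_of_mem hs
    · exact (Finset.coe_subset.2 (Finset.erase_subset _ _)).trans hST
    · refine hTS.trans ?_
      rw [Finset.coe_erase]
      change PointedCone.hull ℝ (S : Set V) ≤ PointedCone.hull ℝ ((S : Set V) \ {s})
      refine Submodule.span_le.2 fun t ht => ?_
      rcases eq_or_ne t s with rfl | hne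
      · exact hmem
      · exact Submodule.subset_span ⟨ht, hne⟩
  refine hTS.trans ?_
  change PointedCone.hull ℝ (S : Set V) ≤ _
  refine Submodule.span_mono fun s hs => ⟨hST hs, fun hmem => ?_⟩
  have hsT := hST hs
  have hins : (S : Set V) = insert s ((S : Set V) \ {s}) := by
    rw [Set.insert_sdiff_singleton, Set.insert_eq_of_mem hs]
  have hnn : ∀ r ∈ PointedCone.hull ℝ ((S : Set V) \ {s}), 0 ≤ inner ℝ x₀ r := fun r hr =>
    nonneg_of_mem_hull (f := innerₛₗ ℝ x₀) (fun v hv => (hx₀ v (hST hv.1)).le) hr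
  have hpos : ∀ r ∈ PointedCone.hull ℝ ((S : Set V) \ {s}), inner ℝ x₀ r = 0 → r = 0 := by
    intro r hr h0
    have h1 := mem_span_zeros_of_mem_hull (f := innerₛₗ ℝ x₀)
      (fun v hv => (hx₀ v (hST hv.1)).le) hr h0
    have h2 : {v ∈ (S : Set V) \ {s} | innerₛₗ ℝ x₀ v = 0} = ∅ := by
      ext v
      refine ⟨fun hv => (hx₀ v (hST hv.1.1)).ne' hv.2, fun hv => hv.elim⟩
    rwa [h2, Submodule.span_empty, Submodule.mem_bot] at h1
  -- elements of the hull of `T \ {s}` are not multiples of `s`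
  have key : ∀ x ∈ PointedCone.hull ℝ (T \ {s}), ∃ a : ℝ, 0 ≤ a ∧
      ∃ r ∈ PointedCone.hull ℝ ((S : Set V) \ {s}), x = a • s + r ∧ (inner ℝ x₀ r = 0 → a = 0) := by
    intro x hx
    induction hx using Submodule.span_induction with
    | mem t ht =>
      have h1 := hTS ht.1
      rw [hins] at h1
      obtain ⟨a, r, hr, he⟩ := Submodule.mem_span_insert.1 h1
      refine ⟨a, a.2, r, hr, he, fun h0 => ?_⟩
      have h2 : t = (a : ℝ) • s := by
        rw [he, hpos r hr h0, add_zero]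
        rfl
      have h3 := hnorm t ht.1
      rw [h2, norm_smul, hnorm s hsT, mul_one, Real.norm_of_nonneg a.2] at h3
      rw [h3, one_smul] at h2
      exact absurd h2 ht.2
    | zero => exact ⟨0, le_rfl, 0, Submodule.zero_mem _, by simp, fun _ => rfl⟩
    | add x y _ _ hx hy =>
      obtain ⟨a, ha, r, hr, hxe, h0⟩ := hx
      obtain ⟨b, hb, r', hr', hye, h0'⟩ := hy
      refine ⟨a + b, add_nonneg ha hb, r + r', Submodule.add_mem _ hr hr', ?_, fun h => ?_⟩
      · rw [hxe, hye]
        module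
      · rw [inner_add_right] at h
        have h1 := hnn r hr
        have h2 := hnn r' hr'
        rw [h0 (by linarith), h0' (by linarith), add_zero]
    | smul c x _ hx =>
      obtain ⟨a, ha, r, hr, hxe, h0⟩ := hx
      refine ⟨c * a, mul_nonneg c.2 ha, (c : ℝ) • r, Submodule.smul_mem _ c hr, ?_, fun h => ?_⟩
      · change (c : ℝ) • x = _
        rw [hxe]
        module
      · rw [real_inner_smul_right] at h
        rcases mul_eq_zero.1 h with h | h
        · rw [h, zero_mul]
        · rw [h0 h, mul_zero]
  obtain ⟨a, ha, r, hr, hse, h0⟩ := key s hmem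
  rcases lt_or_ge a 1 with h | h
  · refine hmin s hs ?_
    have h1 : s = (1 - a)⁻¹ • r := by
      have h2 : r = (1 - a) • s := by
        rw [sub_smul, one_smul]
        exact eq_sub_of_add_eq' hse.symm
      rw [h2, smul_smul, inv_mul_cancel₀ (by linarith), one_smul]
    have h3 : (1 - a)⁻¹ • r ∈ PointedCone.hull ℝ ((S : Set V) \ {s}) :=
      Submodule.smul_mem _ (⟨(1 - a)⁻¹, inv_nonneg.2 (by linarith)⟩ : {c : ℝ // 0 ≤ c}) hr
    rwa [← h1] at h3
  · have h1 := congrArg (inner ℝ x₀) hse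
    rw [inner_add_right, real_inner_smul_right] at h1
    have h2 := hnn r hr
    have h3 := hx₀ s hsT
    have h4 : inner ℝ x₀ r = 0 := by nlinarith
    linarith [h0 h4]

/-- Vectors in an open half-space that pairwise form no acute angle are linearly independent. -/
theorem linearIndependent_of_inner_nonpos {ι : Type*} [Fintype ι] {v : ι → V}
    (hv : ∀ i j, i ≠ j → inner ℝ (v i) (v j) ≤ 0) {x₀ : V} (hx₀ : ∀ i, 0 < inner ℝ x₀ (v i)) :
    LinearIndependent ℝ v := by
  rw [Fintype.linearIndependent_iff]
  intro g hg
  -- the combination with the positive coefficients equals that with the negative ones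
  have hsplit : ∑ i, g⁺ i • v i = ∑ i, g⁻ i • v i := by
    rw [← sub_eq_zero, ← Finset.sum_sub_distrib, ← hg]
    refine Finset.sum_congr rfl fun i _ => ?_
    rw [← sub_smul]
    congr 1
    exact congrFun (posPart_sub_negPart g) i
  have hP : ∑ i, g⁺ i • v i = 0 := by
    refine inner_self_eq_zero (𝕜 := ℝ).1 (le_antisymm ?_ real_inner_self_nonneg)
    nth_rewrite 2 [hsplit]
    rw [sum_inner]
    refine Finset.sum_nonpos fun i _ => ?_
    rw [inner_sum]
    refine Finset.sum_nonpos fun j _ => ?_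
    rw [real_inner_smul_left, real_inner_smul_right, ← mul_assoc]
    rcases eq_or_ne i j with rfl | hij
    · have : g⁺ i * g⁻ i = 0 := by
        rw [Pi.posPart_apply, Pi.negPart_apply]
        rcases le_total 0 (g i) with h | h
        · rw [negPart_eq_zero.2 h, mul_zero]
        · rw [posPart_eq_zero.2 h, zero_mul]
      rw [this, zero_mul]
    · exact mul_nonpos_of_nonneg_of_nonpos
        (mul_nonneg (posPart_nonneg g i) (negPart_nonneg g j)) (hv i j hij)
  have hzero : ∀ f : ι → ℝ, (∀ i, 0 ≤ f i) → ∑ i, f i • v i = 0 → ∀ i, f i = 0 := by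
    intro f hf h i
    have h1 := congrArg (inner ℝ x₀) h
    rw [inner_sum, inner_zero_right] at h1
    simp_rw [real_inner_smul_right] at h1
    have h2 := (Finset.sum_eq_zero_iff_of_nonneg fun j _ =>
      mul_nonneg (hf j) (hx₀ j).le).1 h1 i (Finset.mem_univ i)
    exact (mul_eq_zero.1 h2).resolve_right (hx₀ i).ne'
  intro i
  have h1 := hzero _ (posPart_nonneg g) hP i
  have h2 := hzero _ (negPart_nonneg g) (hsplit ▸ hP) i
  have h3 := congrFun (posPart_sub_negPart g) i
  rw [Pi.sub_apply, h1, h2, sub_zero] at h3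
  exact h3.symm

end Cones

/-! ### Noncrossing partitions and their simple systems -/

namespace BipartiteReflectionGroup

variable {n : ℕ} {D : BipartiteReflectionGroup n}

theorem mem_NCP_iff {w : Iso n} : w ∈ D.NCP ↔
    w ∈ D.W ∧ Module.finrank ℝ (M w) + Module.finrank ℝ (M (w⁻¹ * D.c)) = n := by
  refine and_congr_right fun hw => ?_
  rw [le, length_eq_finrank_M hw, length_eq_finrank_M (D.W.mul_mem (D.W.inv_mem hw) c_mem),
    length_eq_finrank_M c_mem, finrank_M_c]

theorem c_mul_inv_mem_NCP {w : Iso n} (hw : w ∈ D.NCP) : D.c * w⁻¹ ∈ D.NCP := by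
  rw [mem_NCP_iff] at hw ⊢
  refine ⟨D.W.mul_mem c_mem (D.W.inv_mem hw.1), ?_⟩
  rw [show (D.c * w⁻¹)⁻¹ * D.c = w by group,
    show D.c * w⁻¹ = w * (w⁻¹ * D.c) * w⁻¹ by group, finrank_M_conj]
  omega

theorem c_mul_inv_inv_mul_c (w : Iso n) : (D.c * w⁻¹)⁻¹ * D.c = w := by group

/-- For `u v = c` with complementary dimensions, `I - c` maps the fixed space of `v` onto `M u`. -/
theorem mu_mem_fixSpace {u : Iso n} (hu : u ∈ D.NCP) {x : Euc n} (hx : x ∈ M u) :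
    D.mu x ∈ fixSpace (u⁻¹ * D.c) := by
  have hle : (fixSpace (u⁻¹ * D.c)).map D.oneSubC ≤ M u := by
    rintro _ ⟨y, hy, rfl⟩
    rw [SetLike.mem_coe, mem_fixSpace] at hy
    have h1 : D.c y = u y := by
      nth_rewrite 2 [← hy]
      rw [← iso_mul_apply, mul_inv_cancel_left]
    rw [oneSubC_apply, h1, ← neg_sub]
    exact (M u).neg_mem (apply_sub_mem_M u y)
  have hinj : Function.Injective D.oneSubC :=
    LinearMap.ker_eq_bot.1 ((LinearMap.isUnit_iff_ker_eq_bot _).1 D.isUnit_oneSubC)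
  have h2 := (mem_NCP_iff.1 hu).2
  have h3 := finrank_fixSpace_add_finrank_M (u⁻¹ * D.c)
  have h4 : (fixSpace (u⁻¹ * D.c)).map D.oneSubC = M u := by
    refine Submodule.eq_of_le_of_finrank_eq hle ?_
    rw [← (Submodule.equivMapOfInjective D.oneSubC hinj _).finrank_eq]
    omega
  rw [← h4] at hx
  obtain ⟨y, hy, rfl⟩ := hx
  have h5 : D.mu (D.oneSubC y) = (2 : ℝ) • y := by
    refine mu_eq_of_sub_eq ?_
    rw [map_smul, ← smul_sub, oneSubC_apply]
  rw [h5]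
  exact Submodule.smul_mem _ _ hy

/-- The spaces of a noncrossing partition and of its complement are orthogonal for the form. -/
theorem form_eq_zero_of_mem {u : Iso n} (hu : u ∈ D.NCP) {x y : Euc n} (hx : x ∈ M u)
    (hy : y ∈ M (u⁻¹ * D.c)) : D.form x y = 0 :=
  inner_eq_zero_of_mem_M (mu_mem_fixSpace hu hx) hy

theorem mem_parabolicPosRoots_iff {u : Iso n} (hu : u ∈ D.W) {v : Euc n} :
    v ∈ D.parabolicPosRoots u ↔ v ∈ D.unitRoots ∧ v ∈ M u ∧ D.IsPositive v := by
  rw [parabolicPosRoots, Set.mem_ofPred_eq, roots_eq_unitRoots]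
  refine and_congr_right fun hv => and_congr_left fun _ => ?_
  have hv0 := ne_zero_of_mem_unitRoots hv
  rw [le, reflIn_inv, length_eq_finrank_M hv.2, length_eq_finrank_M (D.W.mul_mem hv.2 hu),
    length_eq_finrank_M hu, finrank_M_reflIn hv0, add_comm, mem_M_iff_finrank hv0]

theorem finite_parabolicPosRoots (D : BipartiteReflectionGroup n) (u : Iso n) :
    (D.parabolicPosRoots u).Finite :=
  D.finite_roots.subset fun _ h => h.1

theorem simpleSystem_subset (u : Iso n) : D.simpleSystem u ⊆ D.parabolicPosRoots u :=
  fun _ h => h.1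

theorem finite_simpleSystem (D : BipartiteReflectionGroup n) (u : Iso n) :
    (D.simpleSystem u).Finite :=
  (D.finite_parabolicPosRoots u).subset (simpleSystem_subset u)

theorem parabolicPosRoots_subset_hull {u : Iso n} (hu : u ∈ D.W) :
    D.parabolicPosRoots u ⊆ PointedCone.hull ℝ (D.simpleSystem u) := by
  obtain ⟨x₀, hx₀⟩ := D.exists_mem_C
  refine subset_hull_minimal_generators (D.finite_parabolicPosRoots u)
    (fun v hv => ((mem_parabolicPosRoots_iff hu).1 hv).1.1) (x₀ := x₀) fun v hv => ?_
  rw [real_inner_comm]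
  exact ((mem_parabolicPosRoots_iff hu).1 hv).2.2 x₀ hx₀

theorem inner_nonpos_of_mem_simpleSystem {u : Iso n} (hu : u ∈ D.W) {v w : Euc n}
    (hv : v ∈ D.simpleSystem u) (hw : w ∈ D.simpleSystem u) (hne : v ≠ w) : inner ℝ v w ≤ 0 := by
  by_contra! hpos
  obtain ⟨hvr, hvM, hvp⟩ := (mem_parabolicPosRoots_iff hu).1 hv.1
  obtain ⟨hwr, hwM, hwp⟩ := (mem_parabolicPosRoots_iff hu).1 hw.1
  have hr := apply_mem_unitRoots hvr.2 hwr
  have he := reflIn_apply hvr.1 w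
  have hM : reflIn v w ∈ M u := by
    rw [he]
    exact (M u).sub_mem hwM ((M u).smul_mem _ hvM)
  -- one of `v`, `w` is a combination of the other and of the reflected root
  rcases isPositive_or_isPositive_neg hr with hp | hp
  · refine hw.2 ?_
    have h1 : w = reflIn v w + (2 * inner ℝ v w) • v := by rw [he]; abel
    have h2 : reflIn v w ∈ D.parabolicPosRoots u \ {w} := by
      refine ⟨(mem_parabolicPosRoots_iff hu).2 ⟨hr, hM, hp⟩, fun h => ?_⟩
      rw [Set.mem_singleton_iff] at h
      exact hpos.ne' (inner_eq_zero_of_reflIn_eq_self h)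
    have h3 : (2 * inner ℝ v w) • v ∈ PointedCone.hull ℝ (D.parabolicPosRoots u \ {w}) :=
      Submodule.smul_mem _ (⟨2 * inner ℝ v w, by linarith⟩ : {c : ℝ // 0 ≤ c})
        (Submodule.subset_span ⟨hv.1, hne⟩)
    have h4 := Submodule.add_mem _ (PointedCone.subset_hull (R := ℝ) h2) h3
    rwa [← h1] at h4
  · refine hv.2 ?_
    have h1 : v = (2 * inner ℝ v w)⁻¹ • w + (2 * inner ℝ v w)⁻¹ • -reflIn v w := by
      rw [he, ← smul_add, neg_sub, add_sub_cancel, smul_smul, inv_mul_cancel₀ (by linarith),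
        one_smul]
    have h2 : -reflIn v w ∈ D.parabolicPosRoots u \ {v} := by
      refine ⟨(mem_parabolicPosRoots_iff hu).2 ⟨neg_mem_unitRoots hr, (M u).neg_mem hM, hp⟩,
        fun h => ?_⟩
      rw [Set.mem_singleton_iff] at h
      refine hne ?_
      have h3 := congrArg (fun x => reflIn v x) h
      simp only [map_neg, reflIn_apply_apply, reflIn_self] at h3
      exact (neg_injective h3).symm
    have hc : (0 : ℝ) ≤ (2 * inner ℝ v w)⁻¹ := inv_nonneg.2 (by linarith)
    have h3 : (2 * inner ℝ v w)⁻¹ • w ∈ PointedCone.hull ℝ (D.parabolicPosRoots u \ {v}) :=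
      Submodule.smul_mem _ (⟨_, hc⟩ : {c : ℝ // 0 ≤ c}) (Submodule.subset_span ⟨hw.1, hne.symm⟩)
    have h4 : (2 * inner ℝ v w)⁻¹ • -reflIn v w ∈
        PointedCone.hull ℝ (D.parabolicPosRoots u \ {v}) :=
      Submodule.smul_mem _ (⟨_, hc⟩ : {c : ℝ // 0 ≤ c}) (Submodule.subset_span h2)
    have h5 := Submodule.add_mem _ h3 h4
    rwa [← h1] at h5

theorem linearIndepOn_simpleSystem {u : Iso n} (hu : u ∈ D.W) :
    LinearIndepOn ℝ id (D.simpleSystem u) := by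
  have := (D.finite_simpleSystem u).fintype
  obtain ⟨x₀, hx₀⟩ := D.exists_mem_C
  refine linearIndependent_of_inner_nonpos (x₀ := x₀) (fun v w hvw => ?_) fun v => ?_
  · exact inner_nonpos_of_mem_simpleSystem hu v.2 w.2 fun h => hvw (Subtype.ext h)
  · rw [real_inner_comm]
    exact v.2.1.2.2 x₀ hx₀

theorem span_parabolicPosRoots {u : Iso n} (hu : u ∈ D.W) :
    Submodule.span ℝ (D.parabolicPosRoots u) = M u := by
  refine le_antisymm (Submodule.span_le.2 fun v hv => ((mem_parabolicPosRoots_iff hu).1 hv).2.1) ?_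
  rw [← span_unitRoots_inter_M hu, Submodule.span_le]
  rintro v ⟨hv, hvM⟩
  rcases isPositive_or_isPositive_neg hv with h | h
  · exact Submodule.subset_span ((mem_parabolicPosRoots_iff hu).2 ⟨hv, hvM, h⟩)
  · rw [← neg_neg v]
    exact Submodule.neg_mem _ (Submodule.subset_span
      ((mem_parabolicPosRoots_iff hu).2 ⟨neg_mem_unitRoots hv, (M u).neg_mem hvM, h⟩))

theorem span_simpleSystem {u : Iso n} (hu : u ∈ D.W) :
    Submodule.span ℝ (D.simpleSystem u) = M u := by
  rw [← span_parabolicPosRoots hu]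
  exact le_antisymm (Submodule.span_mono (simpleSystem_subset u))
    (Submodule.span_le.2 fun v hv => mem_span_of_mem_hull (parabolicPosRoots_subset_hull hu hv))

theorem finrank_span_of_subset_simpleSystem {u : Iso n} (hu : u ∈ D.W) {s : Set (Euc n)}
    (hs : s ⊆ D.simpleSystem u) : Module.finrank ℝ (Submodule.span ℝ s) = s.ncard := by
  have := ((D.finite_simpleSystem u).subset hs).fintype
  rw [finrank_span_set_eq_card ((linearIndepOn_simpleSystem hu).mono hs),
    Set.ncard_eq_toFinset_card']

theorem ncard_simpleSystem {u : Iso n} (hu : u ∈ D.W) :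
    (D.simpleSystem u).ncard = Module.finrank ℝ (M u) := by
  rw [← finrank_span_of_subset_simpleSystem hu subset_rfl, span_simpleSystem hu]

variable (D) in
/-- The functional `μ(x) · _`. -/
noncomputable def formL (x : Euc n) : Euc n →ₗ[ℝ] ℝ := innerₛₗ ℝ (D.mu x)

theorem formL_apply (x y : Euc n) : D.formL x y = D.form x y := rfl

variable (D) in
/-- The functional `μ(_) · y`. -/
noncomputable def formR (y : Euc n) : Euc n →ₗ[ℝ] ℝ := (innerₛₗ ℝ y).comp D.mu

theorem formR_apply (x y : Euc n) : D.formR y x = D.form x y :=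
  real_inner_comm (D.mu x) y

/-- Passing from `u` to `R(v) u` lowers the dimension of `M u` by one and raises that of the
complement by at most one. As these dimensions add up to at least `n`, their sum remains `n`. -/
theorem reflIn_mul_mem_NCP {u : Iso n} (hu : u ∈ D.NCP) {v : Euc n} (hv : v ∈ D.unitRoots)
    (hvM : v ∈ M u) : reflIn v * u ∈ D.NCP := by
  rw [mem_NCP_iff] at hu ⊢
  refine ⟨D.W.mul_mem hv.2 hu.1, ?_⟩
  have h1 := finrank_M_reflIn_mul (ne_zero_of_mem_unitRoots hv) hvM
  have h2 := finrank_M_mul_le (reflIn v * u) ((reflIn v * u)⁻¹ * D.c)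
  rw [mul_inv_cancel_left, finrank_M_c] at h2
  have h3 : (reflIn v * u)⁻¹ * D.c = reflIn (u⁻¹ v) * (u⁻¹ * D.c) := by
    rw [reflIn_conj u⁻¹ hv.1, mul_inv_rev, reflIn_inv]
    group
  have h4 := finrank_M_mul_le (reflIn (u⁻¹ v)) (u⁻¹ * D.c)
  rw [← h3, finrank_M_reflIn (ne_zero_of_mem_unitRoots
    (apply_mem_unitRoots (D.W.inv_mem hu.1) hv))] at h4
  omega

theorem form_eq_zero_of_mem_M_reflIn_mul {u : Iso n} (hu : u ∈ D.NCP) {v : Euc n}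
    (hv : v ∈ D.unitRoots) (hvM : v ∈ M u) {x : Euc n} (hx : x ∈ M (reflIn v * u)) :
    D.form v x = 0 := by
  refine inner_eq_zero_of_mem_M ?_ hx
  have h1 := mem_fixSpace.1 (mu_mem_fixSpace hu hvM)
  have h2 : u (D.mu v) = D.c (D.mu v) := by
    nth_rewrite 1 [← h1]
    rw [← iso_mul_apply, mul_inv_cancel_left]
  rw [mem_fixSpace, iso_mul_apply, h2, c_mu, map_sub, map_smul, reflIn_self,
    reflIn_apply hv.1, real_inner_comm, ← form, form_self hv]
  module

/-- The roots of a simple system, in the order of the sequence `ρ`, form a triangular system for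
the form. Indeed the first positive root `γ` of `M u` is simple, it pairs nonnegatively with the
positive roots of `M u`, and those that pair to zero span the hyperplane `M (R(γ) u)` of `M u`.
Hence all other simple roots pair to zero with `γ` and make up the simple system of `R(γ) u`. -/
theorem form_eq_zero_of_mem_simpleSystem (k : ℕ) : ∀ u ∈ D.NCP, Module.finrank ℝ (M u) = k →
    ∀ i j : ℤ, 1 ≤ i → i < j → j ≤ D.numRefl → D.rho i ∈ D.simpleSystem u →
      D.rho j ∈ D.simpleSystem u → D.form (D.rho i) (D.rho j) = 0 := by
  induction k with
  | zero =>
    intro u hu hk i j _ _ _ hi _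
    have hmem := ((mem_parabolicPosRoots_iff hu.1).1 hi.1).2.1
    rw [Submodule.finrank_eq_zero.1 hk, Submodule.mem_bot] at hmem
    exact absurd hmem (ne_zero_of_mem_unitRoots (rho_mem i))
  | succ k ih =>
    classical
    intro u hu hk i j hi1 hij hjN hi hj
    have huW := hu.1
    set T := (Finset.Icc 1 D.numRefl).filter fun m => D.rho m ∈ D.parabolicPosRoots u with hT
    have hiT : i ∈ T := by
      rw [hT, Finset.mem_filter, Finset.mem_Icc]
      exact ⟨⟨hi1, by omega⟩, hi.1⟩
    obtain ⟨hmT, hmin⟩ : T.min' ⟨i, hiT⟩ ∈ T ∧ ∀ m' ∈ T, T.min' ⟨i, hiT⟩ ≤ m' :=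
      ⟨T.min'_mem _, fun m' hm' => T.min'_le m' hm'⟩
    set m := T.min' ⟨i, hiT⟩ with hm
    rw [hT, Finset.mem_filter, Finset.mem_Icc] at hmT
    obtain ⟨⟨hm1, hmN⟩, hmP⟩ := hmT
    obtain ⟨hγ, hγM, hγp⟩ := (mem_parabolicPosRoots_iff huW).1 hmP
    have hlater : ∀ x ∈ D.parabolicPosRoots u, ∃ l, m ≤ l ∧ l ≤ D.numRefl ∧ D.rho l = x := by
      intro x hx
      obtain ⟨hx1, -, hx3⟩ := (mem_parabolicPosRoots_iff huW).1 hx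
      obtain ⟨l, hl1, hlN, rfl⟩ := exists_rho_eq_of_isPositive hx1 hx3
      refine ⟨l, hmin l ?_, hlN, rfl⟩
      rw [hT, Finset.mem_filter, Finset.mem_Icc]
      exact ⟨⟨hl1, hlN⟩, hx⟩
    have hγnn : ∀ x ∈ D.parabolicPosRoots u, 0 ≤ D.form (D.rho m) x := by
      intro x hx
      obtain ⟨l, hl, hlN, rfl⟩ := hlater x hx
      exact form_rho_nonneg hm1 hl hlN
    have hγS : D.rho m ∈ D.simpleSystem u := by
      refine ⟨hmP, fun hmem => ?_⟩
      have h1 := nonneg_of_mem_hull (f := -D.formR (D.rho m)) (fun x hx => by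
        obtain ⟨l, hl, hlN, rfl⟩ := hlater x hx.1
        have hne : l ≠ m := by
          rintro rfl
          exact hx.2 rfl
        have := form_rho_nonpos hm1 (lt_of_le_of_ne hl (Ne.symm hne)) hlN
        rw [LinearMap.neg_apply, formR_apply]
        linarith) hmem
      rw [LinearMap.neg_apply, formR_apply, form_self hγ] at h1
      linarith
    set u' := reflIn (D.rho m) * u with hu'
    have hu'N : u' ∈ D.NCP := reflIn_mul_mem_NCP hu hγ hγM
    have hdim : Module.finrank ℝ (M u') = k := by
      rw [hu']
      have := finrank_M_reflIn_mul (ne_zero_of_mem_unitRoots hγ) hγM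
      omega
    have hMle : M u' ≤ M u := by
      rw [M_eq_orthogonal_fixSpace, M_eq_orthogonal_fixSpace]
      exact Submodule.orthogonal_le (fixSpace_le_fixSpace_reflIn_mul hγM)
    have hPle : D.parabolicPosRoots u' ⊆ D.parabolicPosRoots u := by
      intro x hx
      obtain ⟨h1, h2, h3⟩ := (mem_parabolicPosRoots_iff hu'N.1).1 hx
      exact (mem_parabolicPosRoots_iff huW).2 ⟨h1, hMle h2, h3⟩
    set Γ := {x ∈ D.simpleSystem u | D.formL (D.rho m) x = 0} with hΓ
    have hΓsub : Γ ⊆ D.simpleSystem u := fun x hx => hx.1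
    have hspan : M u' ≤ Submodule.span ℝ Γ := by
      rw [← span_parabolicPosRoots hu'N.1, Submodule.span_le]
      intro x hx
      refine mem_span_zeros_of_mem_hull (fun v hv => hγnn v hv.1)
        (parabolicPosRoots_subset_hull huW (hPle hx)) ?_
      exact form_eq_zero_of_mem_M_reflIn_mul hu hγ hγM ((mem_parabolicPosRoots_iff hu'N.1).1 hx).2.1
    have hcard := finrank_span_of_subset_simpleSystem huW hΓsub
    have hfin := D.finite_simpleSystem u
    have hsub2 : Γ ⊆ D.simpleSystem u \ {D.rho m} := by
      intro x hx
      refine ⟨hx.1, fun h => ?_⟩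
      rw [Set.mem_singleton_iff] at h
      have h1 := hx.2
      rw [h, formL_apply, form_self hγ] at h1
      exact one_ne_zero h1
    have hcard2 : (D.simpleSystem u \ {D.rho m}).ncard = k := by
      have := Set.ncard_sdiff_singleton_add_one hγS hfin
      rw [ncard_simpleSystem huW] at this
      omega
    have hle1 := Submodule.finrank_mono hspan
    have heq : Γ = D.simpleSystem u \ {D.rho m} :=
      Set.eq_of_subset_of_ncard_le hsub2 (by omega) hfin.sdiff
    have hspan_eq : M u' = Submodule.span ℝ Γ := by
      refine Submodule.eq_of_le_of_finrank_eq hspan ?_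
      rw [hcard, heq, hcard2, hdim]
    have hmi := hmin i hiT
    have hjΓ : D.rho j ∈ Γ := by
      rw [heq]
      refine ⟨hj, fun h => ?_⟩
      have := rho_injOn (by omega) hjN hm1 hmN h
      omega
    rcases hmi.eq_or_lt with h | hlt
    · rw [← h]
      exact hjΓ.2
    · have hiΓ : D.rho i ∈ Γ := by
        rw [heq]
        refine ⟨hi, fun h => ?_⟩
        have := rho_injOn hi1 (by omega) hm1 hmN h
        omega
      have hΓ' : ∀ x ∈ Γ, x ∈ D.simpleSystem u' := by
        intro x hx
        obtain ⟨h1, -, h3⟩ := (mem_parabolicPosRoots_iff huW).1 hx.1.1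
        refine ⟨(mem_parabolicPosRoots_iff hu'N.1).2
          ⟨h1, hspan_eq ▸ Submodule.subset_span hx, h3⟩, fun hmem => hx.1.2 ?_⟩
        exact Submodule.span_mono (Set.sdiff_subset_sdiff_left hPle) hmem
      exact ih u' hu'N hdim i j hi1 hij hjN (hΓ' _ hiΓ) (hΓ' _ hjΓ)

end BipartiteReflectionGroup

/-! ### Lexicographic comparison of finite sets -/

section Lexicographic

/-- If one strictly increasing list is lexicographically smaller than another one, then all its
entries occur in the other list, or it has an entry that does not, below which both lists agree. -/
theorem exists_of_list_lt {l₁ l₂ : List ℤ} (h₁ : l₁.Pairwise (· < ·)) (h₂ : l₂.Pairwise (· < ·))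
    (h : l₁ < l₂) : (∀ x ∈ l₁, x ∈ l₂) ∨
      ∃ a ∈ l₁, a ∉ l₂ ∧ ∀ x < a, x ∈ l₁ ↔ x ∈ l₂ := by
  replace h : List.Lex (· < ·) l₁ l₂ := h
  induction h with
  | nil => exact Or.inl (by simp)
  | @cons a l₁ l₂ _ ih =>
    rw [List.pairwise_cons] at h₁ h₂
    rcases ih h₁.2 h₂.2 with h | ⟨b, hb, hb', hx⟩
    · refine Or.inl fun x hx => ?_
      rcases List.mem_cons.1 hx with rfl | hx
      · simp
      · exact List.mem_cons_of_mem _ (h x hx)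
    · refine Or.inr ⟨b, List.mem_cons_of_mem _ hb, ?_, fun x hxb => ?_⟩
      · rw [List.mem_cons, not_or]
        exact ⟨(h₁.1 b hb).ne', hb'⟩
      · rw [List.mem_cons, List.mem_cons, hx x hxb]
  | @rel a l₁ b l₂ hab =>
    rw [List.pairwise_cons] at h₁ h₂
    refine Or.inr ⟨a, by simp, fun h => ?_, fun x hx => ?_⟩
    · rcases List.mem_cons.1 h with rfl | h
      · exact lt_irrefl _ hab
      · exact lt_asymm hab (h₂.1 a h)
    · constructor
      · intro h
        rcases List.mem_cons.1 h with rfl | h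
        · exact absurd hx (lt_irrefl _)
        · exact absurd hx (lt_asymm (h₁.1 x h))
      · intro h
        rcases List.mem_cons.1 h with rfl | h
        · exact absurd hx (lt_asymm hab)
        · exact absurd hx (lt_asymm (hab.trans (h₂.1 x h)))

theorem exists_of_sort_lt {I J : Finset ℤ} (h : I.sort < J.sort) :
    I ⊆ J ∨ ∃ a ∈ I, a ∉ J ∧ ∀ x < a, x ∈ I ↔ x ∈ J := by
  have := exists_of_list_lt I.sortedLT_sort.pairwise J.sortedLT_sort.pairwise h
  simp only [Finset.mem_sort] at this
  exact this

end Lexicographic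

/-! ### The first and the last facet -/

namespace BipartiteReflectionGroup

variable {n : ℕ} {D : BipartiteReflectionGroup n}

theorem mem_X_iff {u : Iso n} (I : Finset ℤ) : I ∈ D.X u ↔
    (∀ i ∈ I, 1 ≤ i ∧ i ≤ D.numRefl ∧ D.rho i ∈ M u) ∧
      ∀ i ∈ I, ∀ j ∈ I, i < j → D.form (D.rho j) (D.rho i) = 0 := by
  rw [X, Set.mem_ofPred_eq, mem_EX_iff]
  constructor
  · rintro ⟨⟨h1, h2⟩, h3⟩
    refine ⟨fun i hi => ?_, h2⟩
    have h4 := (isPositive_rho_iff (h1 i hi).1 (h1 i hi).2).1 (h3 i hi).1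
    exact ⟨h4.1, h4.2, (h3 i hi).2⟩
  · rintro ⟨h1, h2⟩
    refine ⟨⟨fun i hi => ?_, h2⟩, fun i hi => ⟨isPositive_rho (h1 i hi).1 (h1 i hi).2.1,
      (h1 i hi).2.2⟩⟩
    have := D.s_le
    have := h1 i hi
    omega

theorem rho_mem_parabolicPosRoots {u : Iso n} (hu : u ∈ D.W) {i : ℤ} (h1 : 1 ≤ i)
    (h2 : i ≤ D.numRefl) (hM : D.rho i ∈ M u) : D.rho i ∈ D.parabolicPosRoots u :=
  (mem_parabolicPosRoots_iff hu).2 ⟨rho_mem i, hM, isPositive_rho h1 h2⟩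

/-- Simplices consist of linearly independent roots, so one with `dim M u` vertices is maximal. -/
theorem isFacet_of_card {u : Iso n} {I : Finset ℤ} (hI : I ∈ D.X u)
    (hcard : I.card = Module.finrank ℝ (M u)) : IsFacet (D.X u) I := by
  refine ⟨hI, fun J hJ hIJ => ?_⟩
  have h1 := card_le_of_mem_EX hJ.1 fun i hi => (hJ.2 i hi).2
  rw [← hcard] at h1
  exact (Finset.eq_of_subset_of_card_le hIJ h1).ge

/-- A facet that is lexicographically smaller than `I` has a vertex outside `I`, all of whose
predecessors it shares with `I`. By the signs of the form, this vertex could be added to `I`. -/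
theorem isFirstFacet_of_form_nonneg {u : Iso n} (hu : u ∈ D.W) {I : Finset ℤ}
    (hI : ∀ i ∈ I, 1 ≤ i ∧ i ≤ D.numRefl ∧ D.rho i ∈ M u)
    (hcard : I.card = Module.finrank ℝ (M u))
    (hnn : ∀ i ∈ I, ∀ x ∈ D.parabolicPosRoots u, 0 ≤ D.form (D.rho i) x) :
    IsFirstFacet (D.X u) I := by
  have hlater : ∀ i ∈ I, ∀ j, 1 ≤ j → j < i → D.rho j ∈ M u →
      D.form (D.rho i) (D.rho j) = 0 := by
    intro i hi j hj1 hji hjM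
    obtain ⟨-, h2, -⟩ := hI i hi
    exact le_antisymm (form_rho_nonpos hj1 hji h2)
      (hnn i hi _ (rho_mem_parabolicPosRoots hu hj1 (by omega) hjM))
  have hX : I ∈ D.X u := (mem_X_iff I).2
    ⟨hI, fun i hi j hj hij => hlater j hj i (hI i hi).1 hij (hI i hi).2.2⟩
  have hfacet := isFacet_of_card hX hcard
  refine ⟨hfacet, fun J hJ => not_lt.1 fun hlt => ?_⟩
  rcases exists_of_sort_lt hlt with hsub | ⟨a, haJ, haI, hbelow⟩
  · rw [(hJ.eq_of_ge hX hsub)] at hlt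
    exact lt_irrefl _ hlt
  · obtain ⟨hJ1, hJ2⟩ := (mem_X_iff J).1 hJ.prop
    obtain ⟨ha1, haN, haM⟩ := hJ1 a haJ
    have hins : insert a I ∈ D.X u := by
      refine (mem_X_iff _).2 ⟨?_, ?_⟩
      · intro i hi
        rcases Finset.mem_insert.1 hi with rfl | hi
        · exact ⟨ha1, haN, haM⟩
        · exact hI i hi
      · intro i hi j hj hij
        rcases Finset.mem_insert.1 hi with rfl | hi' <;>
          rcases Finset.mem_insert.1 hj with rfl | hj'
        · exact absurd hij (lt_irrefl _)
        · exact hlater j hj' i ha1 hij haM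
        · exact hJ2 i ((hbelow i hij).2 hi') j haJ hij
        · exact hlater j hj' i (hI i hi').1 hij (hI i hi').2.2
    exact haI (hfacet.2 hins (Finset.subset_insert a I) (Finset.mem_insert_self a I))

/-- If `I` is lexicographically smaller than another facet, then `I` has a vertex outside that
facet, all of whose predecessors they share. By the signs of the form, this vertex could be added
to that facet. -/
theorem isLastFacet_of_form_nonneg {u : Iso n} (hu : u ∈ D.W) {I : Finset ℤ}
    (hI : ∀ i ∈ I, 1 ≤ i ∧ i ≤ D.numRefl ∧ D.rho i ∈ M u)
    (hcard : I.card = Module.finrank ℝ (M u))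
    (hnn : ∀ i ∈ I, ∀ x ∈ D.parabolicPosRoots u, 0 ≤ D.form x (D.rho i)) :
    IsLastFacet (D.X u) I := by
  have hearlier : ∀ i ∈ I, ∀ j, i < j → j ≤ D.numRefl → D.rho j ∈ M u →
      D.form (D.rho j) (D.rho i) = 0 := by
    intro i hi j hij hjN hjM
    obtain ⟨h1, -, -⟩ := hI i hi
    exact le_antisymm (form_rho_nonpos h1 hij hjN)
      (hnn i hi _ (rho_mem_parabolicPosRoots hu (by omega) hjN hjM))
  have hX : I ∈ D.X u := (mem_X_iff I).2
    ⟨hI, fun i hi j hj hij => hearlier i hi j hij (hI j hj).2.1 (hI j hj).2.2⟩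
  have hfacet := isFacet_of_card hX hcard
  refine ⟨hfacet, fun J hJ => not_lt.1 fun hlt => ?_⟩
  rcases exists_of_sort_lt hlt with hsub | ⟨a, haI, haJ, hbelow⟩
  · rw [(hfacet.eq_of_ge hJ.prop hsub)] at hlt
    exact lt_irrefl _ hlt
  · obtain ⟨hJ1, hJ2⟩ := (mem_X_iff J).1 hJ.prop
    have hins : insert a J ∈ D.X u := by
      refine (mem_X_iff _).2 ⟨?_, ?_⟩
      · intro i hi
        rcases Finset.mem_insert.1 hi with rfl | hi
        · exact hI i haI
        · exact hJ1 i hi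
      · intro i hi j hj hij
        rcases Finset.mem_insert.1 hi with rfl | hi' <;>
          rcases Finset.mem_insert.1 hj with rfl | hj'
        · exact absurd hij (lt_irrefl _)
        · exact hearlier i haI j hij (hJ1 j hj').2.1 (hJ1 j hj').2.2
        · exact hearlier i ((hbelow i hij).2 hi') j hij (hI j haI).2.1 (hI j haI).2.2
        · exact hJ2 i hi' j hj' hij
    exact haJ (hJ.2 hins (Finset.subset_insert a J) (Finset.mem_insert_self a J))

theorem form_eq_zero_of_mem_span {x y : Euc n} {s : Set (Euc n)} (h : ∀ v ∈ s, D.form x v = 0)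
    (hy : y ∈ Submodule.span ℝ s) : D.form x y = 0 := by
  have : Submodule.span ℝ s ≤ LinearMap.ker (D.formL x) := Submodule.span_le.2 h
  exact this hy

theorem form_eq_zero_of_mem_span_left {x y : Euc n} {s : Set (Euc n)}
    (h : ∀ v ∈ s, D.form v y = 0) (hx : x ∈ Submodule.span ℝ s) : D.form x y = 0 := by
  have : Submodule.span ℝ s ≤ LinearMap.ker (D.formR y) := Submodule.span_le.2 fun v hv => by
    rw [SetLike.mem_coe, LinearMap.mem_ker, formR_apply, h v hv]
  rw [← formR_apply]
  exact this hx

/-- The basis dual to a triangular system of roots `δ_1, …, δ_m` on the left of the form consists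
of roots, namely of `R(δ_1) ⋯ R(δ_{a-1}) δ_a`. -/
theorem exists_left_dual_root (K : Finset ℤ) :
    (∀ i ∈ K, ∀ j ∈ K, i < j → D.form (D.rho i) (D.rho j) = 0) → ∀ a ∈ K, ∃ x ∈ D.unitRoots,
      x ∈ Submodule.span ℝ (D.rho '' K) ∧ ∀ b ∈ K, D.form x (D.rho b) = if a = b then 1 else 0 := by
  classical
  induction K using Finset.induction_on_min with
  | empty => simp
  | insert m s hm ih =>
    intro htri a ha
    have hms : ∀ b ∈ s, D.form (D.rho m) (D.rho b) = 0 := fun b hb =>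
      htri m (Finset.mem_insert_self m s) b (Finset.mem_insert_of_mem hb) (hm b hb)
    rcases Finset.mem_insert.1 ha with rfl | has
    · refine ⟨D.rho a, rho_mem a, Submodule.subset_span ⟨a, by simp, rfl⟩, fun b hb => ?_⟩
      rcases Finset.mem_insert.1 hb with rfl | hb
      · rw [if_pos rfl, form_self (rho_mem _)]
      · rw [if_neg (hm b hb).ne, hms b hb]
    · obtain ⟨y, hy, hys, hyb⟩ := ih (fun i hi j hj => htri i (Finset.mem_insert_of_mem hi) j
        (Finset.mem_insert_of_mem hj)) a has
      have he := reflIn_apply (rho_mem (D := D) m).1 y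
      refine ⟨reflIn (D.rho m) y, apply_mem_unitRoots (rho_mem m).2 hy, ?_, fun b hb => ?_⟩
      · rw [he]
        refine Submodule.sub_mem _ (Submodule.span_mono (Set.image_mono (by simp)) hys)
          (Submodule.smul_mem _ _ (Submodule.subset_span ⟨m, by simp, rfl⟩))
      · rw [he, form_sub_left, form_smul_left]
        rcases Finset.mem_insert.1 hb with rfl | hb
        · have h1 : D.form (D.rho b) y = 0 := form_eq_zero_of_mem_span
            (by rintro _ ⟨j, hj, rfl⟩; exact hms j hj) hys
          have h2 := form_add_form_swap (D := D) (D.rho b) y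
          rw [form_self (rho_mem _), if_neg (hm a has).ne']
          linarith
        · rw [hyb b hb, hms b hb, mul_zero, sub_zero]

/-- The basis dual to a triangular system of roots `δ_1, …, δ_m` on the right of the form consists
of roots, namely of `R(δ_m) ⋯ R(δ_{a+1}) δ_a`. -/
theorem exists_right_dual_root (K : Finset ℤ) :
    (∀ i ∈ K, ∀ j ∈ K, i < j → D.form (D.rho i) (D.rho j) = 0) → ∀ a ∈ K, ∃ x ∈ D.unitRoots,
      x ∈ Submodule.span ℝ (D.rho '' K) ∧ ∀ b ∈ K, D.form (D.rho b) x = if a = b then 1 else 0 := by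
  classical
  induction K using Finset.induction_on_max with
  | empty => simp
  | insert m s hm ih =>
    intro htri a ha
    have hms : ∀ b ∈ s, D.form (D.rho b) (D.rho m) = 0 := fun b hb =>
      htri b (Finset.mem_insert_of_mem hb) m (Finset.mem_insert_self m s) (hm b hb)
    rcases Finset.mem_insert.1 ha with rfl | has
    · refine ⟨D.rho a, rho_mem a, Submodule.subset_span ⟨a, by simp, rfl⟩, fun b hb => ?_⟩
      rcases Finset.mem_insert.1 hb with rfl | hb
      · rw [if_pos rfl, form_self (rho_mem _)]
      · rw [if_neg (hm b hb).ne', hms b hb]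
    · obtain ⟨y, hy, hys, hyb⟩ := ih (fun i hi j hj => htri i (Finset.mem_insert_of_mem hi) j
        (Finset.mem_insert_of_mem hj)) a has
      have he := reflIn_apply (rho_mem (D := D) m).1 y
      refine ⟨reflIn (D.rho m) y, apply_mem_unitRoots (rho_mem m).2 hy, ?_, fun b hb => ?_⟩
      · rw [he]
        refine Submodule.sub_mem _ (Submodule.span_mono (Set.image_mono (by simp)) hys)
          (Submodule.smul_mem _ _ (Submodule.subset_span ⟨m, by simp, rfl⟩))
      · rw [he, form_sub_right, form_smul_right]
        rcases Finset.mem_insert.1 hb with rfl | hb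
        · have h1 : D.form y (D.rho b) = 0 := form_eq_zero_of_mem_span_left
            (by rintro _ ⟨j, hj, rfl⟩; exact hms j hj) hys
          have h2 := form_add_form_swap (D := D) (D.rho b) y
          rw [form_self (rho_mem _), if_neg (hm a has).ne]
          linarith
        · rw [hyb b hb, hms b hb, mul_zero, sub_zero]

/-- The indices of a simple system. -/
theorem exists_simpleSystem_index {u : Iso n} (hu : u ∈ D.NCP) : ∃ K : Finset ℤ,
    (∀ a ∈ K, 1 ≤ a ∧ a ≤ D.numRefl) ∧ D.rho '' K = D.simpleSystem u ∧
      K.card = (D.simpleSystem u).ncard ∧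
      ∀ i ∈ K, ∀ j ∈ K, i < j → D.form (D.rho i) (D.rho j) = 0 := by
  classical
  set K := (Finset.Icc 1 D.numRefl).filter fun m => D.rho m ∈ D.simpleSystem u with hK
  have hmem : ∀ a, a ∈ K ↔ (1 ≤ a ∧ a ≤ D.numRefl) ∧ D.rho a ∈ D.simpleSystem u := by
    intro a
    rw [hK, Finset.mem_filter, Finset.mem_Icc]
  have himg : D.rho '' K = D.simpleSystem u := by
    ext x
    constructor
    · rintro ⟨a, ha, rfl⟩
      exact ((hmem a).1 ha).2
    · intro hx
      obtain ⟨h1, -, h3⟩ := (mem_parabolicPosRoots_iff hu.1).1 hx.1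
      obtain ⟨a, ha1, haN, rfl⟩ := exists_rho_eq_of_isPositive h1 h3
      exact ⟨a, (hmem a).2 ⟨⟨ha1, haN⟩, hx⟩, rfl⟩
  refine ⟨K, fun a ha => ((hmem a).1 ha).1, himg, ?_, ?_⟩
  · rw [← himg, Set.InjOn.ncard_image, Set.ncard_coe_finset]
    intro a ha b hb hab
    obtain ⟨h1, -⟩ := (hmem a).1 ha
    obtain ⟨h2, -⟩ := (hmem b).1 hb
    exact rho_injOn h1.1 h1.2 h2.1 h2.2 hab
  · intro i hi j hj hij
    obtain ⟨h1, h2⟩ := (hmem i).1 hi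
    obtain ⟨h3, h4⟩ := (hmem j).1 hj
    exact form_eq_zero_of_mem_simpleSystem _ u hu rfl i j h1.1 hij h3.2 h2 h4

/-- The first facet of `X(u)` is dual to the simple system of `u` on the left of the form. -/
theorem exists_isFirstFacet {u : Iso n} (hu : u ∈ D.NCP) : ∃ (I : Finset ℤ) (d : ℤ → Euc n),
    IsFirstFacet (D.X u) I ∧ I.card = (D.simpleSystem u).ncard ∧ d '' I = D.simpleSystem u ∧
      ∀ i ∈ I, ∀ j ∈ I, D.form (D.rho i) (d j) = if i = j then 1 else 0 := by
  classical
  obtain ⟨K, hK, himg, hcard, htri⟩ := exists_simpleSystem_index hu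
  have hex : ∀ a ∈ K, ∃ i, (1 ≤ i ∧ i ≤ D.numRefl ∧ D.rho i ∈ M u) ∧
      ∀ b ∈ K, D.form (D.rho i) (D.rho b) = if a = b then 1 else 0 := by
    intro a ha
    obtain ⟨x, hx, hxs, hxb⟩ := exists_left_dual_root K htri a ha
    rw [himg, span_simpleSystem hu.1] at hxs
    have hxp : D.IsPositive x := by
      refine (isPositive_or_isPositive_neg hx).resolve_right fun hn => ?_
      have h1 := nonneg_of_mem_hull (f := D.formL x) (s := D.simpleSystem u) (fun v hv => by
        rw [← himg] at hv
        obtain ⟨b, hb, rfl⟩ := hv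
        rw [formL_apply, hxb b hb]
        split_ifs <;> norm_num) (parabolicPosRoots_subset_hull hu.1
          ((mem_parabolicPosRoots_iff hu.1).2 ⟨neg_mem_unitRoots hx, (M u).neg_mem hxs, hn⟩))
      rw [formL_apply, form_neg_right, form_self hx] at h1
      linarith
    obtain ⟨i, h1, h2, rfl⟩ := exists_rho_eq_of_isPositive hx hxp
    exact ⟨i, ⟨h1, h2, hxs⟩, hxb⟩
  choose! e he heb using hex
  have hinj : Set.InjOn e K := by
    intro a ha b hb hab
    have h1 := heb a ha b hb
    rw [hab, heb b hb b hb, if_pos rfl] at h1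
    by_contra hne
    rw [if_neg hne] at h1
    exact one_ne_zero h1
  have hcard' : (K.image e).card = K.card := Finset.card_image_of_injOn hinj
  set f := Function.invFunOn e (K : Set ℤ) with hf
  have hfe : ∀ a ∈ K, f (e a) = a := fun a ha => hinj.leftInvOn_invFunOn ha
  refine ⟨K.image e, fun i => D.rho (f i), ?_, by rw [hcard', hcard], ?_, ?_⟩
  · refine isFirstFacet_of_form_nonneg hu.1 ?_ ?_ ?_
    · intro i hi
      obtain ⟨a, ha, rfl⟩ := Finset.mem_image.1 hi
      exact he a ha
    · rw [hcard', hcard, ncard_simpleSystem hu.1]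
    · intro i hi x hx
      obtain ⟨a, ha, rfl⟩ := Finset.mem_image.1 hi
      refine nonneg_of_mem_hull (f := D.formL (D.rho (e a))) (fun v hv => ?_)
        (parabolicPosRoots_subset_hull hu.1 hx)
      rw [← himg] at hv
      obtain ⟨b, hb, rfl⟩ := hv
      rw [formL_apply, heb a ha b hb]
      split_ifs <;> norm_num
  · rw [← himg, Finset.coe_image, Set.image_image]
    exact Set.image_congr fun a ha => by rw [hfe a ha]
  · intro i hi j hj
    obtain ⟨a, ha, rfl⟩ := Finset.mem_image.1 hi
    obtain ⟨b, hb, rfl⟩ := Finset.mem_image.1 hj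
    change D.form (D.rho (e a)) (D.rho (f (e b))) = _
    rw [hfe b hb, heb a ha b hb]
    exact if_congr (hinj.eq_iff ha hb).symm rfl rfl

/-- The last facet of `X(u)` is dual to the simple system of `u` on the right of the form. -/
theorem exists_isLastFacet {u : Iso n} (hu : u ∈ D.NCP) : ∃ (I : Finset ℤ) (d : ℤ → Euc n),
    IsLastFacet (D.X u) I ∧ I.card = (D.simpleSystem u).ncard ∧ d '' I = D.simpleSystem u ∧
      ∀ i ∈ I, ∀ j ∈ I, D.form (d j) (D.rho i) = if i = j then 1 else 0 := by
  classical
  obtain ⟨K, hK, himg, hcard, htri⟩ := exists_simpleSystem_index hu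
  have hex : ∀ a ∈ K, ∃ i, (1 ≤ i ∧ i ≤ D.numRefl ∧ D.rho i ∈ M u) ∧
      ∀ b ∈ K, D.form (D.rho b) (D.rho i) = if a = b then 1 else 0 := by
    intro a ha
    obtain ⟨x, hx, hxs, hxb⟩ := exists_right_dual_root K htri a ha
    rw [himg, span_simpleSystem hu.1] at hxs
    have hxp : D.IsPositive x := by
      refine (isPositive_or_isPositive_neg hx).resolve_right fun hn => ?_
      have h1 := nonneg_of_mem_hull (f := D.formR x) (s := D.simpleSystem u) (fun v hv => by
        rw [← himg] at hv
        obtain ⟨b, hb, rfl⟩ := hv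
        rw [formR_apply, hxb b hb]
        split_ifs <;> norm_num) (parabolicPosRoots_subset_hull hu.1
          ((mem_parabolicPosRoots_iff hu.1).2 ⟨neg_mem_unitRoots hx, (M u).neg_mem hxs, hn⟩))
      rw [formR_apply, form_neg_left, form_self hx] at h1
      linarith
    obtain ⟨i, h1, h2, rfl⟩ := exists_rho_eq_of_isPositive hx hxp
    exact ⟨i, ⟨h1, h2, hxs⟩, hxb⟩
  choose! e he heb using hex
  have hinj : Set.InjOn e K := by
    intro a ha b hb hab
    have h1 := heb a ha b hb
    rw [hab, heb b hb b hb, if_pos rfl] at h1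
    by_contra hne
    rw [if_neg hne] at h1
    exact one_ne_zero h1
  have hcard' : (K.image e).card = K.card := Finset.card_image_of_injOn hinj
  set f := Function.invFunOn e (K : Set ℤ) with hf
  have hfe : ∀ a ∈ K, f (e a) = a := fun a ha => hinj.leftInvOn_invFunOn ha
  refine ⟨K.image e, fun i => D.rho (f i), ?_, by rw [hcard', hcard], ?_, ?_⟩
  · refine isLastFacet_of_form_nonneg hu.1 ?_ ?_ ?_
    · intro i hi
      obtain ⟨a, ha, rfl⟩ := Finset.mem_image.1 hi
      exact he a ha
    · rw [hcard', hcard, ncard_simpleSystem hu.1]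
    · intro i hi x hx
      obtain ⟨a, ha, rfl⟩ := Finset.mem_image.1 hi
      rw [← formR_apply]
      refine nonneg_of_mem_hull (f := D.formR (D.rho (e a))) (fun v hv => ?_)
        (parabolicPosRoots_subset_hull hu.1 hx)
      rw [← himg] at hv
      obtain ⟨b, hb, rfl⟩ := hv
      rw [formR_apply, heb a ha b hb]
      split_ifs <;> norm_num
  · rw [← himg, Finset.coe_image, Set.image_image]
    exact Set.image_congr fun a ha => by rw [hfe a ha]
  · intro i hi j hj
    obtain ⟨a, ha, rfl⟩ := Finset.mem_image.1 hi
    obtain ⟨b, hb, rfl⟩ := Finset.mem_image.1 hj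
    change D.form (D.rho (f (e b))) (D.rho (e a)) = _
    rw [hfe b hb, heb a ha b hb]
    exact if_congr (hinj.eq_iff ha hb).symm rfl rfl

end BipartiteReflectionGroup

/-! ### Simplicial cones -/

section SimplicialCone

variable {V : Type*} [NormedAddCommGroup V] [InnerProductSpace ℝ V]
  {ι : Type*} [Fintype ι] [DecidableEq ι] {r φ : ι → V}

theorem inner_sum_smul_of_dual
    (hdual : ∀ a b, inner ℝ (φ a) (r b) = if a = b then (1 : ℝ) else 0) (g : ι → ℝ) (a : ι) :
    inner ℝ (φ a) (∑ b, g b • r b) = g a := by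
  rw [inner_sum]
  simp_rw [real_inner_smul_right, hdual]
  simp

theorem linearIndependent_of_dual
    (hdual : ∀ a b, inner ℝ (φ a) (r b) = if a = b then (1 : ℝ) else 0) :
    LinearIndependent ℝ r := by
  rw [Fintype.linearIndependent_iff]
  intro g hg a
  rw [← inner_sum_smul_of_dual hdual g a, hg, inner_zero_right]

theorem sum_inner_smul_of_dual [FiniteDimensional ℝ V]
    (hdual : ∀ a b, inner ℝ (φ a) (r b) = if a = b then (1 : ℝ) else 0)
    (hcard : Fintype.card ι = Module.finrank ℝ V) (x : V) :
    ∑ a, inner ℝ (φ a) x • r a = x := by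
  have hspan := (linearIndependent_of_dual hdual).span_eq_top_of_card_eq_finrank' hcard
  have hx : x ∈ Submodule.span ℝ (Set.range r) := by rw [hspan]; trivial
  obtain ⟨g, rfl⟩ := (Submodule.mem_span_range_iff_exists_fun ℝ).1 hx
  simp_rw [inner_sum_smul_of_dual hdual]

/-- The cone cut out by the functionals of a dual basis is generated by the basis. -/
theorem eq_hull_of_dual [FiniteDimensional ℝ V]
    (hdual : ∀ a b, inner ℝ (φ a) (r b) = if a = b then (1 : ℝ) else 0)
    (hcard : Fintype.card ι = Module.finrank ℝ V) {K : PointedCone ℝ V}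
    (hK : ∀ x, x ∈ K ↔ ∀ a, 0 ≤ inner ℝ (φ a) x) : K = PointedCone.hull ℝ (Set.range r) := by
  refine le_antisymm (fun x hx => ?_) (Submodule.span_le.2 ?_)
  · rw [← sum_inner_smul_of_dual hdual hcard x]
    refine Submodule.sum_mem _ fun a _ => ?_
    exact Submodule.smul_mem _ (⟨_, (hK x).1 hx a⟩ : {c : ℝ // 0 ≤ c})
      (Submodule.subset_span ⟨a, rfl⟩)
  · rintro _ ⟨b, rfl⟩
    refine (hK _).2 fun a => ?_
    rw [hdual]
    split_ifs <;> norm_num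

theorem mem_hull_singleton_iff {v x : V} :
    x ∈ PointedCone.hull ℝ {v} ↔ ∃ t : ℝ, 0 ≤ t ∧ t • v = x := by
  rw [PointedCone.hull, Submodule.mem_span_singleton]
  constructor
  · rintro ⟨t, rfl⟩
    exact ⟨t, t.2, rfl⟩
  · rintro ⟨t, ht, rfl⟩
    exact ⟨⟨t, ht⟩, rfl⟩

theorem span_hull_singleton (v : V) :
    Submodule.span ℝ (PointedCone.hull ℝ {v} : Set V) = Submodule.span ℝ {v} := by
  refine le_antisymm (Submodule.span_le.2 fun x hx => mem_span_of_mem_hull hx)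
    (Submodule.span_mono PointedCone.subset_hull)

/-- The rays of the cone cut out by the functionals of a dual basis are the half-lines generated
by the basis vectors. -/
theorem isRay_iff_of_dual [FiniteDimensional ℝ V]
    (hdual : ∀ a b, inner ℝ (φ a) (r b) = if a = b then (1 : ℝ) else 0)
    (hcard : Fintype.card ι = Module.finrank ℝ V) {K : PointedCone ℝ V}
    (hK : ∀ x, x ∈ K ↔ ∀ a, 0 ≤ inner ℝ (φ a) x) (F : PointedCone ℝ V) :
    IsRay F K ↔ ∃ a, PointedCone.hull ℝ {r a} = F := by
  have hr : ∀ a, r a ∈ K := fun a => (hK _).2 fun b => by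
    rw [hdual]
    split_ifs <;> norm_num
  have hr0 : ∀ a, r a ≠ 0 := (linearIndependent_of_dual hdual).ne_zero
  constructor
  · rintro ⟨hF, hdim⟩
    obtain ⟨x, hx, hx0⟩ : ∃ x ∈ F, x ≠ 0 := by
      by_contra! h0
      have : Submodule.span ℝ (F : Set V) = ⊥ := Submodule.span_eq_bot.2 h0
      rw [this, finrank_bot] at hdim
      exact zero_ne_one hdim
    have hxK := (hK x).1 (hF.le hx)
    obtain ⟨a, ha⟩ : ∃ a, inner ℝ (φ a) x ≠ 0 := by
      by_contra! h0
      refine hx0 ?_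
      rw [← sum_inner_smul_of_dual hdual hcard x]
      exact Finset.sum_eq_zero fun a _ => by rw [h0 a, zero_smul]
    have hapos : 0 < inner ℝ (φ a) x := lt_of_le_of_ne (hxK a) (Ne.symm ha)
    -- `x` is the sum of a positive multiple of `r a` and of an element of the cone
    have hraF : r a ∈ F := by
      refine hF.mem_of_smul_add_mem (y := x - inner ℝ (φ a) x • r a) (hr a) ?_ hapos ?_
      · refine (hK _).2 fun b => ?_
        rw [inner_sub_right, real_inner_smul_right, hdual]
        split_ifs with h
        · rw [h]
          linarith
        · linarith [hxK b]
      · rwa [add_sub_cancel]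
    have hspan : Submodule.span ℝ {r a} = Submodule.span ℝ (F : Set V) := by
      refine Submodule.eq_of_le_of_finrank_eq (Submodule.span_mono (by simpa using hraF)) ?_
      rw [hdim, finrank_span_singleton (hr0 a)]
    refine ⟨a, le_antisymm (Submodule.span_le.2 (by simpa using hraF)) fun y hy => ?_⟩
    have hy' : y ∈ Submodule.span ℝ {r a} := hspan ▸ Submodule.subset_span hy
    obtain ⟨t, rfl⟩ := Submodule.mem_span_singleton.1 hy'
    have h1 := (hK _).1 (hF.le hy) a
    rw [real_inner_smul_right, hdual, if_pos rfl, mul_one] at h1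
    exact mem_hull_singleton_iff.2 ⟨t, h1, rfl⟩
  · rintro ⟨a, rfl⟩
    refine ⟨⟨Submodule.span_le.2 (by simpa using hr a), fun {x y c} hx hy hc h => ?_⟩, ?_⟩
    · obtain ⟨t, -, ht⟩ := mem_hull_singleton_iff.1 h
      refine mem_hull_singleton_iff.2 ⟨inner ℝ (φ a) x, (hK x).1 hx a, ?_⟩
      have h0 : ∀ b, b ≠ a → inner ℝ (φ b) x = 0 := by
        intro b hb
        have h1 := congrArg (inner ℝ (φ b)) ht
        rw [real_inner_smul_right, hdual, if_neg hb, mul_zero, inner_add_right,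
          real_inner_smul_right] at h1
        have h2 := (hK x).1 hx b
        have h3 := (hK y).1 hy b
        nlinarith
      conv_rhs => rw [← sum_inner_smul_of_dual hdual hcard x]
      rw [Finset.sum_eq_single a (fun b _ hb => by rw [h0 b hb, zero_smul]) (by simp)]
    · rw [span_hull_singleton, finrank_span_singleton (hr0 a)]

end SimplicialCone

/-! ### The rays of `F(w)` -/

namespace BipartiteReflectionGroup

variable {n : ℕ} {D : BipartiteReflectionGroup n}

theorem singleton_mem_muAX {i : ℤ} (hi : -(n : ℤ) + D.s + 1 ≤ i ∧ i ≤ D.numRefl + D.s) :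
    D.mu (D.cPlus (D.rho i)) ∈ complexVertices D.muAX := by
  refine ⟨{D.cPlus (D.rho i)}, ⟨{i}, (mem_EX_iff _).2 ⟨?_, ?_⟩, ?_⟩, ?_⟩
  · intro j hj
    rwa [Finset.mem_singleton.1 hj]
  · intro j hj k hk hjk
    rw [Finset.mem_singleton.1 hj, Finset.mem_singleton.1 hk] at hjk
    exact absurd hjk (lt_irrefl _)
  · rw [Finset.coe_singleton, Set.image_singleton]
  · rw [Set.image_singleton]

end BipartiteReflectionGroup

theorem mainTheorem5 {n : ℕ} (D : BipartiteReflectionGroup n) (w : Iso n) (hw : w ∈ D.NCP) :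
    IsUnit D.oneSubC ∧ D.c * w⁻¹ ∈ D.NCP ∧
    ∃ I J : Finset ℤ,
      IsFirstFacet (D.X (D.c * w⁻¹)) I ∧ IsLastFacet (D.X w) J ∧
      I.card = (D.simpleSystem (D.c * w⁻¹)).ncard ∧ J.card = (D.simpleSystem w).ncard ∧
      I.card + J.card = n ∧
      LinearIndependent ℝ (D.rayVector I J) ∧
      D.F w = PointedCone.hull ℝ (Set.range (D.rayVector I J)) ∧
      {r : PointedCone ℝ (Euc n) | IsRay r (D.F w)} =
        Set.range (fun a => PointedCone.hull ℝ {D.rayVector I J a}) ∧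
      ∀ a, D.rayVector I J a ∈ complexVertices D.muAX := by
  classical
  open BipartiteReflectionGroup in
  have hu := c_mul_inv_mem_NCP hw
  obtain ⟨I, d, hIfirst, hIcard, hId, hIdual⟩ := exists_isFirstFacet hu
  obtain ⟨J, e, hJlast, hJcard, hJe, hJdual⟩ := exists_isLastFacet hw
  have hsum : I.card + J.card = n := by
    have h1 := (mem_NCP_iff.1 hu).2
    rw [c_mul_inv_inv_mul_c, ← ncard_simpleSystem hu.1, ← ncard_simpleSystem hw.1] at h1
    omega
  obtain ⟨hI1, -⟩ := (mem_X_iff I).1 hIfirst.1.prop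
  obtain ⟨hJ1, -⟩ := (mem_X_iff J).1 hJlast.1.prop
  have hdmem : ∀ i ∈ I, d i ∈ D.simpleSystem (D.c * w⁻¹) := fun i hi => hId ▸ ⟨i, hi, rfl⟩
  have hemem : ∀ j ∈ J, e j ∈ D.simpleSystem w := fun j hj => hJe ▸ ⟨j, hj, rfl⟩
  have hcross : ∀ x y, x ∈ M (D.c * w⁻¹) → y ∈ M w → D.form x y = 0 := fun x y hx hy =>
    form_eq_zero_of_mem hu hx (by rwa [c_mul_inv_inv_mul_c])
  -- the functionals defining `F(w)`, indexed as the ray vectors to which they are dual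
  let φ : I ⊕ J → Euc n := Sum.elim (fun i => d i) fun j => -e j
  have hdual : ∀ a b, inner ℝ (φ a) (D.rayVector I J b) = if a = b then (1 : ℝ) else 0 := by
    rintro (⟨i, hi⟩ | ⟨j, hj⟩) (⟨i', hi'⟩ | ⟨j', hj'⟩)
    · simp only [φ, rayVector, Sum.elim_inl, Sum.inl.injEq, Subtype.mk.injEq]
      rw [real_inner_comm, ← form, hIdual i' hi' i hi]
      simp only [eq_comm]
    · simp only [φ, rayVector, Sum.elim_inl, Sum.elim_inr, reduceCtorEq, if_false]
      rw [real_inner_comm, ← form, form_c_left, neg_eq_zero]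
      exact hcross _ _ ((mem_parabolicPosRoots_iff hu.1).1 (hdmem i hi).1).2.1 (hJ1 j' hj').2.2
    · simp only [φ, rayVector, Sum.elim_inl, Sum.elim_inr, reduceCtorEq, if_false]
      rw [inner_neg_left, real_inner_comm, ← form, neg_eq_zero]
      exact hcross _ _ (hI1 i' hi').2.2 ((mem_parabolicPosRoots_iff hw.1).1 (hemem j hj).1).2.1
    · simp only [φ, rayVector, Sum.elim_inr, Sum.inr.injEq, Subtype.mk.injEq]
      rw [inner_neg_left, real_inner_comm, ← form, form_c_left, neg_neg, hJdual j' hj' j hj]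
      simp only [eq_comm]
  have hcard : Fintype.card (I ⊕ J) = Module.finrank ℝ (Euc n) := by
    rw [Fintype.card_sum, Fintype.card_coe, Fintype.card_coe, hsum, finrank_euclideanSpace_fin]
  have hF : ∀ x, x ∈ D.F w ↔ ∀ a, 0 ≤ inner ℝ (φ a) x := by
    intro x
    have h1 : x ∈ D.F w ↔ (∀ δ ∈ D.simpleSystem w, inner ℝ x δ ≤ 0) ∧
      ∀ θ ∈ D.simpleSystem (D.c * w⁻¹), 0 ≤ inner ℝ x θ := Iff.rfl
    rw [h1, ← hId, ← hJe, Sum.forall]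
    simp only [Set.forall_mem_image, Finset.mem_coe, φ, Sum.elim_inl, Sum.elim_inr,
      inner_neg_right, Subtype.forall, Left.nonneg_neg_iff, real_inner_comm x]
    exact and_comm
  refine ⟨D.isUnit_oneSubC, hu, I, J, hIfirst, hJlast, hIcard, hJcard, hsum,
    linearIndependent_of_dual hdual, eq_hull_of_dual hdual hcard hF, ?_, ?_⟩
  · ext r
    exact isRay_iff_of_dual hdual hcard hF r
  · -- `ε = c_+ (c_+ ε)` and `c η = c_+ (c_- η)`, where `c_+ ε` and `c_- η` are vertices of `EX(c)`
    rintro (⟨i, hi⟩ | ⟨j, hj⟩)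
    · obtain ⟨k, hk, he⟩ := exists_rho_eq_cPlus (rho_mem (D := D) i)
        (isPositive_rho (hI1 i hi).1 (hI1 i hi).2.1)
      have h1 := singleton_mem_muAX hk
      rwa [he, cPlus_cPlus] at h1
    · obtain ⟨k, hk, he⟩ := exists_rho_eq_cMinus (rho_mem (D := D) j)
        (isPositive_rho (hJ1 j hj).1 (hJ1 j hj).2.1)
      have h1 := singleton_mem_muAX hk
      rwa [he, ← iso_mul_apply, ← c_eq] at h1
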